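/- **Proposition (entropy stability for the Sakaguchi–Kuramoto model with a graphop and a frequency distribution).** Let $L>0$, let $U=[-\frac L2,\frac L2]$ be the one-dimensional flat torus of length $L$, let $\rho_\infty=\frac1L$, and let $D\in W^{2,\infty}(U)$ be a (periodic) interaction potential. Let $(\Omega,\mathcal A,\mu)$ be a probability space and let $A\in B_{2,2}(\Omega)$ be a graphop, i.e. (identified with its unique bounded extension) a bounded linear, positivity preserving, self-adjoint operator on the real space $L^2(\Omega,\mu)$, with numerical radius $n(A)=\sup\{(Af,f)_{L^2}: \|f\|_{L^2(\Omega)}=1\}$. Let $g\ge 0$ on $\mathbb R$ with $\|g\|_{L^1(\mathbb R)}=1$ be an arbitrary frequency density, and let $\kappa>0$, $\beta>0$. Consider $$\partial_t\rho=\partial_x\big(-\omega\rho+\kappa\rho\,V[A,g](\rho)\big)+\beta^{-1}\partial_{xx}\rho\quad (t>0),\qquad \rho(0)=\rho_0,$$ $$V[A,g](\rho)(t,x,\xi)=\int_{\mathbb R}\int_U \partial_xD(x-y)\,(A\rho)(t,y,\xi,\omega)\,dy\;g(\omega)\,d\omega ,$$ for $\rho=\rho(t,x,\xi,\omega)$,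 where $A$ acts on the network variable $\xi$ only (and is extended from $L^2(\Omega,\mu)$ to measurable functions $f$ as the limit in measure, if it exists, of $A$ applied to the truncations of $f$ to $[-n,n]$). Let $\rho_0$ be admissible: for $\mu\times g\,d\omega$-a.e. $(\xi,\omega)$ the function $\rho_0(\cdot,\xi,\omega)$ is a probability density on $U$ lying in $H^4(U)$, and $\rho_0(x,\cdot,\cdot)\in L^\infty(\mu\times g\,d\omega)$ for every $x$. Define $$\hat H_{g\times\mu}(\rho|\rho_\infty)=\int_{\mathbb R}\int_\Omega\int_U\rho\log\Big(\frac{\rho}{\rho_\infty}\Big)\,dx\,d\mu(\xi)\,g(\omega)\,d\omega$$ and assume $\hat H_{g\times\mu}(\rho_0|\rho_\infty)<\infty$ and $$\kappa<\frac{2\pi^2}{L^2\,\beta\,\|\partial_{xx}D\|_{L^\infty(U)}\,n(A)}$$ (no condition if the denominator is $0$). Then every classical solution $\rho$ with initial datum $\rho_0$ (for a.e. $(\xi,\omega)$: continuous on $[0,\infty)\times U$, with $\partial_t\rho,\partial_x\rho,\partial_{xx}\rho$ continuous on $(0,\infty)\times U$, and satisfying the equation pointwise) has $\hat H_{g\times\mu}(\rho(t)|\rho_\infty)<\infty$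 for all $t\ge0$ and satisfies $$\hat H_{g\times\mu}(\rho(t)|\rho_\infty)\le e^{-\hat\alpha t}\,\hat H_{g\times\mu}(\rho_0|\rho_\infty),\quad t\ge 0,\qquad \hat\alpha=\frac{4\pi^2}{L^2\beta}-2\kappa\,\|\partial_{xx}D\|_{L^\infty(U)}\,n(A)>0 .$$ -/

import Mathlib

open MeasureTheory Set Filter Topology
open scoped ENNReal

noncomputable section

namespace SakaguchiKuramoto

/-! ### The flat torus of length `L` and periodic Sobolev spaces

Functions on the one-dimensional torus `U = [-L/2, L/2]` are `L`-periodic functions on `ℝ`. -/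

/-- Lebesgue measure on one period `U` of the torus of length `L`. -/
def torus (L : ℝ) : Measure ℝ := volume.restrict (Ioc (-(L / 2)) (L / 2))

/-- `h` is the weak derivative of order `k` of the periodic function `f`: integration against
smooth periodic test functions. -/
structure IsWeakDeriv (L : ℝ) (k : ℕ) (f h : ℝ → ℝ) : Prop where
  periodic_left : Function.Periodic f L
  periodic_right : Function.Periodic h L
  integrable_left : Integrable f (torus L)
  integrable_right : Integrable h (torus L)
  integral_eq : ∀ φ : ℝ → ℝ, ContDiff ℝ (⊤ : ℕ∞) φ → Function.Periodic φ L →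
    ∫ x, f x * iteratedDeriv k φ x ∂(torus L) = (-1) ^ k * ∫ x, h x * φ x ∂(torus L)

/-- The Sobolev space `W^{k,p}(U)` of the torus; `W^{k,2}(U) = H^k(U)`. -/
def MemSobolev (L : ℝ) (k : ℕ) (p : ℝ≥0∞) (f : ℝ → ℝ) : Prop :=
  ∀ j ≤ k, ∃ h : ℝ → ℝ, IsWeakDeriv L j f h ∧ MemLp h p (torus L)

open Classical in
/-- The weak derivative of order `k` (unique up to null sets); `0` if there is none. -/
def weakDeriv (L : ℝ) (k : ℕ) (f : ℝ → ℝ) : ℝ → ℝ :=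
  if h : ∃ u : ℝ → ℝ, IsWeakDeriv L k f u then h.choose else 0

/-- The norm of `L^∞(U)`. -/
def supNorm (L : ℝ) (f : ℝ → ℝ) : ℝ := (eLpNorm f ⊤ (torus L)).toReal

/-- `f` is the density of an absolutely continuous probability measure on the torus. -/
structure IsProbDensity (L : ℝ) (f : ℝ → ℝ) : Prop where
  nonneg : ∀ᵐ x ∂(torus L), 0 ≤ f x
  integrable : Integrable f (torus L)
  integral_eq_one : ∫ x, f x ∂(torus L) = 1

/-! ### Graphops on `L²` -/

section Graphop

variable {Ω : Type*} [MeasurableSpace Ω] {μ : Measure Ω}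

/-- A graphop in `B_{2,2}(Ω)`, given by its bounded operator on the real space `L²(Ω, μ)`:
it preserves positivity and is self-adjoint. -/
structure IsGraphop (A : Lp ℝ 2 μ →L[ℝ] Lp ℝ 2 μ) : Prop where
  positive : ∀ f : Lp ℝ 2 μ, 0 ≤ f → 0 ≤ A f
  selfAdjoint : ∀ f g : Lp ℝ 2 μ, inner ℝ (A f) g = inner ℝ f (A g)

/-- The numerical radius `n(A) = sup {(A f, f) | ‖f‖ = 1}`. -/
def numericalRadius (A : Lp ℝ 2 μ →L[ℝ] Lp ℝ 2 μ) : ℝ :=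
  sSup {r : ℝ | ∃ f : Lp ℝ 2 μ, ‖f‖ = 1 ∧ r = inner ℝ (A f) f}

open Classical in
/-- `A f` for a square-integrable function `f` (and `0` for any other function). -/
def applyL2 (A : Lp ℝ 2 μ →L[ℝ] Lp ℝ 2 μ) (f : Ω → ℝ) : Ω → ℝ :=
  if h : MemLp f 2 μ then A (h.toLp f) else 0

/-- Truncation of a real number to `[-n, n]`. -/
def truncate (n : ℕ) (y : ℝ) : ℝ := max (-(n : ℝ)) (min y n)

/-- `w` is (a version of) `A f`, where `A` is extended from `L²` to measurable functions `f` by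
truncation. On `L²` this is `A f`, see `isImage_iff_of_memLp`. The extension is needed since
solutions are probability densities in `x` and are not assumed to be square-integrable in the
network variable. -/
structure IsImage (A : Lp ℝ 2 μ →L[ℝ] Lp ℝ 2 μ) (f w : Ω → ℝ) : Prop where
  aemeasurable : AEMeasurable f μ
  tendsto : TendstoInMeasure μ (fun n : ℕ => applyL2 A (fun ξ => truncate n (f ξ))) atTop w

theorem isImage_iff_of_memLp (A : Lp ℝ 2 μ →L[ℝ] Lp ℝ 2 μ) {f w : Ω → ℝ} (hf : MemLp f 2 μ) :
    IsImage A f w ↔ w =ᵐ[μ] A (hf.toLp f) := by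
  have hc : ∀ n : ℕ, Continuous (truncate n) := fun n => by unfold truncate; fun_prop
  have hm : ∀ n : ℕ, MemLp (fun ξ => truncate n (f ξ)) 2 μ := by
    intro n
    refine hf.mono ((hc n).comp_aestronglyMeasurable hf.1) (ae_of_all _ fun ξ => ?_)
    have hn : (0 : ℝ) ≤ n := Nat.cast_nonneg n
    rw [Real.norm_eq_abs, Real.norm_eq_abs, truncate]
    grind
  have hl : Tendsto (fun n : ℕ => ∫⁻ ξ, ‖truncate n (f ξ) - f ξ‖ₑ ^ (2 : ℝ) ∂μ) atTop (𝓝 0) := by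
    have h0 : ∫⁻ _ : Ω, (0 : ℝ≥0∞) ∂μ = 0 := by simp
    rw [← h0]
    refine tendsto_lintegral_of_dominated_convergence' (fun ξ => ‖f ξ‖ₑ ^ (2 : ℝ))
      (fun n => (((hm n).1.sub hf.1).enorm.pow_const _)) (fun n => ae_of_all _ fun ξ => ?_) ?_
      (ae_of_all _ fun ξ => ?_)
    · refine ENNReal.rpow_le_rpow (enorm_le_iff_norm_le.2 ?_) (by norm_num)
      have hn : (0 : ℝ) ≤ n := Nat.cast_nonneg n
      rw [Real.norm_eq_abs, Real.norm_eq_abs, truncate]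
      grind
    · have := lintegral_rpow_enorm_lt_top_of_eLpNorm_lt_top (p := 2) (by norm_num) (by norm_num)
        hf.2
      simpa using this.ne
    · obtain ⟨N, hN⟩ := exists_nat_ge |f ξ|
      refine tendsto_const_nhds.congr' ?_
      filter_upwards [eventually_ge_atTop N] with n hn
      have hn' : (N : ℝ) ≤ n := by exact_mod_cast hn
      have : truncate n (f ξ) = f ξ := by rw [truncate]; grind
      simp [this]
  have hL : Tendsto (fun n : ℕ => (hm n).toLp _) atTop (𝓝 (hf.toLp f)) := by
    rw [Lp.tendsto_Lp_iff_tendsto_eLpNorm'']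
    have h1 := hl.ennrpow_const (1 / 2 : ℝ)
    rw [ENNReal.zero_rpow_of_pos (by norm_num)] at h1
    refine h1.congr fun n => ?_
    rw [eLpNorm_eq_lintegral_rpow_enorm_toReal (by norm_num) (by norm_num)]
    simp
  have hA := tendstoInMeasure_of_tendsto_Lp ((A.continuous.tendsto _).comp hL)
  have hap : (fun n : ℕ => applyL2 A (fun ξ => truncate n (f ξ)))
      = fun n : ℕ => (A ((hm n).toLp _) : Ω → ℝ) := by
    funext n
    rw [applyL2, dif_pos (hm n)]
  constructor
  · intro h
    have h2 := h.tendsto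
    rw [hap] at h2
    exact tendstoInMeasure_ae_unique h2 hA
  · intro h
    refine ⟨hf.1.aemeasurable, ?_⟩
    rw [hap]
    exact hA.congr_right h.symm

end Graphop

/-! ### The mean-field model -/

section Model

variable {Ω : Type*} [MeasurableSpace Ω]

/-- The frequency distribution `g dω`. -/
def freqMeasure (g : ℝ → ℝ) : Measure ℝ := volume.withDensity fun ω => ENNReal.ofReal (g ω)

/-- The density `ρ log (ρ / ρ∞)` of the relative entropy with respect to `ρ∞ = 1 / L`,
as a function of `(x, ξ, ω)`. -/
def entropyDensity (L : ℝ) (ρ : ℝ → Ω → ℝ → ℝ) (z : ℝ × Ω × ℝ) : ℝ :=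
  ρ z.1 z.2.1 z.2.2 * Real.log (ρ z.1 z.2.1 z.2.2 / (1 / L))

/-- The averaged relative entropy is finite. -/
def FiniteEntropy (L : ℝ) (μ : Measure Ω) (g : ℝ → ℝ) (ρ : ℝ → Ω → ℝ → ℝ) : Prop :=
  Integrable (entropyDensity L ρ) ((torus L).prod (μ.prod (freqMeasure g)))

/-- The relative entropy averaged over the network variable and the frequency. -/
def entropy (L : ℝ) (μ : Measure Ω) (g : ℝ → ℝ) (ρ : ℝ → Ω → ℝ → ℝ) : ℝ :=
  ∫ z, entropyDensity L ρ z ∂((torus L).prod (μ.prod (freqMeasure g)))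

/-- Admissible initial data `ρ₀ (x, ξ, ω)`. -/
structure IsAdmissible (L : ℝ) (μ : Measure Ω) (g : ℝ → ℝ) (ρ₀ : ℝ → Ω → ℝ → ℝ) : Prop where
  aestronglyMeasurable : AEStronglyMeasurable (fun z : ℝ × Ω × ℝ => ρ₀ z.1 z.2.1 z.2.2)
    ((torus L).prod (μ.prod (freqMeasure g)))
  sobolev : ∀ᵐ p ∂(μ.prod (freqMeasure g)), MemSobolev L 4 2 fun x => ρ₀ x p.1 p.2
  density : ∀ᵐ p ∂(μ.prod (freqMeasure g)), IsProbDensity L fun x => ρ₀ x p.1 p.2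
  bounded : ∀ x, MemLp (fun p : Ω × ℝ => ρ₀ x p.1 p.2) ⊤ (μ.prod (freqMeasure g))

/-- Regularity of a classical solution `u (t, x)` for fixed network variable and frequency:
periodic in `x`, continuous on `[0, ∞) × U`, and with continuous `∂ₜ u`, `∂ₓ u`, `∂ₓₓ u` on
`(0, ∞) × U`. -/
structure IsClassicalFunction (L : ℝ) (u : ℝ → ℝ → ℝ) : Prop where
  periodic : ∀ t, 0 ≤ t → Function.Periodic (u t) L
  continuousOn : ContinuousOn (fun q : ℝ × ℝ => u q.1 q.2) (Ici 0 ×ˢ univ)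
  differentiableAt_time : ∀ t, 0 < t → ∀ x, DifferentiableAt ℝ (fun s => u s x) t
  continuousOn_deriv_time :
    ContinuousOn (fun q : ℝ × ℝ => deriv (fun s => u s q.2) q.1) (Ioi 0 ×ˢ univ)
  contDiff_space : ∀ t, 0 < t → ContDiff ℝ 2 (u t)
  continuousOn_deriv_space : ∀ k : ℕ, k ≤ 2 →
    ContinuousOn (fun q : ℝ × ℝ => iteratedDeriv k (u q.1) q.2) (Ioi 0 ×ˢ univ)

/-- `W` is a version of `A ρ`, where `A` acts on the network variable only: `W (t, x, ·, ω)` is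
`A` applied to `ρ (t, x, ·, ω)`, measurable in `(x, ξ, ω)` and integrable in `(x, ω)`. -/
structure IsNetworkImage (L : ℝ) (g : ℝ → ℝ) {μ : Measure Ω} (A : Lp ℝ 2 μ →L[ℝ] Lp ℝ 2 μ)
    (ρ W : ℝ → ℝ → Ω → ℝ → ℝ) : Prop where
  aestronglyMeasurable : ∀ t, 0 < t →
    AEStronglyMeasurable (fun z : ℝ × Ω × ℝ => W t z.1 z.2.1 z.2.2)
      ((torus L).prod (μ.prod (freqMeasure g)))
  isImage : ∀ t, 0 < t → ∀ᵐ q ∂((torus L).prod (freqMeasure g)),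
    IsImage A (fun ξ => ρ t q.1 ξ q.2) (fun ξ => W t q.1 ξ q.2)
  integrable : ∀ᵐ ξ ∂μ, ∀ t, 0 < t →
    Integrable (fun q : ℝ × ℝ => W t q.1 ξ q.2) ((torus L).prod (freqMeasure g))

/-- The Vlasov term `∫ (∂ₓ D * A ρ) g dω` at `(t, x, ξ)`, where `W = A ρ`. -/
def vlasov (L : ℝ) (D g : ℝ → ℝ) (W : ℝ → ℝ → Ω → ℝ → ℝ) (t x : ℝ) (ξ : Ω) : ℝ :=
  ∫ ω, ∫ y, weakDeriv L 1 D (x - y) * W t y ξ ω ∂(torus L) ∂(freqMeasure g)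

/-- `ρ (t, x, ξ, ω)` is a classical solution, for almost every `(ξ, ω)`, of
`∂ₜ ρ = ∂ₓ (-ω ρ + κ ρ V) + β⁻¹ ∂ₓₓ ρ` for `t > 0`, with `ρ (0) = ρ₀`, where
`V = ∫ (∂ₓ D * A ρ) g dω`. The differentiability of the flux `-ω ρ + κ ρ V` in `x` is part of the
equation. -/
structure IsClassicalSolution (L κ β : ℝ) (D g : ℝ → ℝ) {μ : Measure Ω}
    (A : Lp ℝ 2 μ →L[ℝ] Lp ℝ 2 μ) (ρ₀ : ℝ → Ω → ℝ → ℝ) (ρ : ℝ → ℝ → Ω → ℝ → ℝ) : Prop where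
  measurable : Measurable fun z : ℝ × ℝ × Ω × ℝ => ρ z.1 z.2.1 z.2.2.1 z.2.2.2
  regular : ∀ᵐ p ∂(μ.prod (freqMeasure g)), IsClassicalFunction L fun t x => ρ t x p.1 p.2
  initial : ∀ᵐ p ∂(μ.prod (freqMeasure g)), ∀ᵐ x ∂(torus L), ρ 0 x p.1 p.2 = ρ₀ x p.1 p.2
  equation : ∃ W : ℝ → ℝ → Ω → ℝ → ℝ, IsNetworkImage L g A ρ W ∧
    ∀ᵐ p ∂(μ.prod (freqMeasure g)), ∀ t, 0 < t → ∀ x,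
      HasDerivAt
        (fun y => -p.2 * ρ t y p.1 p.2 + κ * ρ t y p.1 p.2 * vlasov L D g W t y p.1)
        (deriv (fun s => ρ s x p.1 p.2) t
          - β⁻¹ * iteratedDeriv 2 (fun y => ρ t y p.1 p.2) x) x

end Model

end SakaguchiKuramoto

end

/-! For fixed `(ξ, ω)` the density `u` solves `∂ₜ u = ∂ₓ (u B) + β⁻¹ ∂ₓₓ u` with drift `B = -ω + κ
V`, so formally the relative entropy `H` satisfies `H' = -β⁻¹ ∫ u'² / u - ∫ u' B`. The logarithmic
Sobolev inequality on the circle (`integral_mul_log_le`), with its sharp constant, bounds the first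
term by `-4π² / (L² β) * H`. In the second term the constant `-ω` disappears. Two integrations by
parts move one more derivative onto `D`. Since `u - 1/L` has the same derivative as `u` and `∂ₓₓ D`
has mean zero, the rest is at most `κ ‖∂ₓₓ D‖_∞ ‖u - 1/L‖₁ ∫ |A ρ - A (1/L)|`
(`exists_vlasov_bound`).

Averaging over `(ξ, ω)` brings in the graphop. Let `r (ξ)` be the frequency average of the `L¹`
distance `‖ρ - 1/L‖₁`. Positivity gives `|A f| ≤ A |f|`, self-adjointness moves `A` to the other
factor, and the interaction is at most `(A r, r) ≤ n(A) ‖r‖²`. Jensen and Pinsker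
(`sq_integral_abs_sub_le`) give `‖r‖² ≤ 2 Ĥ`. Hence `Ĥ' ≤ -α̂ Ĥ`, and Grönwall's inequality finishes
the argument.

Four points make this rigorous. Positivity of `u` is not assumed at later times: it follows from
conservation of mass and the decay of the `L¹` norm (`IsAdvectionDiffusion.nonneg`). Since `u` may
vanish, the entropy of `u + ε` is differentiated instead, with errors that are uniform in `(ξ, ω)`
and vanish as `ε → 0`. Since `ρ` need not be square-integrable in `ξ`, the graphop estimate is
proved for truncations, weighted with a nonnegative `L²` function, and passed to the limit by Fatou
(`IsGraphop.lintegral_image_le`). Finally, the averaged entropy is not known to be finite for `t >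
0`, so the averaged argument is carried out with integrals in `[0, ∞]`; the trivial bound `‖u -
1/L‖₁ ≤ 2` supplies the a priori bound that Grönwall needs. -/

/-! ### Functional inequalities on the circle: Wirtinger, logarithmic Sobolev, Pinsker -/

/-- **Wirtinger's inequality** for functions with equal boundary values. -/
theorem wirtinger_of_hasDerivAt {a b : ℝ} (hab : a < b) {f f' : ℝ → ℝ} (hfab : f a = f b)
    (hf : ∀ x, HasDerivAt f (f' x) x) (hf' : Continuous f') :
    ∫ x in a..b, f x ^ 2 ≤
      (b - a)⁻¹ * (∫ x in a..b, f x) ^ 2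
        + ((b - a) / (2 * Real.pi)) ^ 2 * ∫ x in a..b, f' x ^ 2 := by
  have hfc : Continuous f := continuous_iff_continuousAt.2 fun x => (hf x).continuousAt
  have hba : 0 < b - a := by linarith
  have key : ∀ h : ℝ → ℝ, Continuous h →
      HasSum (fun i : ℤ => ‖fourierCoeffOn hab (fun x => (h x : ℂ)) i‖ ^ 2)
        ((b - a)⁻¹ * ∫ x in a..b, h x ^ 2) := by
    intro h hh
    have hc : Continuous fun x => (h x : ℂ) := Complex.continuous_ofReal.comp hh
    have hm : MemLp (fun x => (h x : ℂ)) 2 (volume.restrict (Ioc a b)) := by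
      obtain ⟨C, hC⟩ := (isCompact_Icc (a := a) (b := b)).exists_bound_of_continuousOn
        hc.continuousOn
      refine MemLp.of_bound hc.aestronglyMeasurable C ?_
      filter_upwards [ae_restrict_mem measurableSet_Ioc] with x hx
      exact hC x (Ioc_subset_Icc_self hx)
    simpa using hasSum_sq_fourierCoeffOn hab hm
  have h1 := key f hfc
  have h2 := key f' hf'
  -- Equal boundary values remove the boundary term, so the coefficients of `f` are those of `f'`
  -- divided by `2πin / (b - a)` up to sign, and `|n| ≥ 1`. Parseval then sums these bounds; the
  -- zero mode is the mean.
  have hcoef : ∀ n : ℤ, n ≠ 0 → ‖fourierCoeffOn hab (fun x => (f x : ℂ)) n‖ ^ 2 ≤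
      ((b - a) / (2 * Real.pi)) ^ 2 * ‖fourierCoeffOn hab (fun x => (f' x : ℂ)) n‖ ^ 2 := by
    intro n hn
    have h3 := fourierCoeffOn_of_hasDerivAt (f := fun x => (f x : ℂ)) (f' := fun x => (f' x : ℂ))
      hab hn (fun x _ => (hf x).ofReal_comp)
      ((Complex.continuous_ofReal.comp hf').intervalIntegrable _ _)
    have h4 : (f b : ℂ) - (f a : ℂ) = 0 := by rw [hfab]; ring
    rw [h4, mul_zero, zero_sub] at h3
    have hn1 : (1 : ℝ) ≤ |(n : ℝ)| := by
      rw [← Int.cast_abs]; exact_mod_cast Int.one_le_abs hn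
    rw [h3, ← mul_pow]
    refine pow_le_pow_left₀ (norm_nonneg _) ?_ 2
    have : ((b : ℂ) - (a : ℂ)) = ((b - a : ℝ) : ℂ) := by push_cast; ring
    rw [norm_mul, norm_neg, norm_mul, this, Complex.norm_real, Real.norm_of_nonneg hba.le]
    have h5 : ‖(1 / (-2 * (Real.pi : ℂ) * Complex.I * n) : ℂ)‖ ≤ 1 / (2 * Real.pi) := by
      rw [norm_div, norm_mul, norm_mul, norm_mul, norm_neg, norm_one, Complex.norm_I,
        Complex.norm_real, Complex.norm_intCast, Real.norm_of_nonneg Real.pi_pos.le]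
      have : ‖(2 : ℂ)‖ = 2 := by simp
      rw [this, mul_one]
      apply one_div_le_one_div_of_le (by positivity)
      nlinarith [Real.pi_pos]
    calc _ ≤ 1 / (2 * Real.pi) * ((b - a) * ‖fourierCoeffOn hab (fun x => (f' x : ℂ)) n‖) := by
          gcongr
      _ = _ := by ring
  have h0 : ‖fourierCoeffOn hab (fun x => (f x : ℂ)) 0‖ ^ 2
      = ((b - a)⁻¹ * ∫ x in a..b, f x) ^ 2 := by
    rw [fourierCoeffOn_eq_integral]
    have : ∫ x in a..b, (f x : ℂ) = ((∫ x in a..b, f x : ℝ) : ℂ) := by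
      rw [intervalIntegral.integral_ofReal]
    have hn : ‖(b : ℂ) - a‖ = b - a := by
      rw [← Complex.ofReal_sub, Complex.norm_real, Real.norm_of_nonneg hba.le]
    simp [this, mul_pow, hn]
  have h6 : HasSum (fun i : ℤ => (if i = 0 then ((b - a)⁻¹ * ∫ x in a..b, f x) ^ 2 else 0)
      + ((b - a) / (2 * Real.pi)) ^ 2 * ‖fourierCoeffOn hab (fun x => (f' x : ℂ)) i‖ ^ 2) _ :=
    (hasSum_ite_eq (0 : ℤ) _).add (h2.mul_left _)
  have h7 := hasSum_le (fun i => ?_) h1 h6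
  · have h8 := mul_le_mul_of_nonneg_left h7 hba.le
    rw [← mul_assoc, mul_inv_cancel₀ hba.ne', one_mul] at h8
    refine h8.trans_eq ?_
    field_simp
  · by_cases hi : i = 0
    · subst hi
      rw [if_pos rfl, h0]
      have : 0 ≤ ((b - a) / (2 * Real.pi)) ^ 2
        * ‖fourierCoeffOn hab (fun x => (f' x : ℂ)) 0‖ ^ 2 := by positivity
      linarith
    · rw [if_neg hi, zero_add]
      exact hcoef i hi

/-- The parabola touches the left side at `y = 1`. Its leading coefficient `5` is what later turns
into the factor `4 = 5 - 1` that matches Wirtinger's constant. Divided by `2 y ^ 2`, the gap has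
derivative `-(y - 1) (y - 3) / y ^ 3`: it falls to zero at `1`, rises up to `3` and falls again, so
only the endpoint needs numerics, where the gap is `1.875 - log 6`. -/
theorem two_mul_sq_mul_log_le {y : ℝ} (h0 : 0 < y) (h6 : y ≤ 6) :
    2 * y ^ 2 * Real.log y ≤ 5 * y ^ 2 - 8 * y + 3 := by
  set G : ℝ → ℝ := fun y => (5 - 8 * y⁻¹ + 3 * (y⁻¹) ^ 2) / 2 - Real.log y with hG
  have hd : ∀ z : ℝ, 0 < z → HasDerivAt G (-(z - 1) * (z - 3) / z ^ 3) z := by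
    intro z hz
    have h1 := hasDerivAt_inv hz.ne'
    have h2 := ((((h1.const_mul 8).const_sub 5).add ((h1.pow 2).const_mul 3)).div_const 2).sub
      (Real.hasDerivAt_log hz.ne')
    refine h2.congr_deriv ?_
    simp
    field_simp
    ring
  have hc : ∀ s : Set ℝ, (∀ z ∈ s, 0 < z) → ContinuousOn G s := fun s hs z hz =>
    (hd z (hs z hz)).continuousAt.continuousWithinAt
  have hG1 : G 1 = 0 := by simp [hG]; norm_num
  have hG6 : 0 ≤ G 6 := by
    have : Real.log 6 ≤ 1.8 := by
      rw [Real.log_le_iff_le_exp (by norm_num)]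
      have h1 : (2.7182 : ℝ) ≤ Real.exp 1 := by have := Real.exp_one_gt_d9; linarith
      have h2 : (1.22 : ℝ) ≤ Real.exp 0.2 := by
        have := Real.quadratic_le_exp_of_nonneg (x := 0.2) (by norm_num)
        norm_num at this ⊢; linarith
      have h3 : Real.exp 1.8 * Real.exp 0.2 = Real.exp 1 * Real.exp 1 := by
        rw [← Real.exp_add, ← Real.exp_add]; norm_num
      have h5 : Real.exp 0.2 ≤ 1.23 := by
        have h := Real.exp_bound_div_one_sub_of_interval (x := 0.2) (by norm_num) (by norm_num)
        have h' : Real.exp 0.2 ^ 5 = Real.exp 1 := by rw [← Real.exp_nat_mul]; norm_num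
        by_contra hcon
        push Not at hcon
        have : (1.23 : ℝ) ^ 5 < Real.exp 0.2 ^ 5 := by gcongr
        have := Real.exp_one_lt_d9
        rw [h'] at *
        norm_num at *
        linarith
      nlinarith [Real.exp_pos 1.8]
    simp only [hG]; norm_num at this ⊢; linarith
  have hGy : 0 ≤ G y := by
    rcases le_total y 1 with h1 | h1
    · have : AntitoneOn G (Ioc 0 1) := by
        refine antitoneOn_of_deriv_nonpos (convex_Ioc _ _) (hc _ fun z hz => hz.1) ?_ ?_
        · intro z hz; rw [interior_Ioc] at hz
          exact (hd z hz.1).differentiableAt.differentiableWithinAt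
        · intro z hz; rw [interior_Ioc] at hz
          rw [(hd z hz.1).deriv]
          have := hz.1; have := hz.2
          apply div_nonpos_of_nonpos_of_nonneg _ (by positivity)
          nlinarith
      have := this ⟨h0, h1⟩ ⟨one_pos, le_rfl⟩ h1
      linarith
    · rcases le_total y 3 with h3 | h3
      · have : MonotoneOn G (Icc 1 3) := by
          refine monotoneOn_of_deriv_nonneg (convex_Icc _ _)
            (hc _ fun z hz => by linarith [hz.1]) ?_ ?_
          · intro z hz; rw [interior_Icc] at hz
            exact (hd z (by linarith [hz.1])).differentiableAt.differentiableWithinAt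
          · intro z hz; rw [interior_Icc] at hz
            rw [(hd z (by linarith [hz.1])).deriv]
            have := hz.1; have := hz.2
            have : 0 < z := by linarith
            apply div_nonneg _ (by positivity)
            nlinarith
        have := this ⟨le_rfl, by norm_num⟩ ⟨h1, h3⟩ h1
        linarith
      · have : AntitoneOn G (Icc 3 6) := by
          refine antitoneOn_of_deriv_nonpos (convex_Icc _ _)
            (hc _ fun z hz => by linarith [hz.1]) ?_ ?_
          · intro z hz; rw [interior_Icc] at hz
            exact (hd z (by linarith [hz.1])).differentiableAt.differentiableWithinAt
          · intro z hz; rw [interior_Icc] at hz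
            rw [(hd z (by linarith [hz.1])).deriv]
            have := hz.1; have := hz.2
            have : 0 < z := by linarith
            apply div_nonpos_of_nonpos_of_nonneg _ (by positivity)
            nlinarith
        have := this ⟨h3, h6⟩ ⟨by norm_num, le_rfl⟩ h6
        linarith
  have h9 : 0 ≤ 2 * y ^ 2 * G y := by positivity
  have h10 : 2 * y ^ 2 * G y = 5 * y ^ 2 - 8 * y + 3 - 2 * y ^ 2 * Real.log y := by
    simp only [hG]; field_simp
  linarith

/-- The logarithm lies below its tangent at `11`, the value of `1 + 2 * z` at `z = 5`, where the
inequality is nearly tight: `log 11 ≤ 2.5` and `25 / 9.95 > 2.51`. -/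
theorem log_one_add_two_mul_le {z : ℝ} (hz : 5 ≤ z) :
    Real.log (1 + 2 * z) ≤ z ^ 2 / Real.pi ^ 2 := by
  have h11 : Real.log 11 ≤ 2.5 := by
    rw [Real.log_le_iff_le_exp (by norm_num)]
    have h1 : (2.7182 : ℝ) ≤ Real.exp 1 := by have := Real.exp_one_gt_d9; linarith
    have h2 : Real.exp 2.5 ^ 2 = Real.exp 1 ^ 5 := by
      rw [← Real.exp_nat_mul, ← Real.exp_nat_mul]; norm_num
    have h3 : (2.7182 : ℝ) ^ 5 ≤ Real.exp 1 ^ 5 := by gcongr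
    by_contra hcon
    push Not at hcon
    have h4 : Real.exp 2.5 ^ 2 < 11 ^ 2 := by gcongr
    norm_num at *
    linarith
  have h12 : Real.log (1 + 2 * z) = Real.log 11 + Real.log ((1 + 2 * z) / 11) := by
    rw [← Real.log_mul (by norm_num) (by positivity)]; congr 1; ring
  have h13 : Real.log ((1 + 2 * z) / 11) ≤ (1 + 2 * z) / 11 - 1 :=
    Real.log_le_sub_one_of_pos (by positivity)
  have hpi : Real.pi ^ 2 ≤ 9.95 := by nlinarith [Real.pi_lt_d2, Real.pi_pos]
  have h14 : z ^ 2 / 9.95 ≤ z ^ 2 / Real.pi ^ 2 := by gcongr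
  have h15 : 2.5 + ((1 + 2 * z) / 11 - 1) ≤ z ^ 2 / 9.95 := by
    norm_num at *
    nlinarith
  linarith

/-- After division by `2 * v + 4` the gap is convex, with second derivative `(v - 1)² (v + 8) / (v
(v + 2)³)`, and it vanishes to first order at `v = 1`. This is the pointwise form of Pinsker's
inequality. -/
theorem three_mul_sub_one_sq_le {v : ℝ} (hv : 0 ≤ v) :
    3 * (v - 1) ^ 2 ≤ (2 * v + 4) * (v * Real.log v - v + 1) := by
  rcases hv.eq_or_lt with rfl | hv
  · norm_num
  set G : ℝ → ℝ := fun z => z * Real.log z - z + 1 - 3 * (z - 1) ^ 2 / (2 * z + 4) with hG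
  set G1 : ℝ → ℝ := fun z => Real.log z - 3 * ((z - 1) * (z + 5)) / (2 * (z + 2) ^ 2) with hG1
  have hd1 : ∀ z : ℝ, 0 < z → HasDerivAt G1 ((z - 1) ^ 2 * (z + 8) / (z * (z + 2) ^ 3)) z := by
    intro z hz
    have h1 : HasDerivAt (fun z : ℝ => 3 * ((z - 1) * (z + 5))) (3 * (1 * (z + 5) + (z - 1) * 1)) z :=
      (((hasDerivAt_id z).sub_const 1).mul ((hasDerivAt_id z).add_const 5)).const_mul 3
    have h2 : HasDerivAt (fun z : ℝ => 2 * (z + 2) ^ 2) (2 * (2 * (z + 2))) z := by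
      have := (((hasDerivAt_id z).add_const 2).pow 2).const_mul 2
      simpa using this
    refine ((Real.hasDerivAt_log hz.ne').sub (h1.div h2 (by positivity))).congr_deriv ?_
    field_simp
    ring
  have hd : ∀ z : ℝ, 0 < z → HasDerivAt G (G1 z) z := by
    intro z hz
    have h1 : HasDerivAt (fun z : ℝ => 3 * (z - 1) ^ 2) (3 * (2 * (z - 1))) z := by
      have := (((hasDerivAt_id z).sub_const 1).pow 2).const_mul 3
      simpa using this
    have h2 : HasDerivAt (fun z : ℝ => 2 * z + 4) 2 z := by
      have := ((hasDerivAt_id z).const_mul 2).add_const 4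
      simpa using this
    have h3 := ((Real.hasDerivAt_mul_log hz.ne').sub (hasDerivAt_id z)).add_const 1
    refine (h3.sub (h1.div h2 (by positivity))).congr_deriv ?_
    simp only [hG1]
    field_simp
    ring
  have hm1 : MonotoneOn G1 (Ioi 0) := by
    refine monotoneOn_of_deriv_nonneg (convex_Ioi _)
      (fun z hz => (hd1 z hz).continuousAt.continuousWithinAt) ?_ ?_
    · intro z hz; rw [interior_Ioi] at hz
      exact (hd1 z hz).differentiableAt.differentiableWithinAt
    · intro z hz; rw [interior_Ioi] at hz
      rw [(hd1 z hz).deriv]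
      have : 0 < z := hz
      positivity
  have e1 : G1 1 = 0 := by simp [hG1]
  have e0 : G 1 = 0 := by simp [hG]
  have hGv : 0 ≤ G v := by
    rcases le_total v 1 with h1 | h1
    · have : AntitoneOn G (Ioc 0 1) := by
        refine antitoneOn_of_deriv_nonpos (convex_Ioc _ _)
          (fun z hz => (hd z hz.1).continuousAt.continuousWithinAt) ?_ ?_
        · intro z hz; rw [interior_Ioc] at hz
          exact (hd z hz.1).differentiableAt.differentiableWithinAt
        · intro z hz; rw [interior_Ioc] at hz
          rw [(hd z hz.1).deriv, ← e1]
          exact hm1 hz.1 (mem_Ioi.2 one_pos) hz.2.le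
      have := this ⟨hv, h1⟩ ⟨one_pos, le_rfl⟩ h1
      linarith
    · have : MonotoneOn G (Ici 1) := by
        refine monotoneOn_of_deriv_nonneg (convex_Ici _)
          (fun z hz => (hd z (one_pos.trans_le hz)).continuousAt.continuousWithinAt) ?_ ?_
        · intro z hz; rw [interior_Ici] at hz
          exact (hd z (one_pos.trans hz)).differentiableAt.differentiableWithinAt
        · intro z hz; rw [interior_Ici] at hz
          have hz' : (0:ℝ) < z := one_pos.trans hz
          rw [(hd z hz').deriv, ← e1]
          exact hm1 (mem_Ioi.2 one_pos) hz' (le_of_lt hz)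
      have := this (mem_Ici.2 le_rfl) h1 h1
      linarith
  have h9 : 0 ≤ (2 * v + 4) * G v := by positivity
  have h10 : (2 * v + 4) * G v = (2 * v + 4) * (v * Real.log v - v + 1) - 3 * (v - 1) ^ 2 := by
    simp only [hG]; field_simp
  linarith

/-- A continuous function exceeds its mean by at most the integral of `|v'|`. -/
theorem le_mean_add_integral_abs_deriv {a b : ℝ} (hab : a < b) {v v' : ℝ → ℝ}
    (hv : ∀ x, HasDerivAt v (v' x) x) (hv' : Continuous v')
    {x : ℝ} (hx : x ∈ Icc a b) :
    v x ≤ (b - a)⁻¹ * (∫ y in a..b, v y) + ∫ y in a..b, |v' y| := by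
  have hba : 0 < b - a := by linarith
  have hvc : Continuous v := continuous_iff_continuousAt.2 fun x => (hv x).continuousAt
  have h1 : ∀ y ∈ Icc a b, v x - ∫ z in a..b, |v' z| ≤ v y := by
    intro y hy
    have e : ∫ z in y..x, v' z = v x - v y :=
      intervalIntegral.integral_eq_sub_of_hasDerivAt (fun z _ => hv z) (hv'.intervalIntegrable _ _)
    have h2 : |∫ z in y..x, v' z| ≤ ∫ z in a..b, |v' z| := by
      have h3 := intervalIntegral.norm_integral_le_integral_norm_uIoc (f := v') (μ := volume)
        (a := y) (b := x)
      refine h3.trans ?_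
      rw [intervalIntegral.integral_of_le hab.le]
      refine setIntegral_mono_set ?_ (ae_of_all _ fun z => abs_nonneg _) ?_
      · exact (hv'.abs.integrableOn_Icc).mono_set Ioc_subset_Icc_self
      · refine LE.le.eventuallyLE ?_
        intro z hz
        rw [uIoc, mem_Ioc] at hz
        exact ⟨(le_min hy.1 hx.1).trans_lt hz.1, hz.2.trans (max_le hy.2 hx.2)⟩
    rw [e] at h2
    linarith [le_abs_self (v x - v y)]
  have h4 := intervalIntegral.integral_mono_on (μ := volume) hab.le (continuous_const.intervalIntegrable _ _)
    (hvc.intervalIntegrable _ _) h1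
  rw [intervalIntegral.integral_const, smul_eq_mul] at h4
  have h5 := mul_le_mul_of_nonneg_left h4 (inv_pos.2 hba).le
  rw [← mul_assoc, inv_mul_cancel₀ hba.ne', one_mul] at h5
  linarith

/-- A logarithmic Sobolev inequality on the circle, for positive functions of mean one. -/
theorem integral_mul_log_le_of_mean_one {a b : ℝ} (hab : a < b) {v v' : ℝ → ℝ}
    (hvab : v a = v b) (hpos : ∀ x, 0 < v x)
    (hv : ∀ x, HasDerivAt v (v' x) x) (hv' : Continuous v') (hmean : ∫ x in a..b, v x = b - a) :
    ∫ x in a..b, v x * Real.log (v x) ≤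
      (b - a) ^ 2 / (4 * Real.pi ^ 2) * ∫ x in a..b, v' x ^ 2 / v x := by
  have hba : 0 < b - a := by linarith
  have hvc : Continuous v := continuous_iff_continuousAt.2 fun x => (hv x).continuousAt
  have hlc : Continuous fun x => Real.log (v x) := hvc.log fun x => (hpos x).ne'
  have hqc : Continuous fun x => v' x ^ 2 / v x := (hv'.pow 2).div hvc fun x => (hpos x).ne'
  set l := b - a with hl
  set I := ∫ x in a..b, v' x ^ 2 / v x with hI
  have hI0 : 0 ≤ I := intervalIntegral.integral_nonneg hab.le fun x _ =>
    div_nonneg (sq_nonneg _) (hpos x).le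
  set z := Real.sqrt (l * I) / 2 with hz
  have hz0 : 0 ≤ z := by positivity
  have hz2 : 4 * z ^ 2 = l * I := by
    rw [hz, div_pow, Real.sq_sqrt (by positivity)]; ring
  -- The AM-GM bound `|v'| ≤ (c / l) v + (l / 4c) v'² / v` integrates to `c + z ^ 2 / c`, because
  -- `v` has mean one and `l * I = 4 * z ^ 2`.
  have hsup : ∀ c : ℝ, 0 < c → ∀ x ∈ Icc a b, v x ≤ 1 + c + z ^ 2 / c := by
    intro c hc x hx
    have h1 := le_mean_add_integral_abs_deriv hab hv hv' hx
    rw [hmean, inv_mul_cancel₀ hba.ne'] at h1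
    have h2 : ∫ y in a..b, |v' y| ≤ ∫ y in a..b, (c / l * v y + l / (4 * c) * (v' y ^ 2 / v y)) := by
      refine intervalIntegral.integral_mono_on hab.le (hv'.abs.intervalIntegrable _ _)
        (((hvc.const_mul _).add (hqc.const_mul _)).intervalIntegrable _ _) fun y _ => ?_
      have hvy := hpos y
      have : c / l * v y + l / (4 * c) * (v' y ^ 2 / v y) - |v' y|
          = (2 * c * v y - l * |v' y|) ^ 2 / (4 * c * l * v y) := by
        rw [← sq_abs (v' y)]; field_simp; ring
      have h0 : 0 ≤ (2 * c * v y - l * |v' y|) ^ 2 / (4 * c * l * v y) := by positivity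
      linarith
    rw [intervalIntegral.integral_add ((hvc.const_mul _).intervalIntegrable _ _)
      ((hqc.const_mul _).intervalIntegrable _ _), intervalIntegral.integral_const_mul,
      intervalIntegral.integral_const_mul, hmean, div_mul_cancel₀ _ hba.ne'] at h2
    have h3 : l / (4 * c) * I = z ^ 2 / c := by
      have : z ^ 2 = l * I / 4 := by linarith
      rw [this]; field_simp
    rw [← hI, h3] at h2
    linarith
  have hgoal : l ^ 2 / (4 * Real.pi ^ 2) * I = l * (z ^ 2 / Real.pi ^ 2) := by
    have : z ^ 2 = l * I / 4 := by linarith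
    rw [this]; field_simp
  rw [hgoal]
  -- For a large Fisher information the crude bound `log v ≤ log (1 + 2 * z)`, from `c = z`, already
  -- suffices. Otherwise `v` stays close enough to constant for the parabola bound to apply to `√v`.
  rcases le_total 5 z with h5 | h5
  · have hc : ∀ x ∈ Icc a b, v x * Real.log (v x) ≤ v x * (z ^ 2 / Real.pi ^ 2) := by
      intro x hx
      refine mul_le_mul_of_nonneg_left ?_ (hpos x).le
      refine (Real.log_le_log (hpos x) ?_).trans (log_one_add_two_mul_le h5)
      have := hsup z (by linarith) x hx
      have e : z ^ 2 / z = z := by field_simp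
      linarith
    refine (intervalIntegral.integral_mono_on hab.le ((hvc.mul hlc).intervalIntegrable _ _)
      ((hvc.mul_const _).intervalIntegrable _ _) hc).trans_eq ?_
    rw [intervalIntegral.integral_mul_const, hmean]
  · set f : ℝ → ℝ := fun x => Real.sqrt (v x) with hf
    set f' : ℝ → ℝ := fun x => v' x / (2 * Real.sqrt (v x)) with hf'
    have hfd : ∀ x, HasDerivAt f (f' x) x := fun x => (hv x).sqrt (hpos x).ne'
    have hfc : Continuous f := hvc.sqrt
    have hf'c : Continuous f' := hv'.div (hfc.const_mul 2) fun x => by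
      have := Real.sqrt_pos.2 (hpos x); positivity
    have hf2 : ∀ x, f x ^ 2 = v x := fun x => Real.sq_sqrt (hpos x).le
    have hf'2 : ∀ x, f' x ^ 2 = 4⁻¹ * (v' x ^ 2 / v x) := by
      intro x
      simp only [hf']
      rw [div_pow, mul_pow, Real.sq_sqrt (hpos x).le]; ring
    have hw := wirtinger_of_hasDerivAt hab (by simp only [hf]; rw [hvab]) hfd hf'c
    simp only [hf2, hf'2] at hw
    rw [intervalIntegral.integral_const_mul, hmean, ← hI, ← hl] at hw
    set m := l⁻¹ * ∫ x in a..b, f x with hm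
    have hm0 : 0 ≤ m := mul_nonneg (inv_pos.2 hba).le
      (intervalIntegral.integral_nonneg hab.le fun x _ => Real.sqrt_nonneg _)
    have hmi : ∫ x in a..b, f x = l * m := by rw [hm, ← mul_assoc, mul_inv_cancel₀ hba.ne', one_mul]
    have hw1 : 1 ≤ m ^ 2 + z ^ 2 / Real.pi ^ 2 / 4 := by
      rw [hmi] at hw
      have e1 : l⁻¹ * (l * m) ^ 2 = l * m ^ 2 := by field_simp
      have e2 : (l / (2 * Real.pi)) ^ 2 * (4⁻¹ * I) = l * (z ^ 2 / Real.pi ^ 2 / 4) := by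
        have : z ^ 2 = l * I / 4 := by linarith
        rw [this]; field_simp; norm_num
      rw [e1, e2, ← mul_add] at hw
      exact le_of_mul_le_mul_left (by linarith) hba
    have hpi : (9.8 : ℝ) ≤ Real.pi ^ 2 := by nlinarith [Real.pi_gt_d2]
    -- From `hw1`, `z ≤ 5` and `π² ≥ 9.8`. Together with the sup bound `v ≤ 11`, from `c = 5`, it
    -- yields `f ≤ 6 * m`, as `36 * 0.36 > 11`.
    have hm2 : 0.36 ≤ m ^ 2 := by
      have : z ^ 2 / Real.pi ^ 2 ≤ 25 / 9.8 := by
        gcongr; nlinarith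
      norm_num at this ⊢; linarith
    have hmpos : 0 < m := by nlinarith
    have hf6 : ∀ x ∈ Icc a b, f x ≤ 6 * m := by
      intro x hx
      have h1 := hsup 5 (by norm_num) x hx
      have h2 : f x ^ 2 ≤ (6 * m) ^ 2 := by
        rw [hf2, mul_pow]; nlinarith
      exact le_of_sq_le_sq h2 (by positivity)
    have hb : ∀ x ∈ Icc a b, v x * Real.log (v x) ≤
        (Real.log (m ^ 2) + 5) * v x + (-8 * m) * f x + 3 * m ^ 2 := by
      intro x hx
      have hfx : 0 < f x := Real.sqrt_pos.2 (hpos x)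
      have h1 := two_mul_sq_mul_log_le (y := f x / m) (by positivity)
        ((div_le_iff₀ hmpos).2 (hf6 x hx))
      have h2 : Real.log (v x) = Real.log (m ^ 2) + 2 * Real.log (f x / m) := by
        rw [← hf2 x, Real.log_div hfx.ne' hmpos.ne', Real.log_pow, Real.log_pow]; push_cast; ring
      have h3 := mul_le_mul_of_nonneg_left h1 (sq_nonneg m)
      have h4 : m ^ 2 * (2 * (f x / m) ^ 2 * Real.log (f x / m))
          = v x * (2 * Real.log (f x / m)) := by rw [← hf2 x]; field_simp
      have h5 : m ^ 2 * (5 * (f x / m) ^ 2 - 8 * (f x / m) + 3)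
          = 5 * v x + (-8 * m) * f x + 3 * m ^ 2 := by rw [← hf2 x]; field_simp; ring
      rw [h4, h5] at h3
      rw [h2, mul_add]
      linarith
    have hi := intervalIntegral.integral_mono_on (μ := volume) hab.le
      (Continuous.intervalIntegrable (hvc.mul hlc) _ _)
      (Continuous.intervalIntegrable (by fun_prop) _ _) hb
    rw [intervalIntegral.integral_add (Continuous.intervalIntegrable (by fun_prop) _ _)
      (continuous_const.intervalIntegrable _ _),
      intervalIntegral.integral_add ((hvc.const_mul _).intervalIntegrable _ _)
      ((hfc.const_mul _).intervalIntegrable _ _), intervalIntegral.integral_const_mul,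
      intervalIntegral.integral_const_mul, intervalIntegral.integral_const, hmean, hmi,
      smul_eq_mul, ← hl] at hi
    refine LE.le.trans hi ?_
    -- The bound becomes `4 * (1 - m ^ 2)`, and Wirtinger in the form `hw1` says that this is at
    -- most `z ^ 2 / π ^ 2`. No constant is lost.
    have hlog : Real.log (m ^ 2) ≤ m ^ 2 - 1 := Real.log_le_sub_one_of_pos (by positivity)
    have e : (Real.log (m ^ 2) + 5) * l + -8 * m * (l * m) + l * (3 * m ^ 2)
        = l * (Real.log (m ^ 2) + 5 - 5 * m ^ 2) := by ring
    rw [e]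
    refine mul_le_mul_of_nonneg_left ?_ hba.le
    linarith

/-- A logarithmic Sobolev inequality on the circle. -/
theorem integral_mul_log_le {a b : ℝ} (hab : a < b) {v v' : ℝ → ℝ}
    (hvab : v a = v b) (hpos : ∀ x, 0 < v x)
    (hv : ∀ x, HasDerivAt v (v' x) x) (hv' : Continuous v') {m : ℝ} (hm : 0 < m)
    (hmean : ∫ x in a..b, v x = m) :
    (∫ x in a..b, v x * Real.log (v x * (b - a))) - m * Real.log m ≤
      (b - a) ^ 2 / (4 * Real.pi ^ 2) * ∫ x in a..b, v' x ^ 2 / v x := by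
  have hba : 0 < b - a := by linarith
  have hvc : Continuous v := continuous_iff_continuousAt.2 fun x => (hv x).continuousAt
  have hlc : Continuous fun x => Real.log (v x * (b - a)) :=
    (hvc.mul_const _).log fun x => (mul_pos (hpos x) hba).ne'
  -- Normalizing to mean one; the logarithm of the scaling factor produces the term `m * log m`.
  set c := (b - a) / m with hc
  have hc0 : 0 < c := div_pos hba hm
  have h := integral_mul_log_le_of_mean_one hab (v := fun x => c * v x) (v' := fun x => c * v' x)
    (by simp only [hvab]) (fun x => mul_pos hc0 (hpos x)) (fun x => (hv x).const_mul c)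
    (hv'.const_mul c) (by
      rw [intervalIntegral.integral_const_mul, hmean, hc]; field_simp)
  have e1 : ∀ x, c * v x * Real.log (c * v x)
      = c * (v x * Real.log (v x * (b - a)) - Real.log m * v x) := by
    intro x
    have : c * v x = v x * (b - a) / m := by rw [hc]; ring
    rw [mul_assoc, this, Real.log_div (mul_pos (hpos x) hba).ne' hm.ne']; ring
  have e2 : ∀ x, (c * v' x) ^ 2 / (c * v x) = c * (v' x ^ 2 / v x) := by
    intro x; have := hpos x; field_simp
  simp only [e1, e2] at h
  rw [intervalIntegral.integral_const_mul, intervalIntegral.integral_const_mul,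
    intervalIntegral.integral_sub (f := fun x => v x * Real.log (v x * (b - a)))
      ((hvc.mul hlc).intervalIntegrable _ _)
      ((hvc.const_mul _).intervalIntegrable _ _), intervalIntegral.integral_const_mul, hmean] at h
  refine le_of_mul_le_mul_left ?_ hc0
  linarith

/-- **Pinsker's inequality** with respect to the uniform distribution on an interval. -/
theorem sq_integral_abs_sub_le {a b : ℝ} (hab : a < b) {u : ℝ → ℝ} (hu : Continuous u)
    (hu0 : ∀ x, 0 ≤ u x) (hmean : ∫ x in a..b, u x = 1) :
    (∫ x in a..b, |u x - (b - a)⁻¹|) ^ 2 ≤ 2 * ∫ x in a..b, u x * Real.log (u x * (b - a)) := by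
  have hba : 0 < b - a := by linarith
  set l := b - a with hl
  have hvl : Continuous fun x => u x * l * Real.log (u x * l) :=
    Real.continuous_mul_log.comp (hu.mul_const l)
  have hlc : Continuous fun x => u x * Real.log (u x * l) := by
    have : (fun x => u x * Real.log (u x * l)) = fun x => l⁻¹ * (u x * l * Real.log (u x * l)) := by
      funext x; field_simp
    rw [this]; exact hvl.const_mul _
  set H := ∫ x in a..b, u x * Real.log (u x * l) with hH
  set q := ∫ x in a..b, |u x - l⁻¹| with hq
  have hq0 : 0 ≤ q := intervalIntegral.integral_nonneg hab.le fun x _ => abs_nonneg _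
  -- AM-GM with a free parameter replaces Cauchy-Schwarz for integrals: `(u - l⁻¹)² ≤ 4 A B ≤ (A +
  -- B)²`, where `A` integrates to `c` and `B` to `H / (2 * c)`.
  have hpt : ∀ c : ℝ, 0 < c → ∀ x, |u x - l⁻¹| ≤
      c / 3 * u x + 2 * c / (3 * l) + (u x * Real.log (u x * l) - u x + l⁻¹) / (2 * c) := by
    intro c hc x
    have h1 := three_mul_sub_one_sq_le (v := u x * l) (mul_nonneg (hu0 x) hba.le)
    set A := c / 3 * u x + 2 * c / (3 * l) with hA
    set B := (u x * Real.log (u x * l) - u x + l⁻¹) / (2 * c) with hB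
    have hA0 : 0 < A := by have := hu0 x; positivity
    have h2 : (u x - l⁻¹) ^ 2 ≤ 4 * (A * B) := by
      have e : 4 * (A * B) - (u x - l⁻¹) ^ 2 = ((2 * (u x * l) + 4) * (u x * l * Real.log (u x * l)
          - u x * l + 1) - 3 * (u x * l - 1) ^ 2) / (3 * l ^ 2) := by
        rw [hA, hB]; field_simp; ring
      have : 0 ≤ 4 * (A * B) - (u x - l⁻¹) ^ 2 := by
        rw [e]; exact div_nonneg (by linarith) (by positivity)
      linarith
    have hB0 : 0 ≤ B := by
      by_contra hcon
      push Not at hcon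
      nlinarith [sq_nonneg (u x - l⁻¹), mul_neg_of_pos_of_neg hA0 hcon]
    have h3 : (u x - l⁻¹) ^ 2 ≤ (A + B) ^ 2 := by nlinarith [sq_nonneg (A - B)]
    exact abs_le_of_sq_le_sq h3 (by positivity)
  have hc : ∀ c : ℝ, 0 < c → q ≤ c + H / (2 * c) := by
    intro c hc
    have hi : q ≤ _ := intervalIntegral.integral_mono_on (μ := volume) hab.le
      ((hu.sub continuous_const).abs.intervalIntegrable _ _)
      (Continuous.intervalIntegrable (by fun_prop) _ _) fun x _ => hpt c hc x
    rw [intervalIntegral.integral_add (Continuous.intervalIntegrable (by fun_prop) _ _)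
      (Continuous.intervalIntegrable (by fun_prop) _ _),
      intervalIntegral.integral_add (Continuous.intervalIntegrable (by fun_prop) _ _)
      (Continuous.intervalIntegrable (by fun_prop) _ _),
      intervalIntegral.integral_const_mul, intervalIntegral.integral_const,
      intervalIntegral.integral_div,
      intervalIntegral.integral_add (Continuous.intervalIntegrable (by fun_prop) _ _)
      (Continuous.intervalIntegrable (by fun_prop) _ _),
      intervalIntegral.integral_sub (Continuous.intervalIntegrable (by fun_prop) _ _)
      (Continuous.intervalIntegrable (by fun_prop) _ _), hmean, ← hH,
      intervalIntegral.integral_const, smul_eq_mul, smul_eq_mul,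
      ← hl] at hi
    refine hi.trans_eq ?_
    field_simp
    ring
  -- The choice `c = q / 2` gives `q ^ 2 ≤ 2 * H`. For `q = 0` it is not available and `0 ≤ H` has
  -- to be shown: if `H < 0`, then `c = √(-H / 4)` makes `c + H / (2 * c) = -c` negative.
  rcases hq0.eq_or_lt with h0 | h0
  · rw [← h0]
    by_contra hcon
    push Not at hcon
    have hH0 : H < 0 := by linarith
    have h1 := hc (Real.sqrt (-H / 4)) (Real.sqrt_pos.2 (by linarith))
    rw [← h0] at h1
    have hs : 0 < Real.sqrt (-H / 4) := Real.sqrt_pos.2 (by linarith)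
    have hs2 : Real.sqrt (-H / 4) ^ 2 = -H / 4 := Real.sq_sqrt (by linarith)
    have h2 : H = -4 * Real.sqrt (-H / 4) ^ 2 := by linarith
    have h3 : H / (2 * Real.sqrt (-H / 4)) = -2 * Real.sqrt (-H / 4) := by
      rw [div_eq_iff (by positivity)]; linarith
    linarith
  · have h1 := hc (q / 2) (by positivity)
    have h2 : H / (2 * (q / 2)) = H / q := by congr 1; ring
    rw [h2] at h1
    have h3 : q / 2 ≤ H / q := by linarith
    rw [le_div_iff₀ h0] at h3
    nlinarith

namespace SakaguchiKuramoto

/-! ### Periodic functions -/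

theorem integral_torus_eq {E : Type*} [NormedAddCommGroup E] [NormedSpace ℝ E] {L : ℝ}
    (hL : 0 < L) (f : ℝ → E) : ∫ x, f x ∂(torus L) = ∫ x in (-(L / 2))..(L / 2), f x := by
  rw [torus, intervalIntegral.integral_of_le (by linarith)]

theorem torus_univ (L : ℝ) : torus L univ = ENNReal.ofReal L := by
  rw [torus, Measure.restrict_apply_univ, Real.volume_Ioc]; congr 1; ring

instance (L : ℝ) : IsFiniteMeasure (torus L) := by unfold torus; infer_instance

theorem _root_.Continuous.integrable_torus {E : Type*} [NormedAddCommGroup E] {f : ℝ → E}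
    (hf : Continuous f) (L : ℝ) : Integrable f (torus L) :=
  (hf.integrableOn_Icc).mono_set Ioc_subset_Icc_self

theorem integral_torus_comp_sub {L : ℝ} (hL : 0 < L) {f : ℝ → ℝ} (hf : Function.Periodic f L)
    (y : ℝ) : ∫ x, f (x - y) ∂(torus L) = ∫ x, f x ∂(torus L) := by
  rw [integral_torus_eq hL, integral_torus_eq hL,
    intervalIntegral.integral_comp_sub_right (fun x => f x) y]
  have h := hf.intervalIntegral_add_eq (-(L / 2) - y) (-(L / 2))
  convert h using 2 <;> ring

theorem integral_torus_comp_sub_left {L : ℝ} (hL : 0 < L) {f : ℝ → ℝ} (hf : Function.Periodic f L)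
    (y : ℝ) : ∫ x, f (y - x) ∂(torus L) = ∫ x, f x ∂(torus L) := by
  rw [integral_torus_eq hL, integral_torus_eq hL,
    intervalIntegral.integral_comp_sub_left (fun x => f x) y]
  have h := hf.intervalIntegral_add_eq (y - L / 2) (-(L / 2))
  convert h using 2 <;> ring

theorem uniformContinuous_of_periodic {L : ℝ} (hL : 0 < L) {f : ℝ → ℝ} (hf : Continuous f)
    (hp : Function.Periodic f L) : UniformContinuous f := by
  have : Fact (0 < L) := ⟨hL⟩
  have hc : Continuous (hp.lift : AddCircle L → ℝ) := continuous_coinduced_dom.2 hf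
  have hu := CompactSpace.uniformContinuous_of_continuous hc
  have hm : UniformContinuous ((↑) : ℝ → AddCircle L) :=
    uniformContinuous_of_continuousAt_zero (QuotientAddGroup.mk' (AddSubgroup.zmultiples L))
      (AddCircle.continuous_mk' L).continuousAt
  exact hu.comp hm

/-- Mollification commutes with translations, so it keeps the period; uniform continuity makes the
error uniform. -/
theorem exists_contDiff_periodic_dist_le {L : ℝ} (hL : 0 < L) {f : ℝ → ℝ} (hf : Continuous f)
    (hp : Function.Periodic f L) {ε : ℝ} (hε : 0 < ε) :
    ∃ g : ℝ → ℝ, ContDiff ℝ (⊤ : ℕ∞) g ∧ Function.Periodic g L ∧ ∀ x, |g x - f x| ≤ ε := by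
  obtain ⟨δ, hδ, hfδ⟩ := Metric.uniformContinuous_iff.mp (uniformContinuous_of_periodic hL hf hp)
    ε hε
  set φ : ContDiffBump (0 : ℝ) := ⟨δ / 2, δ, half_pos hδ, half_lt_self hδ⟩ with hφ
  refine ⟨convolution (φ.normed volume) f (ContinuousLinearMap.lsmul ℝ ℝ) volume, ?_, ?_, ?_⟩
  · exact φ.hasCompactSupport_normed.contDiff_convolution_left _ φ.contDiff_normed
      hf.locallyIntegrable
  · intro x
    simp only [convolution]
    congr 1
    funext t
    rw [show x + L - t = (x - t) + L by ring, hp]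
  · intro x
    rw [← Real.dist_eq]
    exact φ.dist_normed_convolution_le hf.aestronglyMeasurable fun y hy => (hfδ hy).le

/-- A periodic property that holds almost everywhere on the torus holds almost everywhere. -/
theorem ae_of_ae_torus {L : ℝ} (hL : 0 < L) {p : ℝ → Prop} (hp : ∀ x, p (x + L) ↔ p x)
    (h : ∀ᵐ x ∂(torus L), p x) : ∀ᵐ x, p x := by
  have hd := isAddFundamentalDomain_Ioc hL (-(L / 2))
  rw [ae_iff]
  refine hd.measure_zero_of_invariant _ ?_ ?_
  · rintro ⟨g, n, rfl⟩
    have hz : ∀ (n : ℤ) (x : ℝ), p (x + n • L) ↔ p x := by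
      intro n
      induction n using Int.induction_on with
      | zero => simp
      | succ k ih => intro x; rw [add_smul, one_smul, ← add_assoc, hp, ih]
      | pred k ih =>
        intro x
        have h1 := hp (x + ((-k - 1 : ℤ) • L))
        rw [← h1, ← ih x]
        have : x + (-(k : ℤ) - 1) • L + L = x + (-(k : ℤ)) • L := by
          rw [sub_smul, one_smul]; ring
        rw [this]
    ext x
    rw [mem_vadd_set_iff_neg_vadd_mem]
    have : (-(⟨n • L, n, rfl⟩ : AddSubgroup.zmultiples L)) +ᵥ x = x + (-n) • L := by
      change -(n • L) + x = _
      rw [neg_smul]; ring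
    change (¬ p _) ↔ ¬ p _
    erw [this, hz]
  · have h2 := (ae_restrict_iff' measurableSet_Ioc).1 h
    rw [ae_iff] at h2
    have e : -(L / 2) + L = L / 2 := by ring
    rw [e]
    convert h2 using 2
    ext x
    simp; tauto

/-- A du Bois-Reymond lemma on the circle. Mollification first enlarges the test class to continuous
periodic functions. The periodic extension of a function compactly supported inside one period is
then an admissible test without checking smoothness across the seam, and the statement on the open
interval applies. -/
theorem ae_eq_zero_of_integral_mul_periodic {L : ℝ} (hL : 0 < L) {h : ℝ → ℝ}
    (hi : Integrable h (torus L))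
    (hφ : ∀ φ : ℝ → ℝ, ContDiff ℝ (⊤ : ℕ∞) φ → Function.Periodic φ L →
      ∫ x, h x * φ x ∂(torus L) = 0) : ∀ᵐ x ∂(torus L), h x = 0 := by
  have hc : ∀ ψ : ℝ → ℝ, Continuous ψ → Function.Periodic ψ L →
      ∫ x, h x * ψ x ∂(torus L) = 0 := by
    intro ψ hψ hψp
    have hb : ∀ ε : ℝ, 0 < ε → |∫ x, h x * ψ x ∂(torus L)| ≤ ε * ∫ x, |h x| ∂(torus L) := by
      intro ε hε
      obtain ⟨g, hg, hgp, hgd⟩ := exists_contDiff_periodic_dist_le hL hψ hψp hε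
      have hbd : ∀ k : ℝ → ℝ, Continuous k → Function.Periodic k L →
          Integrable (fun x => h x * k x) (torus L) := by
        intro k hk hkp
        obtain ⟨C, hC⟩ := (isCompact_Icc (a := -(L / 2)) (b := L / 2)).exists_bound_of_continuousOn
          hk.continuousOn
        refine hi.mul_bdd (c := C) hk.aestronglyMeasurable ?_
        filter_upwards [ae_restrict_mem measurableSet_Ioc] with x hx
        exact hC x (Ioc_subset_Icc_self hx)
      have e : ∫ x, h x * ψ x ∂(torus L) = ∫ x, h x * (ψ x - g x) ∂(torus L) := by
        simp only [mul_sub]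
        rw [integral_sub (hbd ψ hψ hψp) (hbd g hg.continuous hgp), hφ g hg hgp, sub_zero]
      rw [e, ← integral_const_mul]
      refine (abs_integral_le_integral_abs).trans (integral_mono_of_nonneg
        (ae_of_all _ fun x => abs_nonneg _) (hi.abs.const_mul _) (ae_of_all _ fun x => ?_))
      have := hgd x
      rw [abs_sub_comm] at this
      simp only [abs_mul]
      rw [mul_comm]
      exact mul_le_mul_of_nonneg_right this (abs_nonneg _)
    have h0 : (0 : ℝ) ≤ ∫ x, |h x| ∂(torus L) := integral_nonneg fun x => abs_nonneg _
    have := le_of_forall_pos_le_add (a := |∫ x, h x * ψ x ∂(torus L)|) (b := 0) fun ε hε => by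
      have h1 := hb (ε / (1 + ∫ x, |h x| ∂(torus L))) (by positivity)
      refine h1.trans ?_
      rw [zero_add, div_mul_eq_mul_div, div_le_iff₀ (by positivity)]
      nlinarith
    exact abs_nonpos_iff.1 this
  have : Fact (0 < L) := ⟨hL⟩
  have hO : ∀ᵐ x, x ∈ Ioo (-(L / 2)) (L / 2) → h x = 0 := by
    have hli : LocallyIntegrableOn h (Ioo (-(L / 2)) (L / 2)) :=
      (IntegrableOn.mono_set hi Ioo_subset_Ioc_self).locallyIntegrableOn
    refine isOpen_Ioo.ae_eq_zero_of_integral_contDiff_smul_eq_zero hli ?_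
    intro g hg _ hgs
    have ha : g (-(L / 2)) = 0 := image_eq_zero_of_notMem_tsupport fun h => by
      simpa using hgs h
    have hb : g (-(L / 2) + L) = 0 := image_eq_zero_of_notMem_tsupport fun h => by
      have := (hgs h).2; linarith
    set ψ : ℝ → ℝ := fun x => AddCircle.liftIoc L (-(L / 2)) g (x : AddCircle L) with hψ
    have hψc : Continuous ψ :=
      (AddCircle.liftIoc_continuous (by rw [ha, hb]) hg.continuous.continuousOn).comp
        (AddCircle.continuous_mk' L)
    have hψp : Function.Periodic ψ L := fun x => by simp [hψ]
    have h1 := hc ψ hψc hψp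
    have h2 : ∫ x, g x • h x = ∫ x in Ioc (-(L / 2)) (L / 2), g x • h x := by
      symm
      refine setIntegral_eq_integral_of_forall_compl_eq_zero fun x hx => ?_
      rw [image_eq_zero_of_notMem_tsupport fun h => hx (Ioo_subset_Ioc_self (hgs h)), zero_smul]
    rw [h2, ← h1, torus]
    refine setIntegral_congr_fun measurableSet_Ioc fun x hx => ?_
    have : ψ x = g x := AddCircle.liftIoc_coe_apply (by
      refine ⟨hx.1, hx.2.trans (by linarith)⟩)
    simp only [this, smul_eq_mul, mul_comm]
  rw [torus, ae_restrict_iff' measurableSet_Ioc]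
  have hne : ∀ᵐ x : ℝ, x ≠ L / 2 := by simp [ae_iff]
  filter_upwards [hO, hne] with x hx hx2 hxm
  exact hx ⟨hxm.1, lt_of_le_of_ne hxm.2 hx2⟩

/-! ### Weak derivatives and their representatives -/

theorem IsWeakDeriv.ae_eq {L : ℝ} (hL : 0 < L) {k : ℕ} {f h₁ h₂ : ℝ → ℝ}
    (h1 : IsWeakDeriv L k f h₁) (h2 : IsWeakDeriv L k f h₂) : h₁ =ᵐ[torus L] h₂ := by
  have h := ae_eq_zero_of_integral_mul_periodic hL (h1.integrable_right.sub h2.integrable_right) ?_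
  · filter_upwards [h] with x hx
    simpa [sub_eq_zero] using hx
  · intro φ hφ hφp
    have hbd : ∀ k : ℝ → ℝ, Integrable k (torus L) →
        Integrable (fun x => k x * φ x) (torus L) := by
      intro k hk
      obtain ⟨C, hC⟩ := (isCompact_Icc (a := -(L / 2)) (b := L / 2)).exists_bound_of_continuousOn
        hφ.continuous.continuousOn
      refine hk.mul_bdd (c := C) hφ.continuous.aestronglyMeasurable ?_
      filter_upwards [ae_restrict_mem measurableSet_Ioc] with x hx
      exact hC x (Ioc_subset_Icc_self hx)
    have e1 := h1.integral_eq φ hφ hφp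
    rw [h2.integral_eq φ hφ hφp] at e1
    have e2 := mul_left_cancel₀ (pow_ne_zero k (by norm_num : (-1 : ℝ) ≠ 0)) e1
    simp only [Pi.sub_apply, sub_mul]
    rw [integral_sub (hbd _ h1.integrable_right) (hbd _ h2.integrable_right), e2, sub_self]

theorem MemSobolev.isWeakDeriv_weakDeriv {L : ℝ} {k : ℕ} {p : ℝ≥0∞} {f : ℝ → ℝ}
    (hf : MemSobolev L k p f) {j : ℕ} (hj : j ≤ k) : IsWeakDeriv L j f (weakDeriv L j f) := by
  obtain ⟨h, hh, _⟩ := hf j hj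
  have hex : ∃ u : ℝ → ℝ, IsWeakDeriv L j f u := ⟨h, hh⟩
  rw [weakDeriv, dif_pos hex]
  exact hex.choose_spec

/-- The function chosen by `weakDeriv` need not be the one supplied by the Sobolev hypothesis;
almost everywhere uniqueness transfers the integrability. -/
theorem MemSobolev.memLp_weakDeriv {L : ℝ} (hL : 0 < L) {k : ℕ} {p : ℝ≥0∞} {f : ℝ → ℝ}
    (hf : MemSobolev L k p f) {j : ℕ} (hj : j ≤ k) : MemLp (weakDeriv L j f) p (torus L) := by
  obtain ⟨h, hh, hp⟩ := hf j hj
  exact hp.ae_eq (hh.ae_eq hL (hf.isWeakDeriv_weakDeriv hj))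

/-- A bounded measurable periodic representative of an essentially bounded periodic function. -/
theorem exists_measurable_periodic_rep {L : ℝ} (hL : 0 < L) {h : ℝ → ℝ}
    (hp : Function.Periodic h L) (hm : MemLp h ⊤ (torus L)) :
    ∃ d : ℝ → ℝ, Measurable d ∧ Function.Periodic d L ∧ (∀ x, |d x| ≤ supNorm L h) ∧
      h =ᵐ[volume] d := by
  have : Fact (0 < L) := ⟨hL⟩
  set M := supNorm L h with hM
  have hM0 : 0 ≤ M := ENNReal.toReal_nonneg
  set k := hm.1.mk h with hk
  have hkm : Measurable k := hm.1.stronglyMeasurable_mk.measurable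
  set c : ℝ → ℝ := fun y => max (-M) (min y M) with hc
  have hcm : Measurable c := by fun_prop
  have hcb : ∀ y, |c y| ≤ M := fun y => abs_le.2 ⟨le_max_left _ _, by
    simp only [hc]; exact max_le (by linarith) (min_le_right _ _)⟩
  set e := AddCircle.measurableEquivIoc L (-(L / 2)) with he
  -- Reduction to one period forces exact periodicity, and clipping at `M` forces the bound at every
  -- point rather than almost everywhere.
  set d : ℝ → ℝ := fun x => c (k (e (x : AddCircle L))) with hd
  have hdm : Measurable d := hcm.comp (hkm.comp (measurable_subtype_coe.comp
    (e.measurable.comp AddCircle.measurable_mk')))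
  have hdp : Function.Periodic d L := fun x => by simp [hd]
  refine ⟨d, hdm, hdp, fun x => hcb _, ?_⟩
  refine ae_of_ae_torus hL (p := fun x => h x = d x) (fun x => by rw [hp, hdp]) ?_
  have hbd : ∀ᵐ x ∂(torus L), |h x| ≤ M := by
    have h1 := ae_le_eLpNormEssSup (f := h) (μ := torus L)
    filter_upwards [h1] with x hx
    rw [← eLpNorm_exponent_top] at hx
    have := ENNReal.toReal_mono hm.2.ne hx
    simpa [hM, supNorm] using this
  filter_upwards [hm.1.ae_eq_mk, hbd, ae_restrict_mem measurableSet_Ioc] with x hx1 hx2 hx3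
  have hx4 : x ∈ Ioc (-(L / 2)) (-(L / 2) + L) := ⟨hx3.1, hx3.2.trans (by linarith)⟩
  have : (e (x : AddCircle L) : ℝ) = x := by
    change ((AddCircle.equivIoc L (-(L / 2))) (x : AddCircle L) : ℝ) = x
    rw [AddCircle.equivIoc_coe_eq hx4]
  rw [← hk] at hx1
  simp only [hd, this]
  rw [← hx1]
  obtain ⟨h1, h2⟩ := abs_le.1 hx2
  simp only [hc]
  rw [min_eq_left h2, max_eq_right h1]

/-- The first and the second weak derivative of a potential in `W^{2,∞}` have bounded measurable
periodic representatives, and integration by parts holds against `C¹` periodic functions. -/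
theorem MemSobolev.exists_rep {L : ℝ} (hL : 0 < L) {D : ℝ → ℝ} (hD : MemSobolev L 2 ⊤ D) :
    ∃ d₁ d₂ : ℝ → ℝ, Measurable d₁ ∧ Measurable d₂ ∧ Function.Periodic d₁ L ∧
      Function.Periodic d₂ L ∧ (∀ x, |d₁ x| ≤ supNorm L (weakDeriv L 1 D)) ∧
      (∀ x, |d₂ x| ≤ supNorm L (weakDeriv L 2 D)) ∧ weakDeriv L 1 D =ᵐ[volume] d₁ ∧
      ∀ η η' : ℝ → ℝ, (∀ x, HasDerivAt η (η' x) x) → Continuous η' → Function.Periodic η L →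
        ∫ x, d₁ x * η' x ∂(torus L) = -∫ x, d₂ x * η x ∂(torus L) := by
  have w1 := hD.isWeakDeriv_weakDeriv (j := 1) (by norm_num)
  have w2 := hD.isWeakDeriv_weakDeriv (j := 2) le_rfl
  obtain ⟨d₁, m1, p1, b1, e1⟩ := exists_measurable_periodic_rep hL w1.periodic_right
    (hD.memLp_weakDeriv hL (j := 1) (by norm_num))
  obtain ⟨d₂, m2, p2, b2, e2⟩ := exists_measurable_periodic_rep hL w2.periodic_right
    (hD.memLp_weakDeriv hL (j := 2) le_rfl)
  refine ⟨d₁, d₂, m1, m2, p1, p2, b1, b2, e1, ?_⟩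
  intro η η' hη hη' hηp
  set C1 := supNorm L (weakDeriv L 1 D)
  set C2 := supNorm L (weakDeriv L 2 D)
  have hC1 : 0 ≤ C1 := ENNReal.toReal_nonneg
  have hC2 : 0 ≤ C2 := ENNReal.toReal_nonneg
  have hη'p : Function.Periodic η' L := by
    intro x
    have h1 := (hη (x + L)).comp_add_const x L
    have h2 : (fun x => η (x + L)) = η := funext hηp
    rw [h2] at h1
    exact h1.unique (hη x)
  have hηc : Continuous η := continuous_iff_continuousAt.2 fun x => (hη x).continuousAt
  -- For smooth `φ`, compare two evaluations of `∫ D φ''`: as a first weak derivative tested with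
  -- `φ'`, and as a second one tested with `φ`.
  have hsm : ∀ φ : ℝ → ℝ, ContDiff ℝ (⊤ : ℕ∞) φ → Function.Periodic φ L →
      ∫ x, d₁ x * deriv φ x ∂(torus L) = -∫ x, d₂ x * φ x ∂(torus L) := by
    intro φ hφ hφp
    have hφ' : ContDiff ℝ (⊤ : ℕ∞) (deriv φ) := (contDiff_infty_iff_deriv.1 hφ).2
    have hφ'p : Function.Periodic (deriv φ) L := by
      intro x
      have h2 : (fun x => φ (x + L)) = φ := funext hφp
      rw [← deriv_comp_add_const, h2]
    have h1 := w1.integral_eq _ hφ' hφ'p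
    have h2 := w2.integral_eq _ hφ hφp
    rw [iteratedDeriv_succ'] at h2
    rw [h1] at h2
    have r1 : ∫ x, weakDeriv L 1 D x * deriv φ x ∂(torus L) = ∫ x, d₁ x * deriv φ x ∂(torus L) :=
      integral_congr_ae (by
        filter_upwards [ae_restrict_of_ae e1] with x hx
        rw [hx])
    have r2 : ∫ x, weakDeriv L 2 D x * φ x ∂(torus L) = ∫ x, d₂ x * φ x ∂(torus L) :=
      integral_congr_ae (by
        filter_upwards [ae_restrict_of_ae e2] with x hx
        rw [hx])
    rw [r1, r2] at h2
    linarith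
  have hbd : ∀ (d k : ℝ → ℝ) (C : ℝ), Measurable d → (∀ x, |d x| ≤ C) → Continuous k →
      Integrable (fun x => d x * k x) (torus L) := fun d k C hd hC hk =>
    (hk.integrable_torus L).bdd_mul hd.aestronglyMeasurable (ae_of_all _ hC)
  have hvol : ∀ c : ℝ, ∫ _, c ∂(torus L) = L * c := fun c => by
    rw [integral_const, smul_eq_mul, Measure.real, torus_univ L, ENNReal.toReal_ofReal hL.le]
  have hint : ∀ (d k : ℝ → ℝ) (C e : ℝ), 0 ≤ C → 0 ≤ e → (∀ x, |d x| ≤ C) → (∀ x ∈ Ioc (-(L / 2)) (L / 2),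
      |k x| ≤ e) → |∫ x, d x * k x ∂(torus L)| ≤ L * (C * e) := by
    intro d k C e hC he hd hk
    rw [← hvol]
    refine abs_integral_le_integral_abs.trans (integral_mono_of_nonneg
      (ae_of_all _ fun x => abs_nonneg _) (integrable_const _) ?_)
    filter_upwards [ae_restrict_mem measurableSet_Ioc] with x hx
    rw [abs_mul]
    exact mul_le_mul (hd x) (hk x hx) (abs_nonneg _) hC
  have key : ∀ ε : ℝ, 0 < ε → |(∫ x, d₁ x * η' x ∂(torus L)) + ∫ x, d₂ x * η x ∂(torus L)|
      ≤ ε * (2 * L * C1 + 2 * L * L * C2) := by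
    intro ε hε
    obtain ⟨g, hg, hgp, hgd⟩ := exists_contDiff_periodic_dist_le hL hη' hη'p hε
    have hI0 : ∫ x in (-(L / 2))..(L / 2), η' x = 0 := by
      rw [intervalIntegral.integral_eq_sub_of_hasDerivAt (fun x _ => hη x)
        (hη'.intervalIntegrable _ _)]
      have := hηp (-(L / 2))
      rw [show -(L / 2) + L = L / 2 by ring] at this
      rw [this, sub_self]
    -- The derivative `η'` has mean zero but its smooth approximation `g` need not. Subtracting the
    -- mean, of size at most `ε`, makes the primitive `φ` periodic, hence an admissible test
    -- function close to `η`.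
    set m := L⁻¹ * ∫ x in (-(L / 2))..(L / 2), g x with hm
    have hmb : |m| ≤ ε := by
      have : ∫ x in (-(L / 2))..(L / 2), g x = ∫ x in (-(L / 2))..(L / 2), (g x - η' x) := by
        rw [intervalIntegral.integral_sub (hg.continuous.intervalIntegrable _ _)
          (hη'.intervalIntegrable _ _), hI0, sub_zero]
      rw [hm, this, abs_mul, abs_of_pos (inv_pos.2 hL)]
      have h3 := intervalIntegral.norm_integral_le_of_norm_le_const (a := -(L / 2)) (b := L / 2)
        (f := fun x => g x - η' x) (C := ε) fun x _ => hgd x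
      rw [Real.norm_eq_abs, show L / 2 - -(L / 2) = L by ring, abs_of_pos hL] at h3
      rw [inv_mul_le_iff₀ hL, mul_comm]
      exact h3
    set ζ : ℝ → ℝ := fun x => g x - m with hζ
    have hζs : ContDiff ℝ (⊤ : ℕ∞) ζ := hg.sub contDiff_const
    have hζd : ∀ x, |ζ x - η' x| ≤ 2 * ε := fun x => by
      have := hgd x
      have e : ζ x - η' x = (g x - η' x) - m := by simp only [hζ]; ring
      rw [e]
      exact (abs_sub _ _).trans (by linarith)
    set φ : ℝ → ℝ := fun x => η (-(L / 2)) + ∫ y in (-(L / 2))..x, ζ y with hφ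
    have hφd : ∀ x, HasDerivAt φ (ζ x) x := fun x =>
      (intervalIntegral.integral_hasDerivAt_right (hζs.continuous.intervalIntegrable _ _)
        hζs.continuous.stronglyMeasurable.stronglyMeasurableAtFilter
        hζs.continuous.continuousAt).const_add _
    have hφ' : deriv φ = ζ := funext fun x => (hφd x).deriv
    have hφs : ContDiff ℝ (⊤ : ℕ∞) φ :=
      contDiff_infty_iff_deriv.2 ⟨fun x => (hφd x).differentiableAt, by rw [hφ']; exact hζs⟩
    have hζp : Function.Periodic ζ L := fun x => by simp only [hζ]; rw [hgp]
    have hφp : Function.Periodic φ L := by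
      intro x
      have h1 : ∫ y in x..(x + L), ζ y = 0 := by
        rw [hζp.intervalIntegral_add_eq x (-(L / 2)), show -(L / 2) + L = L / 2 by ring]
        simp only [hζ]
        rw [intervalIntegral.integral_sub (hg.continuous.intervalIntegrable _ _)
          (intervalIntegrable_const), intervalIntegral.integral_const, hm, smul_eq_mul]
        field_simp
        ring
      simp only [hφ]
      rw [← intervalIntegral.integral_add_adjacent_intervals
        (hζs.continuous.intervalIntegrable (-(L / 2)) x)
        (hζs.continuous.intervalIntegrable x (x + L)), h1, add_zero]
    have hφη : ∀ x ∈ Ioc (-(L / 2)) (L / 2), |η x - φ x| ≤ 2 * ε * L := by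
      intro x hx
      have h1 : ∫ y in (-(L / 2))..x, η' y = η x - η (-(L / 2)) :=
        intervalIntegral.integral_eq_sub_of_hasDerivAt (fun x _ => hη x)
        (hη'.intervalIntegrable _ _)
      have h2 : η x - φ x = -∫ y in (-(L / 2))..x, (ζ y - η' y) := by
        rw [intervalIntegral.integral_sub (hζs.continuous.intervalIntegrable _ _)
          (hη'.intervalIntegrable _ _), h1]
        simp only [hφ]; ring
      rw [h2, abs_neg]
      have h3 := intervalIntegral.norm_integral_le_of_norm_le_const (a := -(L / 2)) (b := x)
        (f := fun x => ζ x - η' x) (C := 2 * ε) fun x _ => hζd x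
      refine h3.trans (mul_le_mul_of_nonneg_left ?_ (by positivity))
      rw [abs_of_nonneg (by linarith [hx.1])]
      linarith [hx.2]
    have h1 := hsm φ hφs hφp
    rw [hφ'] at h1
    have s1 : ∫ x, d₁ x * η' x ∂(torus L)
        = (∫ x, d₁ x * (η' x - ζ x) ∂(torus L)) + ∫ x, d₁ x * ζ x ∂(torus L) := by
      rw [← integral_add (hbd d₁ (fun x => η' x - ζ x) _ m1 b1 (hη'.sub hζs.continuous))
        (hbd _ _ _ m1 b1 hζs.continuous)]
      congr 1; funext x; ring
    have s2 : ∫ x, d₂ x * η x ∂(torus L)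
        = (∫ x, d₂ x * (η x - φ x) ∂(torus L)) + ∫ x, d₂ x * φ x ∂(torus L) := by
      rw [← integral_add (hbd d₂ (fun x => η x - φ x) _ m2 b2 (hηc.sub hφs.continuous))
        (hbd _ _ _ m2 b2 hφs.continuous)]
      congr 1; funext x; ring
    have t1 := hint d₁ (fun x => η' x - ζ x) C1 (2 * ε) hC1 (by positivity) b1
      (fun x _ => by rw [abs_sub_comm]; exact hζd x)
    have t2 := hint d₂ (fun x => η x - φ x) C2 (2 * ε * L) hC2 (by positivity) b2 hφη
    rw [s1, s2, h1]
    have e : ∀ A B C : ℝ, A + -C + (B + C) = A + B := fun A B C => by ring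
    rw [e]
    refine (abs_add_le _ _).trans ((add_le_add t1 t2).trans_eq (by ring))
  have h0 : |(∫ x, d₁ x * η' x ∂(torus L)) + ∫ x, d₂ x * η x ∂(torus L)| ≤ 0 := by
    set K := 2 * L * C1 + 2 * L * L * C2 with hK
    have hK0 : 0 ≤ K := by positivity
    refine le_of_forall_pos_le_add fun ε hε => ?_
    refine (key (ε / (1 + K)) (by positivity)).trans ?_
    rw [zero_add, div_mul_eq_mul_div, div_le_iff₀ (by positivity)]
    nlinarith
  have := abs_nonpos_iff.1 h0
  linarith

/-! ### One-dimensional advection-diffusion on the torus -/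

/-- A classical solution of `∂ₜ u = ∂ₓ (u B) + β⁻¹ ∂ₓₓ u` on the torus, with a drift `B` that is
bounded in space at every positive time. -/
structure IsAdvectionDiffusion (L β : ℝ) (u B : ℝ → ℝ → ℝ) : Prop where
  classical : IsClassicalFunction L u
  measurable : ∀ t, 0 < t → Measurable (B t)
  bounded : ∀ t, 0 < t → ∃ C, ∀ x, |B t x| ≤ C
  periodic : ∀ t, 0 < t → Function.Periodic (B t) L
  equation : ∀ t, 0 < t → ∀ x, HasDerivAt (fun y => u t y * B t y)
    (deriv (fun s => u s x) t - β⁻¹ * iteratedDeriv 2 (u t) x) x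

namespace IsClassicalFunction

variable {L : ℝ} {u : ℝ → ℝ → ℝ}

theorem continuous_space (hu : IsClassicalFunction L u) {t : ℝ} (ht : 0 ≤ t) :
    Continuous (u t) := by
  have : Continuous fun x : ℝ => ((t, x) : ℝ × ℝ) := by fun_prop
  exact hu.continuousOn.comp_continuous this fun x => ⟨ht, mem_univ _⟩

theorem hasDerivAt_space (hu : IsClassicalFunction L u) {t : ℝ} (ht : 0 < t) (x : ℝ) :
    HasDerivAt (u t) (deriv (u t) x) x :=
  ((hu.contDiff_space t ht).differentiable (by norm_num) x).hasDerivAt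

theorem continuous_deriv_space (hu : IsClassicalFunction L u) {t : ℝ} (ht : 0 < t) :
    Continuous (deriv (u t)) :=
  (hu.contDiff_space t ht).continuous_deriv (by norm_num)

theorem hasDerivAt_deriv_space (hu : IsClassicalFunction L u) {t : ℝ} (ht : 0 < t) (x : ℝ) :
    HasDerivAt (deriv (u t)) (iteratedDeriv 2 (u t) x) x := by
  have h1 : ContDiff ℝ 1 (deriv (u t)) := by
    have := hu.contDiff_space t ht
    rw [show (2 : WithTop ℕ∞) = 1 + 1 by norm_num, contDiff_succ_iff_deriv] at this
    exact this.2.2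
  have h2 := (h1.differentiable (by norm_num) x).hasDerivAt
  rwa [iteratedDeriv_succ, iteratedDeriv_one]

theorem periodic_deriv_space (hu : IsClassicalFunction L u) {t : ℝ} (ht : 0 < t) :
    Function.Periodic (deriv (u t)) L := by
  intro x
  have h2 : (fun x => u t (x + L)) = u t := funext (hu.periodic t ht.le)
  rw [← deriv_comp_add_const, h2]

theorem continuous_deriv_time (hu : IsClassicalFunction L u) {t : ℝ} (ht : 0 < t) :
    Continuous fun x => deriv (fun s => u s x) t := by
  have : Continuous fun x : ℝ => ((t, x) : ℝ × ℝ) := by fun_prop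
  exact hu.continuousOn_deriv_time.comp_continuous this fun x => ⟨ht, mem_univ _⟩

theorem continuousOn_integral_comp (hu : IsClassicalFunction L u) {j : ℝ → ℝ} {S : Set ℝ}
    (hS : ∀ t, 0 ≤ t → ∀ x, u t x ∈ S) (hj : ContinuousOn j S) :
    ContinuousOn (fun t => ∫ x, j (u t x) ∂(torus L)) (Ici 0) := by
  -- Freezing the solution at time `0` for negative times makes it continuous on the whole plane.
  have h1 : Continuous fun q : ℝ × ℝ => u (max q.1 0) q.2 := by
    have : Continuous fun q : ℝ × ℝ => ((max q.1 0, q.2) : ℝ × ℝ) := by fun_prop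
    exact hu.continuousOn.comp_continuous this fun q =>
      ⟨mem_Ici.2 (le_max_right q.1 0), mem_univ _⟩
  have h2 : Continuous (Function.uncurry fun t x : ℝ => j (u (max t 0) x)) :=
    hj.comp_continuous h1 fun q => hS _ (le_max_right _ _) _
  have h3 : Continuous fun t : ℝ => ∫ x in Icc (-(L / 2)) (L / 2), j (u (max t 0) x) :=
    continuous_parametric_integral_of_continuous h2 isCompact_Icc
  refine h3.continuousOn.congr fun t ht => ?_
  simp only [torus]
  rw [integral_Icc_eq_integral_Ioc, max_eq_left (mem_Ici.1 ht)]

theorem exists_bound_deriv_time (hu : IsClassicalFunction L u) {s t : ℝ} (hs : 0 < s) :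
    ∃ C, ∀ τ ∈ Icc s t, ∀ x ∈ Icc (-(L / 2)) (L / 2), |deriv (fun r => u r x) τ| ≤ C := by
  obtain ⟨C, hC⟩ := ((isCompact_Icc (a := s) (b := t)).prod
    (isCompact_Icc (a := -(L / 2)) (b := L / 2))).exists_bound_of_continuousOn
    (hu.continuousOn_deriv_time.mono fun q hq => ⟨hs.trans_le hq.1.1, mem_univ _⟩)
  exact ⟨C, fun τ hτ x hx => hC (τ, x) ⟨hτ, hx⟩⟩

/-- The range restriction `S` allows both uses: all of `ℝ` for the smoothed absolute value, and the
half line for the entropy of `u + ε`. -/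
theorem hasDerivAt_integral_comp (hu : IsClassicalFunction L u) {j j' : ℝ → ℝ} {S : Set ℝ}
    (hS : ∀ t, 0 ≤ t → ∀ x, u t x ∈ S) (hj : ∀ v ∈ S, HasDerivAt j (j' v) v)
    (hj' : ContinuousOn j' S) {t : ℝ} (ht : 0 < t) :
    HasDerivAt (fun t => ∫ x, j (u t x) ∂(torus L))
      (∫ x, j' (u t x) * deriv (fun s => u s x) t ∂(torus L)) t := by
  have hjc : ContinuousOn j S := fun v hv => (hj v hv).continuousAt.continuousWithinAt
  have hc : ContinuousOn (fun q : ℝ × ℝ => j' (u q.1 q.2) * deriv (fun s => u s q.2) q.1)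
      (Icc (t / 2) (2 * t) ×ˢ Icc (-(L / 2)) (L / 2)) := by
    have hpos : ∀ q ∈ Icc (t / 2) (2 * t) ×ˢ Icc (-(L / 2)) (L / 2), (0 : ℝ) < q.1 :=
      fun q hq => (by linarith : 0 < t / 2).trans_le hq.1.1
    refine ContinuousOn.mul ?_ (hu.continuousOn_deriv_time.mono fun q hq => ⟨hpos q hq, mem_univ _⟩)
    exact hj'.comp (hu.continuousOn.mono fun q hq => ⟨(hpos q hq).le, mem_univ _⟩)
      fun q hq => hS _ (hpos q hq).le _
  obtain ⟨C, hC⟩ := (isCompact_Icc.prod isCompact_Icc).exists_bound_of_continuousOn hc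
  have hcs : ∀ s, 0 ≤ s → Continuous fun x => j (u s x) := fun s hs =>
    hjc.comp_continuous (hu.continuous_space hs) fun x => hS s hs x
  refine (hasDerivAt_integral_of_dominated_loc_of_deriv_le (μ := torus L)
    (F := fun s x => j (u s x)) (F' := fun s x => j' (u s x) * deriv (fun r => u r x) s)
    (bound := fun _ => C) (s := Icc (t / 2) (2 * t)) (Icc_mem_nhds (by linarith) (by linarith))
    ?_ ((hcs t ht.le).integrable_torus L) ?_ ?_ (integrable_const _) ?_).2
  · filter_upwards [lt_mem_nhds ht] with s hs
    exact (hcs s hs.le).aestronglyMeasurable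
  · exact ((hj'.comp_continuous (hu.continuous_space ht.le) fun x => hS t ht.le x).mul
      (hu.continuous_deriv_time ht)).aestronglyMeasurable
  · filter_upwards [ae_restrict_mem measurableSet_Ioc] with x hx s hs
    exact hC (s, x) ⟨hs, Ioc_subset_Icc_self hx⟩
  · refine ae_of_all _ fun x s hs => ?_
    have hs0 : 0 < s := (by linarith : 0 < t / 2).trans_le hs.1
    exact (hj _ (hS s hs0.le x)).comp s (hu.differentiableAt_time s hs0 x).hasDerivAt

end IsClassicalFunction

namespace IsAdvectionDiffusion

variable {L β : ℝ} {u B : ℝ → ℝ → ℝ}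

/-- Integration by parts in the equation tested with `j' (u)`. -/
theorem integral_mul_deriv_time (h : IsAdvectionDiffusion L β u B) (hL : 0 < L) {j' j'' : ℝ → ℝ}
    {S : Set ℝ} (hS : ∀ t, 0 ≤ t → ∀ x, u t x ∈ S) (hj : ∀ v ∈ S, HasDerivAt j' (j'' v) v)
    (hj'' : ContinuousOn j'' S) {t : ℝ} (ht : 0 < t) :
    ∫ x, j' (u t x) * deriv (fun s => u s x) t ∂(torus L)
      = -∫ x, j'' (u t x) * deriv (u t) x * (u t x * B t x + β⁻¹ * deriv (u t) x) ∂(torus L) := by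
  have hu := h.classical
  rw [integral_torus_eq hL, integral_torus_eq hL]
  -- Only the total flux is differentiated, and the equation gives its derivative as `∂ₜ u`. The
  -- drift itself need not be differentiable or even continuous.
  set G : ℝ → ℝ := fun x => u t x * B t x + β⁻¹ * deriv (u t) x with hG
  have hGd : ∀ x, HasDerivAt G (deriv (fun s => u s x) t) x := by
    intro x
    have := (h.equation t ht x).add ((hu.hasDerivAt_deriv_space ht x).const_mul β⁻¹)
    rw [sub_add_cancel] at this
    exact this
  have hj'd : ∀ x, HasDerivAt (fun x => j' (u t x)) (j'' (u t x) * deriv (u t) x) x := fun x =>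
    (hj _ (hS t ht.le x)).comp x (hu.hasDerivAt_space ht x)
  have hc : Continuous fun x => j'' (u t x) * deriv (u t) x :=
    (hj''.comp_continuous (hu.continuous_space ht.le) fun x => hS t ht.le x).mul
      (hu.continuous_deriv_space ht)
  rw [intervalIntegral.integral_mul_deriv_eq_deriv_mul (fun x _ => hj'd x) (fun x _ => hGd x)
    (hc.intervalIntegrable _ _) ((hu.continuous_deriv_time ht).intervalIntegrable _ _)]
  have e : L / 2 = -(L / 2) + L := by ring
  have p1 : u t (L / 2) = u t (-(L / 2)) := by
    conv_lhs => rw [e]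
    exact hu.periodic t ht.le _
  have p2 : G (L / 2) = G (-(L / 2)) := by
    have p3 : B t (L / 2) = B t (-(L / 2)) := by
      conv_lhs => rw [e]
      exact h.periodic t ht _
    have p4 : deriv (u t) (L / 2) = deriv (u t) (-(L / 2)) := by
      conv_lhs => rw [e]
      exact hu.periodic_deriv_space ht _
    simp only [hG, p1, p3, p4]
  rw [p1, p2, sub_self, zero_sub]

/-- Testing the equation with the constant `1` shows that the mass has zero derivative; the mean
value theorem on `[0, t]` needs continuity only at time `0`. -/
theorem integral_eq (h : IsAdvectionDiffusion L β u B) (hL : 0 < L) {t : ℝ} (ht : 0 ≤ t) :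
    ∫ x, u t x ∂(torus L) = ∫ x, u 0 x ∂(torus L) := by
  have hu := h.classical
  rcases ht.eq_or_lt with rfl | ht
  · rfl
  have hc := hu.continuousOn_integral_comp (j := id) (S := univ) (fun _ _ _ => mem_univ _)
    continuousOn_id
  obtain ⟨c, hc1, hc2⟩ := exists_hasDerivAt_eq_slope _ (fun t =>
    ∫ x, (1 : ℝ) * deriv (fun s => u s x) t ∂(torus L)) ht (hc.mono Icc_subset_Ici_self)
    fun s hs => hu.hasDerivAt_integral_comp (j := id) (j' := fun _ => 1) (S := univ)
      (fun _ _ _ => mem_univ _) (fun v _ => hasDerivAt_id v) continuousOn_const hs.1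
  have h0 := h.integral_mul_deriv_time hL (j' := fun _ => 1) (j'' := fun _ => 0) (S := univ)
    (fun _ _ _ => mem_univ _) (fun v _ => hasDerivAt_const v 1) continuousOn_const hc1.1
  simp only [zero_mul, integral_zero, neg_zero] at h0
  rw [h0] at hc2
  have := (div_eq_zero_iff.1 hc2.symm).resolve_right (by linarith)
  simp only [id] at this
  linarith

theorem hasDerivAt_sqrt_sq_add {ε : ℝ} (hε : 0 < ε) (v : ℝ) :
    HasDerivAt (fun v => Real.sqrt (v ^ 2 + ε ^ 2)) (v / Real.sqrt (v ^ 2 + ε ^ 2)) v := by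
  have h1 : HasDerivAt (fun v : ℝ => v ^ 2 + ε ^ 2) (2 * v) v := by
    simpa using ((hasDerivAt_id v).pow 2).add_const (ε ^ 2)
  refine (h1.sqrt (by positivity)).congr_deriv ?_
  field_simp

theorem hasDerivAt_div_sqrt_sq_add {ε : ℝ} (hε : 0 < ε) (v : ℝ) :
    HasDerivAt (fun v => v / Real.sqrt (v ^ 2 + ε ^ 2)) (ε ^ 2 / Real.sqrt (v ^ 2 + ε ^ 2) ^ 3) v := by
  have hp : 0 < Real.sqrt (v ^ 2 + ε ^ 2) := Real.sqrt_pos.2 (by positivity)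
  have hs : Real.sqrt (v ^ 2 + ε ^ 2) ^ 2 = v ^ 2 + ε ^ 2 := Real.sq_sqrt (by positivity)
  refine ((hasDerivAt_id v).div (hasDerivAt_sqrt_sq_add hε v) hp.ne').congr_deriv ?_
  simp only [id]
  field_simp
  rw [hs]; ring

/-- The time derivative of the regularized `L¹` norm is small. -/
theorem integral_div_sqrt_mul_deriv_time_le (h : IsAdvectionDiffusion L β u B) (hL : 0 < L)
    (hβ : 0 < β) {t : ℝ} (ht : 0 < t) {C : ℝ} (hC : ∀ x, |B t x| ≤ C) {ε : ℝ} (hε : 0 < ε) :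
    ∫ x, u t x / Real.sqrt (u t x ^ 2 + ε ^ 2) * deriv (fun s => u s x) t ∂(torus L)
      ≤ ε * (β / 4 * C ^ 2 * L) := by
  have hu := h.classical
  have hr : ∀ v : ℝ, 0 < Real.sqrt (v ^ 2 + ε ^ 2) := fun v => Real.sqrt_pos.2 (by positivity)
  have hcont : Continuous fun v : ℝ => ε ^ 2 / Real.sqrt (v ^ 2 + ε ^ 2) ^ 3 :=
    continuous_const.div (by fun_prop) fun v => (pow_pos (hr v) 3).ne'
  rw [h.integral_mul_deriv_time hL (S := univ) (fun _ _ _ => mem_univ _)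
    (fun v _ => hasDerivAt_div_sqrt_sq_add hε v) hcont.continuousOn ht, ← integral_neg]
  have e : ε * (β / 4 * C ^ 2 * L) = ∫ _, ε * (β / 4 * C ^ 2) ∂(torus L) := by
    rw [integral_const, smul_eq_mul, Measure.real, torus_univ L, ENNReal.toReal_ofReal hL.le]
    ring
  rw [e]
  have hcu := hu.continuous_space ht.le
  have hcd := hu.continuous_deriv_space ht
  refine integral_mono_ae ?_ (integrable_const _) (ae_of_all _ fun x => ?_)
  · have e2 : (fun x => -(ε ^ 2 / Real.sqrt (u t x ^ 2 + ε ^ 2) ^ 3 * deriv (u t) x *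
        (u t x * B t x + β⁻¹ * deriv (u t) x)))
        = fun x => B t x * (-(ε ^ 2 / Real.sqrt (u t x ^ 2 + ε ^ 2) ^ 3 * deriv (u t) x * u t x))
          + -(ε ^ 2 / Real.sqrt (u t x ^ 2 + ε ^ 2) ^ 3 * deriv (u t) x *
            (β⁻¹ * deriv (u t) x)) := by
      funext x; ring
    rw [e2]
    have hc2 := hcont.comp hcu
    refine Integrable.add ?_ ?_
    · refine (Continuous.integrable_torus ?_ L).bdd_mul
        (h.measurable t ht).aestronglyMeasurable (ae_of_all _ hC)
      exact ((hc2.mul hcd).mul hcu).neg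
    · exact (((hc2.mul hcd).mul (hcd.const_mul _)).neg).integrable_torus L
  · set r := Real.sqrt (u t x ^ 2 + ε ^ 2) with hrd
    have hr0 : 0 < r := hr _
    have hr2 : r ^ 2 = u t x ^ 2 + ε ^ 2 := Real.sq_sqrt (by positivity)
    have hεr : ε ≤ r := by
      refine le_of_sq_le_sq ?_ hr0.le
      nlinarith [sq_nonneg (u t x)]
    have hj0 : 0 ≤ ε ^ 2 / r ^ 3 := by positivity
    -- Completing the square: the diffusion absorbs the derivative in the drift term and leaves only
    -- `u² B²`, which the weight `ε ^ 2 / r ^ 3` makes of order `ε`.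
    have h1 : -(ε ^ 2 / r ^ 3 * deriv (u t) x * (u t x * B t x + β⁻¹ * deriv (u t) x))
        ≤ β / 4 * (ε ^ 2 / r ^ 3 * u t x ^ 2) * B t x ^ 2 := by
      have : β / 4 * (ε ^ 2 / r ^ 3 * u t x ^ 2) * B t x ^ 2
          + (ε ^ 2 / r ^ 3 * deriv (u t) x * (u t x * B t x + β⁻¹ * deriv (u t) x))
          = ε ^ 2 / r ^ 3 * (β⁻¹ * (deriv (u t) x + β * u t x * B t x / 2) ^ 2) := by
        field_simp; ring
      have h0 : 0 ≤ ε ^ 2 / r ^ 3 * (β⁻¹ * (deriv (u t) x + β * u t x * B t x / 2) ^ 2) := by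
        positivity
      linarith
    have h2 : ε ^ 2 / r ^ 3 * u t x ^ 2 ≤ ε := by
      rw [div_mul_eq_mul_div, div_le_iff₀ (by positivity)]
      have : u t x ^ 2 ≤ r ^ 2 := by nlinarith [sq_nonneg ε]
      calc ε ^ 2 * u t x ^ 2 = ε * (ε * u t x ^ 2) := by ring
        _ ≤ ε * (r * r ^ 2) := by gcongr
        _ = ε * r ^ 3 := by ring
    have h3 : B t x ^ 2 ≤ C ^ 2 := by
      rw [← sq_abs (B t x)]
      exact pow_le_pow_left₀ (abs_nonneg _) (hC x) 2
    calc _ ≤ β / 4 * (ε ^ 2 / r ^ 3 * u t x ^ 2) * B t x ^ 2 := h1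
      _ ≤ β / 4 * ε * C ^ 2 := by gcongr
      _ = _ := by ring

/-- The bound of order `ε` on the derivative depends on the sup of the drift at each time, with no
uniformity in time, so it cannot be integrated directly. Instead the derivatives converge at each
time to a nonpositive limit, dominated by the bound on `∂ₜ u` over `[s, t]`, and the limit is
integrated. -/
theorem integral_abs_le_of_pos (h : IsAdvectionDiffusion L β u B) (hL : 0 < L) (hβ : 0 < β)
    {s t : ℝ} (hs : 0 < s) (hst : s ≤ t) :
    ∫ x, |u t x| ∂(torus L) ≤ ∫ x, |u s x| ∂(torus L) := by
  have hu := h.classical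
  set e : ℕ → ℝ := fun n => 1 / ((n : ℝ) + 1) with he
  have he0 : ∀ n, 0 < e n := fun n => Nat.one_div_pos_of_nat
  have het : Tendsto e atTop (𝓝 0) := tendsto_one_div_add_atTop_nhds_zero_nat
  set N : ℕ → ℝ → ℝ := fun n τ => ∫ x, Real.sqrt (u τ x ^ 2 + e n ^ 2) ∂(torus L) with hN
  set N' : ℕ → ℝ → ℝ := fun n τ =>
    ∫ x, u τ x / Real.sqrt (u τ x ^ 2 + e n ^ 2) * deriv (fun r => u r x) τ ∂(torus L) with hN'
  -- Here `0 / 0 = 0` is the correct value: the regularized quotients also vanish where `u = 0`.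
  set Z : ℝ → ℝ := fun τ => ∫ x, u τ x / |u τ x| * deriv (fun r => u r x) τ ∂(torus L) with hZ
  obtain ⟨C, hC⟩ := hu.exists_bound_deriv_time (t := t) hs
  have hb1 : ∀ v ε : ℝ, |v / Real.sqrt (v ^ 2 + ε ^ 2)| ≤ 1 := by
    intro v ε
    rw [abs_div, abs_of_nonneg (Real.sqrt_nonneg _)]
    refine div_le_one_of_le₀ ?_ (Real.sqrt_nonneg _)
    exact Real.abs_le_sqrt (by nlinarith [sq_nonneg ε])
  have hd : ∀ n, ∀ τ, 0 < τ → HasDerivAt (N n) (N' n τ) τ := by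
    intro n τ hτ
    have hr : ∀ v : ℝ, 0 < Real.sqrt (v ^ 2 + e n ^ 2) := fun v =>
      Real.sqrt_pos.2 (by have := he0 n; positivity)
    have hcont : Continuous fun v : ℝ => v / Real.sqrt (v ^ 2 + e n ^ 2) :=
      continuous_id.div (by fun_prop) fun v => (hr v).ne'
    exact hu.hasDerivAt_integral_comp (S := univ) (fun _ _ _ => mem_univ _)
      (fun v _ => hasDerivAt_sqrt_sq_add (he0 n) v) hcont.continuousOn hτ
  have hptb : ∀ n, ∀ τ ∈ Icc s t, ∀ᵐ x ∂(torus L),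
      ‖u τ x / Real.sqrt (u τ x ^ 2 + e n ^ 2) * deriv (fun r => u r x) τ‖ ≤ C := by
    intro n τ hτ
    filter_upwards [ae_restrict_mem measurableSet_Ioc] with x hx
    rw [Real.norm_eq_abs, abs_mul]
    refine (mul_le_of_le_one_left (abs_nonneg _) (hb1 _ _)).trans ?_
    exact hC τ hτ x (Ioc_subset_Icc_self hx)
  have hN'b : ∀ n, ∀ τ ∈ Icc s t, ‖N' n τ‖ ≤ C * (torus L).real univ := fun n τ hτ =>
    norm_integral_le_of_norm_le_const (hptb n τ hτ)
  have hsub : uIoc s t ⊆ Icc s t := by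
    rw [uIoc_of_le hst]; exact Ioc_subset_Icc_self
  have hm : ∀ n, AEStronglyMeasurable (N' n) (volume.restrict (uIoc s t)) := by
    intro n
    refine (measurable_deriv (N n)).aestronglyMeasurable.congr ?_
    filter_upwards [ae_restrict_mem measurableSet_uIoc] with τ hτ
    exact (hd n τ (hs.trans_le (hsub hτ).1)).deriv
  have hftc : ∀ n, ∫ τ in s..t, N' n τ = N n t - N n s := by
    intro n
    refine intervalIntegral.integral_eq_sub_of_hasDerivAt (fun τ hτ => hd n τ ?_) ?_
    · rw [uIcc_of_le hst] at hτ; exact hs.trans_le hτ.1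
    · rw [intervalIntegrable_iff]
      refine IntegrableOn.of_bound (by simp) (hm n) (C * (torus L).real univ) ?_
      filter_upwards [ae_restrict_mem measurableSet_uIoc] with τ hτ
      exact hN'b n τ (hsub hτ)
  have hlimN' : ∀ τ ∈ Icc s t, Tendsto (fun n => N' n τ) atTop (𝓝 (Z τ)) := by
    intro τ hτ
    have hτ0 : 0 < τ := hs.trans_le hτ.1
    have hcu := hu.continuous_space hτ0.le
    refine tendsto_integral_of_dominated_convergence (fun _ => C) (fun n => ?_)
      (integrable_const _) (fun n => hptb n τ hτ) (ae_of_all _ fun x => ?_)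
    · refine (Measurable.mul ?_ (hu.continuous_deriv_time hτ0).measurable).aestronglyMeasurable
      have := hcu.measurable
      fun_prop
    · refine Tendsto.mul_const _ ?_
      by_cases hx : u τ x = 0
      · simp [hx]
      · refine tendsto_const_nhds.div ?_ (abs_ne_zero.2 hx)
        have : Tendsto (fun n => Real.sqrt (u τ x ^ 2 + e n ^ 2)) atTop
            (𝓝 (Real.sqrt (u τ x ^ 2 + 0 ^ 2))) :=
          ((het.pow 2).const_add _).sqrt
        simpa [Real.sqrt_sq_eq_abs] using this
  have hZ0 : ∀ τ ∈ Icc s t, Z τ ≤ 0 := by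
    intro τ hτ
    have hτ0 : 0 < τ := hs.trans_le hτ.1
    obtain ⟨K, hK⟩ := h.bounded τ hτ0
    have h1 : Tendsto (fun n => e n * (β / 4 * K ^ 2 * L)) atTop (𝓝 0) := by
      simpa using het.mul_const (β / 4 * K ^ 2 * L)
    exact le_of_tendsto_of_tendsto (hlimN' τ hτ) h1 (Eventually.of_forall fun n =>
      h.integral_div_sqrt_mul_deriv_time_le hL hβ hτ0 hK (he0 n))
  have hlim1 : Tendsto (fun n => ∫ τ in s..t, N' n τ) atTop (𝓝 (∫ τ in s..t, Z τ)) := by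
    refine intervalIntegral.tendsto_integral_filter_of_dominated_convergence
      (fun _ => C * (torus L).real univ) (Eventually.of_forall hm)
      (Eventually.of_forall fun n => ae_of_all _ fun τ hτ => hN'b n τ (hsub hτ))
      intervalIntegrable_const (ae_of_all _ fun τ hτ => hlimN' τ (hsub hτ))
  have hlimN : ∀ τ, 0 ≤ τ → Tendsto (fun n => N n τ) atTop (𝓝 (∫ x, |u τ x| ∂(torus L))) := by
    intro τ hτ
    have hcu := hu.continuous_space hτ
    refine tendsto_integral_of_dominated_convergence (fun x => |u τ x| + 1) (fun n => ?_)
      ((hcu.abs.add continuous_const).integrable_torus L) (fun n => ae_of_all _ fun x => ?_)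
      (ae_of_all _ fun x => ?_)
    · exact (Continuous.aestronglyMeasurable (by fun_prop))
    · rw [Real.norm_of_nonneg (Real.sqrt_nonneg _)]
      refine Real.sqrt_le_iff.2 ⟨by positivity, ?_⟩
      have h1 : e n ≤ 1 := by
        simp only [he]; rw [div_le_one (by positivity)]; linarith [(Nat.cast_nonneg n : (0:ℝ) ≤ n)]
      have := he0 n
      nlinarith [sq_abs (u τ x), abs_nonneg (u τ x)]
    · have : Tendsto (fun n => Real.sqrt (u τ x ^ 2 + e n ^ 2)) atTop
            (𝓝 (Real.sqrt (u τ x ^ 2 + 0 ^ 2))) := ((het.pow 2).const_add _).sqrt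
      simpa [Real.sqrt_sq_eq_abs] using this
  simp only [hftc] at hlim1
  have h1 := tendsto_nhds_unique hlim1
    ((hlimN t (hs.le.trans hst)).sub (hlimN s hs.le))
  have h2 : ∫ τ in s..t, Z τ ≤ 0 := by
    have := intervalIntegral.integral_nonneg (f := fun τ => -Z τ) (μ := volume) hst
      fun τ hτ => by linarith [hZ0 τ hτ]
    rw [intervalIntegral.integral_neg] at this
    linarith
  linarith

theorem integral_abs_le (h : IsAdvectionDiffusion L β u B) (hL : 0 < L) (hβ : 0 < β)
    {t : ℝ} (ht : 0 ≤ t) : ∫ x, |u t x| ∂(torus L) ≤ ∫ x, |u 0 x| ∂(torus L) := by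
  rcases ht.eq_or_lt with rfl | ht
  · rfl
  have hc := h.classical.continuousOn_integral_comp (j := fun v => |v|) (S := univ)
    (fun _ _ _ => mem_univ _) continuous_abs.continuousOn
  have h0 : Tendsto (fun t => ∫ x, |u t x| ∂(torus L)) (𝓝[>] 0)
      (𝓝 (∫ x, |u 0 x| ∂(torus L))) :=
    (hc 0 (mem_Ici.2 le_rfl)).mono_left (nhdsWithin_mono _ Ioi_subset_Ici_self)
  refine ge_of_tendsto h0 ?_
  filter_upwards [Ioo_mem_nhdsGT ht] with s hs
  exact h.integral_abs_le_of_pos hL hβ hs.1 hs.2.le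

/-- The positivity of a density is preserved. -/
theorem nonneg (h : IsAdvectionDiffusion L β u B) (hL : 0 < L) (hβ : 0 < β)
    (h0 : ∀ᵐ x ∂(torus L), 0 ≤ u 0 x) {t : ℝ} (ht : 0 ≤ t) (x : ℝ) : 0 ≤ u t x := by
  have hcu := h.classical.continuous_space ht
  have h1 := h.integral_abs_le hL hβ ht
  have h2 : ∫ x, |u 0 x| ∂(torus L) = ∫ x, u 0 x ∂(torus L) :=
    integral_congr_ae (by filter_upwards [h0] with x hx; exact abs_of_nonneg hx)
  rw [h2, ← h.integral_eq hL ht] at h1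
  by_contra hneg
  push Not at hneg
  set y := toIcoMod hL (-(L / 2)) x with hy
  have hyu : u t y = u t x := by
    rw [hy, toIcoMod]
    exact (h.classical.periodic t ht).sub_zsmul_eq _
  have hym := toIcoMod_mem_Ico hL (-(L / 2)) x
  -- Mass conservation and the `L¹` bound force `∫ (|u| - u) ≤ 0`, while a negative value, moved
  -- into the base period, makes this continuous nonnegative integrand positive somewhere.
  have hpos : 0 < ∫ x in (-(L / 2))..(L / 2), (|u t x| - u t x) := by
    refine intervalIntegral.integral_pos (by linarith) (hcu.abs.sub hcu).continuousOn
      (fun z _ => sub_nonneg.2 (le_abs_self _)) ⟨y, ⟨hym.1, by linarith [hym.2]⟩, ?_⟩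
    rw [hyu, abs_of_neg hneg]; linarith
  rw [intervalIntegral.integral_sub (hcu.abs.intervalIntegrable _ _)
    (hcu.intervalIntegrable _ _), ← integral_torus_eq hL, ← integral_torus_eq hL] at hpos
  linarith

end IsAdvectionDiffusion

/-! ### Dissipation of the relative entropy -/

/-- The relative entropy of `f + ε` on the torus. -/
noncomputable def regEntropy (L ε : ℝ) (f : ℝ → ℝ) : ℝ :=
  ∫ x, (f x + ε) * Real.log ((f x + ε) * L) ∂(torus L)

/-- The error in replacing the relative entropy by its regularization. -/
noncomputable def regError (L ε : ℝ) : ℝ :=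
  ε * (L + L * (1 + ε * L)) + L * |ε * Real.log (ε * L)|

theorem tendsto_regError {L : ℝ} (hL : 0 < L) :
    Tendsto (regError L) (𝓝[>] 0) (𝓝 0) := by
  have h1 : Continuous fun ε : ℝ => ε * (L + L * (1 + ε * L)) + L * |L⁻¹ * (ε * L * Real.log (ε * L))| := by
    have := Real.continuous_mul_log.comp (continuous_mul_const L)
    have h2 : Continuous fun ε : ℝ => ε * L * Real.log (ε * L) := this
    fun_prop
  have h2 := h1.tendsto 0
  simp only [zero_mul, mul_zero, abs_zero, add_zero] at h2
  refine (h2.mono_left nhdsWithin_le_nhds).congr fun ε => ?_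
  rw [regError]
  congr 3
  field_simp

theorem integral_torus_const {L : ℝ} (hL : 0 < L) (c : ℝ) : ∫ _, c ∂(torus L) = L * c := by
  rw [integral_const, smul_eq_mul, Measure.real, torus_univ L, ENNReal.toReal_ofReal hL.le]

theorem continuous_mul_log_mul (L : ℝ) : Continuous fun v : ℝ => v * Real.log (v * L) := by
  rcases eq_or_ne L 0 with rfl | hL
  · simpa using continuous_const
  · have h1 : Continuous fun v : ℝ => L⁻¹ * (v * L * Real.log (v * L)) :=
      (Real.continuous_mul_log.comp (continuous_mul_const L)).const_mul _
    refine h1.congr fun v => ?_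
    field_simp

/-- The increment splits as `f log (1 + ε / f) + ε log ((f + ε) L)`; the first part lies in `[0, ε]`
and the second is controlled by `log x ≤ x` and by monotonicity. Only the mass of `f` enters, so one
error serves all `(ξ, ω)`. -/
theorem abs_regEntropy_sub_le {L : ℝ} (hL : 0 < L) {f : ℝ → ℝ} (hf : Continuous f)
    (hf0 : ∀ x, 0 ≤ f x) (hf1 : ∫ x, f x ∂(torus L) = 1) {ε : ℝ} (hε : 0 < ε) :
    |regEntropy L ε f - ∫ x, f x * Real.log (f x * L) ∂(torus L)| ≤ regError L ε := by
  have c1 : Continuous fun x => f x * Real.log (f x * L) := (continuous_mul_log_mul L).comp hf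
  have c2 : Continuous fun x => (f x + ε) * Real.log ((f x + ε) * L) :=
    (continuous_mul_log_mul L).comp (hf.add_const ε)
  have key : ∀ x, ε * Real.log (ε * L) ≤
      (f x + ε) * Real.log ((f x + ε) * L) - f x * Real.log (f x * L) ∧
      (f x + ε) * Real.log ((f x + ε) * L) - f x * Real.log (f x * L)
        ≤ ε * (1 + (f x + ε) * L) := by
    intro x
    have hl1 : Real.log (ε * L) ≤ Real.log ((f x + ε) * L) :=
      Real.log_le_log (by positivity) (by nlinarith [hf0 x])
    have hl2 : Real.log ((f x + ε) * L) ≤ (f x + ε) * L :=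
      (Real.log_le_sub_one_of_pos (by have := hf0 x; positivity)).trans (by linarith)
    rcases (hf0 x).eq_or_lt with h0 | h0
    · rw [← h0] at hl1 hl2 ⊢
      simp only [zero_add, zero_mul, sub_zero] at hl1 hl2 ⊢
      exact ⟨le_rfl, by nlinarith⟩
    · have e : (f x + ε) * Real.log ((f x + ε) * L) - f x * Real.log (f x * L)
          = f x * Real.log (1 + ε / f x) + ε * Real.log ((f x + ε) * L) := by
        have : (f x + ε) * L = f x * L * (1 + ε / f x) := by field_simp
        rw [this, Real.log_mul (by positivity) (by positivity)]; ring
      have h1 : 0 ≤ f x * Real.log (1 + ε / f x) :=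
        mul_nonneg h0.le (Real.log_nonneg (by have : 0 ≤ ε / f x := by positivity
                                              linarith))
      have h2 : f x * Real.log (1 + ε / f x) ≤ ε := by
        have := mul_le_mul_of_nonneg_left (Real.log_le_sub_one_of_pos
          (show 0 < 1 + ε / f x by positivity)) h0.le
        refine this.trans_eq ?_
        field_simp; ring
      rw [e]
      constructor <;> nlinarith
  rw [regEntropy, ← integral_sub (c2.integrable_torus L) (c1.integrable_torus L)]
  have hlow : L * (ε * Real.log (ε * L)) ≤ ∫ x, ((f x + ε) * Real.log ((f x + ε) * L)
      - f x * Real.log (f x * L)) ∂(torus L) := by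
    rw [← integral_torus_const hL]
    exact integral_mono (integrable_const _) ((c2.sub c1).integrable_torus L) fun x => (key x).1
  have hup : ∫ x, ((f x + ε) * Real.log ((f x + ε) * L)
      - f x * Real.log (f x * L)) ∂(torus L) ≤ ε * (L + L * (1 + ε * L)) := by
    refine (integral_mono ((c2.sub c1).integrable_torus L)
      (Continuous.integrable_torus (by fun_prop) L) fun x => (key x).2).trans_eq ?_
    rw [integral_const_mul, integral_add (integrable_const _)
      (Continuous.integrable_torus (by fun_prop) L), integral_mul_const,
      integral_add (hf.integrable_torus L) (integrable_const _), hf1, integral_torus_const hL,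
      integral_torus_const hL]
    ring
  rw [regError, abs_le]
  have h1 : 0 ≤ ε * (L + L * (1 + ε * L)) := by positivity
  have h2 : -(L * |ε * Real.log (ε * L)|) ≤ L * (ε * Real.log (ε * L)) := by
    rw [← mul_neg]
    exact mul_le_mul_of_nonneg_left (neg_abs_le _) hL.le
  have h3 : 0 ≤ L * |ε * Real.log (ε * L)| := by positivity
  constructor <;> linarith

/-- Equivalent to `1 + s² ≤ exp s` for `s ≥ 0`, which the cubic Taylor polynomial gives. It makes `ε
log (1 + u / ε)` at most `√ε √u`, an error integrable by mass alone. -/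
theorem log_one_add_le_sqrt {z : ℝ} (hz : 0 ≤ z) : Real.log (1 + z) ≤ Real.sqrt z := by
  have h1 : 1 + z ≤ Real.exp (Real.sqrt z) := by
    set s := Real.sqrt z with hs
    have hs0 : 0 ≤ s := Real.sqrt_nonneg _
    have hs2 : s ^ 2 = z := Real.sq_sqrt hz
    have h2 : 1 + s / 2 + (s / 2) ^ 2 / 2 ≤ Real.exp (s / 2) :=
      Real.quadratic_le_exp_of_nonneg (by positivity)
    have h3 : Real.exp s = Real.exp (s / 2) ^ 2 := by
      rw [← Real.exp_nat_mul]; congr 1; push_cast; ring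
    have h4 : 1 + s + s ^ 2 / 2 + s ^ 3 / 6 ≤ Real.exp s := by
      have := Real.sum_le_exp_of_nonneg hs0 4
      norm_num [Finset.sum_range_succ, Nat.factorial] at this
      linarith
    rcases le_total s 3 with h5 | h5
    · rw [← hs2]
      nlinarith [mul_nonneg hs0 (sq_nonneg (s - 3 / 2)), mul_nonneg hs0 (sq_nonneg s)]
    · rw [← hs2]
      nlinarith [mul_nonneg hs0 (sq_nonneg s), mul_nonneg (sub_nonneg.2 h5) (sq_nonneg s)]
  calc Real.log (1 + z) ≤ Real.log (Real.exp (Real.sqrt z)) :=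
        Real.log_le_log (by positivity) h1
    _ = _ := Real.log_exp _

namespace IsAdvectionDiffusion

variable {L β : ℝ} {u B : ℝ → ℝ → ℝ}

/-- Dissipation of the regularized entropy along a density, where `K` bounds the pairing of the
drift with derivatives. -/
theorem exists_hasDerivAt_regEntropy (h : IsAdvectionDiffusion L β u B) (hL : 0 < L) (hβ : 0 < β)
    (hu0 : ∀ t, 0 ≤ t → ∀ x, 0 ≤ u t x) (hu1 : ∀ t, 0 ≤ t → ∫ x, u t x ∂(torus L) = 1)
    {ε t K : ℝ} (hε : 0 < ε) (ht : 0 < t) (hK0 : 0 ≤ K)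
    (hK : ∀ η η' : ℝ → ℝ, (∀ x, HasDerivAt η (η' x) x) → Continuous η' → Function.Periodic η L →
      -∫ x, η' x * B t x ∂(torus L) ≤ K * ∫ x, |η x| ∂(torus L)) :
    ∃ d, HasDerivAt (fun s => regEntropy L ε (u s)) d t ∧
      d + 4 * Real.pi ^ 2 / (L ^ 2 * β) *
        (regEntropy L ε (u t) - (1 + ε * L) * Real.log (1 + ε * L)) ≤
      K * (∫ x, |u t x - L⁻¹| ∂(torus L) + Real.sqrt ε * ((L + 1) / 2)) := by
  have hu := h.classical
  have hcu := hu.continuous_space ht.le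
  have hcd := hu.continuous_deriv_space ht
  have hpos : ∀ v ∈ Ici (0 : ℝ), 0 < v + ε := fun v hv => by
    have : 0 ≤ v := hv
    linarith
  have hφ : ∀ v ∈ Ici (0 : ℝ), HasDerivAt (fun v => (v + ε) * Real.log ((v + ε) * L))
      (Real.log ((v + ε) * L) + 1) v := by
    intro v hv
    have hp := hpos v hv
    have h1 : HasDerivAt (fun v : ℝ => v + ε) 1 v := (hasDerivAt_id v).add_const ε
    have h2 : HasDerivAt (fun v : ℝ => (v + ε) * L) L v := by simpa using h1.mul_const L
    have h3 := h1.mul (h2.log (by positivity))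
    refine h3.congr_deriv ?_
    field_simp
  have hφ' : ∀ v ∈ Ici (0 : ℝ), HasDerivAt (fun v => Real.log ((v + ε) * L) + 1)
      ((v + ε)⁻¹) v := by
    intro v hv
    have hp := hpos v hv
    have h1 : HasDerivAt (fun v : ℝ => v + ε) 1 v := (hasDerivAt_id v).add_const ε
    have h2 : HasDerivAt (fun v : ℝ => (v + ε) * L) L v := by simpa using h1.mul_const L
    refine ((h2.log (by positivity)).add_const 1).congr_deriv ?_
    field_simp
  have hφ'c : ContinuousOn (fun v => Real.log ((v + ε) * L) + 1) (Ici (0 : ℝ)) := fun v hv =>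
    (hφ' v hv).continuousAt.continuousWithinAt
  have hφ''c : ContinuousOn (fun v : ℝ => (v + ε)⁻¹) (Ici (0 : ℝ)) :=
    ContinuousOn.inv₀ (by fun_prop) fun v hv => (hpos v hv).ne'
  have hd := hu.hasDerivAt_integral_comp (S := Ici 0) hu0 hφ hφ'c ht
  rw [h.integral_mul_deriv_time hL (S := Ici 0) hu0 hφ' hφ''c ht] at hd
  refine ⟨_, hd, ?_⟩
  have hp : ∀ x, 0 < u t x + ε := fun x => hpos _ (hu0 t ht.le x)
  have hci : Continuous fun x => (u t x + ε)⁻¹ := (hcu.add_const ε).inv₀ fun x => (hp x).ne'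
  -- the drift term
  set η : ℝ → ℝ := fun x => u t x - ε * Real.log (1 + u t x / ε) - L⁻¹ with hη
  set η' : ℝ → ℝ := fun x => (u t x + ε)⁻¹ * deriv (u t) x * u t x with hη'
  have hη'c : Continuous η' := (hci.mul hcd).mul hcu
  -- The weight in the drift term is `u u' / (u + ε)`, not `u'`, and `η` is its primitive. The
  -- constant `L⁻¹` leaves the distance to equilibrium as `ε → 0`.
  have hηd : ∀ x, HasDerivAt η (η' x) x := by
    intro x
    have h1 := hu.hasDerivAt_space ht x
    have h0 := hu0 t ht.le x
    have h2 := ((h1.div_const ε).const_add 1).log (by positivity)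
    refine ((h1.sub (h2.const_mul ε)).sub_const L⁻¹).congr_deriv ?_
    have h3 := (hp x).ne'
    have h4 : 1 + u t x / ε = (u t x + ε) / ε := by field_simp; ring
    simp only [hη', h4]
    field_simp
    ring
  have hηc : Continuous η := continuous_iff_continuousAt.2 fun x => (hηd x).continuousAt
  have hηp : Function.Periodic η L := fun x => by simp only [hη, hu.periodic t ht.le x]
  have hdrift := hK η η' hηd hη'c hηp
  have hηb : ∫ x, |η x| ∂(torus L) ≤
      ∫ x, |u t x - L⁻¹| ∂(torus L) + Real.sqrt ε * ((L + 1) / 2) := by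
    have hpt : ∀ x, |η x| ≤ |u t x - L⁻¹| + Real.sqrt ε * ((1 + u t x) / 2) := by
      intro x
      have h0 := hu0 t ht.le x
      have h1 : 0 ≤ ε * Real.log (1 + u t x / ε) :=
        mul_nonneg hε.le (Real.log_nonneg (by have : 0 ≤ u t x / ε := by positivity
                                              linarith))
      have h2 : ε * Real.log (1 + u t x / ε) ≤ Real.sqrt ε * ((1 + u t x) / 2) := by
        have h3 := mul_le_mul_of_nonneg_left (log_one_add_le_sqrt
          (show 0 ≤ u t x / ε by positivity)) hε.le
        have hs : 0 < Real.sqrt ε := Real.sqrt_pos.2 hε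
        have hs2 : Real.sqrt ε ^ 2 = ε := Real.sq_sqrt hε.le
        have h4 : ε * Real.sqrt (u t x / ε) = Real.sqrt ε * Real.sqrt (u t x) := by
          rw [Real.sqrt_div h0]
          nth_rewrite 1 [← hs2]
          field_simp
        have h5 : Real.sqrt (u t x) ≤ (1 + u t x) / 2 := by
          nlinarith [sq_nonneg (Real.sqrt (u t x) - 1), Real.sq_sqrt h0]
        rw [h4] at h3
        exact h3.trans (mul_le_mul_of_nonneg_left h5 hs.le)
      have e : η x = (u t x - L⁻¹) - ε * Real.log (1 + u t x / ε) := by simp only [hη]; ring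
      rw [e]
      refine (abs_sub _ _).trans ?_
      rw [abs_of_nonneg h1]
      linarith
    refine (integral_mono (hηc.abs.integrable_torus L)
      (Continuous.integrable_torus (by fun_prop) L) hpt).trans_eq ?_
    rw [integral_add (Continuous.integrable_torus (by fun_prop) L)
      (Continuous.integrable_torus (by fun_prop) L), integral_const_mul, integral_div,
      integral_add (integrable_const _) (hcu.integrable_torus L), hu1 t ht.le,
      integral_torus_const hL, mul_one]
  -- the diffusive term
  have hlsi := integral_mul_log_le (a := -(L / 2)) (b := L / 2) (by linarith)
    (v := fun x => u t x + ε) (v' := deriv (u t)) (by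
      have := hu.periodic t ht.le (-(L / 2))
      rw [show -(L / 2) + L = L / 2 by ring] at this
      simp only [this]) hp (fun x => (hu.hasDerivAt_space ht x).add_const ε) hcd
    (m := 1 + ε * L) (by positivity) (by
      rw [← integral_torus_eq hL, integral_add (hcu.integrable_torus L) (integrable_const _),
        hu1 t ht.le, integral_torus_const hL]
      ring)
  rw [show L / 2 - -(L / 2) = L by ring, ← integral_torus_eq hL, ← integral_torus_eq hL] at hlsi
  have hcf : Continuous fun x => deriv (u t) x ^ 2 / (u t x + ε) := by
    refine (hcd.pow 2).div (hcu.add_const ε) fun x => (hp x).ne'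
  obtain ⟨C, hC⟩ := h.bounded t ht
  have hsplit : ∫ x, (u t x + ε)⁻¹ * deriv (u t) x * (u t x * B t x + β⁻¹ * deriv (u t) x) ∂(torus L)
      = ∫ x, η' x * B t x ∂(torus L) + β⁻¹ * ∫ x, deriv (u t) x ^ 2 / (u t x + ε) ∂(torus L) := by
    rw [← integral_const_mul, ← integral_add]
    · congr 1; funext x; simp only [hη']; field_simp
    · exact (hη'c.integrable_torus L).mul_bdd (c := C) (h.measurable t ht).aestronglyMeasurable
        (ae_of_all _ hC)
    · exact (hcf.const_mul _).integrable_torus L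
  rw [hsplit]
  -- The logarithmic Sobolev inequality for `u + ε`, whose mass `1 + ε * L` accounts for the
  -- subtracted term.
  have hfin : 4 * Real.pi ^ 2 / (L ^ 2 * β) *
      (regEntropy L ε (u t) - (1 + ε * L) * Real.log (1 + ε * L))
      ≤ β⁻¹ * ∫ x, deriv (u t) x ^ 2 / (u t x + ε) ∂(torus L) := by
    refine (mul_le_mul_of_nonneg_left hlsi (by positivity)).trans_eq ?_
    have := Real.pi_pos
    field_simp
  have hKη := mul_le_mul_of_nonneg_left hηb hK0
  linarith

end IsAdvectionDiffusion

/-! ### Graphops -/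

section Graphop

variable {Ω : Type*} [MeasurableSpace Ω] {μ : Measure Ω}

theorem inner_nonneg_of_nonneg {φ ψ : Lp ℝ 2 μ} (hφ : 0 ≤ φ) (hψ : 0 ≤ ψ) :
    0 ≤ (inner ℝ φ ψ : ℝ) := by
  rw [L2.inner_def]
  refine integral_nonneg_of_ae ?_
  filter_upwards [(Lp.coeFn_nonneg φ).2 hφ, (Lp.coeFn_nonneg ψ).2 hψ] with ξ h1 h2
  simp only [Pi.zero_apply] at h1 h2
  simpa [mul_comm] using mul_nonneg h1 h2

/-- The bridge between the inner product of `L²`, where the graphop is self-adjoint, and the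
extended integrals in which the estimates are made. -/
theorem lintegral_ofReal_mul_ofReal {φ ψ : Lp ℝ 2 μ} (hφ : 0 ≤ φ) (hψ : 0 ≤ ψ) :
    ∫⁻ ξ, ENNReal.ofReal (φ ξ) * ENNReal.ofReal (ψ ξ) ∂μ = ENNReal.ofReal (inner ℝ φ ψ) := by
  rw [L2.inner_def, ofReal_integral_eq_lintegral_ofReal (L2.integrable_inner φ ψ)]
  · refine lintegral_congr_ae ?_
    filter_upwards [(Lp.coeFn_nonneg φ).2 hφ] with ξ h1
    rw [← ENNReal.ofReal_mul h1]
    simp [mul_comm]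
  · filter_upwards [(Lp.coeFn_nonneg φ).2 hφ, (Lp.coeFn_nonneg ψ).2 hψ] with ξ h1 h2
    simp only [Pi.zero_apply] at h1 h2
    simpa [mul_comm] using mul_nonneg h1 h2

/-- Positivity applied to `|g| - g` and `|g| + g`. -/
theorem IsGraphop.abs_apply_le {A : Lp ℝ 2 μ →L[ℝ] Lp ℝ 2 μ} (hA : IsGraphop A) (g : Lp ℝ 2 μ) :
    ∀ᵐ ξ ∂μ, |A g ξ| ≤ A |g| ξ := by
  have h1 : A g ≤ A |g| := by
    have := hA.positive (|g| - g) (sub_nonneg.2 (le_abs_self g))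
    rwa [map_sub, sub_nonneg] at this
  have h2 : -A g ≤ A |g| := by
    have := hA.positive (|g| - -g) (sub_nonneg.2 (neg_le_abs g))
    rwa [map_sub, map_neg, sub_nonneg] at this
  filter_upwards [(Lp.coeFn_le _ _).2 h1, (Lp.coeFn_le _ _).2 h2, Lp.coeFn_neg (A g)]
    with ξ e1 e2 e3
  rw [e3] at e2
  exact abs_le'.2 ⟨e1, e2⟩

theorem inner_apply_le_numericalRadius (A : Lp ℝ 2 μ →L[ℝ] Lp ℝ 2 μ) (f : Lp ℝ 2 μ) :
    inner ℝ (A f) f ≤ numericalRadius A * ‖f‖ ^ 2 := by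
  rcases eq_or_ne f 0 with rfl | hf
  · simp
  have hn : 0 < ‖f‖ := norm_pos_iff.2 hf
  have hbdd : BddAbove {r : ℝ | ∃ f : Lp ℝ 2 μ, ‖f‖ = 1 ∧ r = inner ℝ (A f) f} := by
    refine ⟨‖A‖, ?_⟩
    rintro r ⟨f, hf, rfl⟩
    refine (real_inner_le_norm _ _).trans ?_
    have := A.le_opNorm f
    rw [hf] at *
    simpa using this
  have h1 := le_csSup hbdd ⟨‖f‖⁻¹ • f, by
    rw [norm_smul, norm_inv, norm_norm, inv_mul_cancel₀ hn.ne'], rfl⟩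
  rw [map_smul, real_inner_smul_left, real_inner_smul_right] at h1
  have h2 := mul_le_mul_of_nonneg_right h1 (sq_nonneg ‖f‖)
  refine le_trans (le_of_eq ?_) h2
  field_simp

/-- A normalized nonnegative function has a nonnegative quadratic form. If `L²` is trivial, the
supremum is over the empty set and equals `0`. -/
theorem IsGraphop.numericalRadius_nonneg {A : Lp ℝ 2 μ →L[ℝ] Lp ℝ 2 μ} (hA : IsGraphop A) :
    0 ≤ numericalRadius A := by
  by_cases h : ∃ f : Lp ℝ 2 μ, f ≠ 0
  · obtain ⟨f, hf⟩ := h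
    have hn : 0 < ‖|f|‖ := by rw [norm_abs_eq_norm]; exact norm_pos_iff.2 hf
    have hp : 0 ≤ ‖|f|‖⁻¹ • |f| := by
      rw [← Lp.coeFn_nonneg]
      filter_upwards [Lp.coeFn_smul ‖|f|‖⁻¹ |f|, (Lp.coeFn_nonneg |f|).2 (abs_nonneg f)]
        with ξ h1 h2
      rw [h1]
      exact mul_nonneg (inv_pos.2 hn).le h2
    exact Real.sSup_nonneg' ⟨_, ⟨‖|f|‖⁻¹ • |f|, by rw [norm_smul, norm_inv, norm_norm, inv_mul_cancel₀ hn.ne'], rfl⟩,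
      inner_nonneg_of_nonneg (hA.positive _ hp) hp⟩
  · push Not at h
    refine Real.sSup_nonneg ?_
    rintro r ⟨f, hf, rfl⟩
    rw [h f, map_zero, inner_zero_left]

/-- Truncation is 1-Lipschitz and fixes `c`, so it only moves `y` closer to `c`; the bound for
truncations is therefore uniform in `n`. -/
theorem abs_truncate_sub_le {n : ℕ} {c : ℝ} (hc : |c| ≤ n) (y : ℝ) :
    |truncate n y - c| ≤ |y - c| := by
  have h := abs_le.1 hc
  rw [truncate]
  grind

/-- Domination of the image under a graphop, in duality form. -/
theorem IsGraphop.lintegral_image_le [IsFiniteMeasure μ] {A : Lp ℝ 2 μ →L[ℝ] Lp ℝ 2 μ}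
    (hA : IsGraphop A) {f w : Ω → ℝ} (hw : IsImage A f w) (c : ℝ) {ψ : Lp ℝ 2 μ} (hψ : 0 ≤ ψ) :
    ∫⁻ ξ, ENNReal.ofReal (ψ ξ) * ‖w ξ - A ((memLp_const c).toLp _) ξ‖ₑ ∂μ ≤
      ∫⁻ ξ, ENNReal.ofReal (A ψ ξ) * ‖f ξ - c‖ₑ ∂μ := by
  set c₁ : Lp ℝ 2 μ := (memLp_const c).toLp _ with hc₁
  have hm : ∀ n : ℕ, MemLp (fun ξ => truncate n (f ξ)) 2 μ := by
    intro n
    have hcont : Continuous (truncate n) := by unfold truncate; fun_prop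
    refine MemLp.of_bound (hcont.measurable.comp_aemeasurable hw.aemeasurable).aestronglyMeasurable
      n (ae_of_all _ fun ξ => ?_)
    have hn : (0 : ℝ) ≤ n := Nat.cast_nonneg n
    rw [Real.norm_eq_abs, truncate]
    grind
  set F : ℕ → Lp ℝ 2 μ := fun n => (hm n).toLp _ with hF
  -- The image is only a limit in measure; a subsequence converging almost everywhere is enough for
  -- Fatou.
  obtain ⟨ns, hns, hlim⟩ := hw.tendsto.exists_seq_tendsto_ae
  have hap : ∀ n : ℕ, applyL2 A (fun ξ => truncate n (f ξ)) = (A (F n) : Ω → ℝ) := by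
    intro n
    rw [applyL2, dif_pos (hm n)]
  simp only [hap] at hlim
  obtain ⟨N, hN⟩ := exists_nat_ge |c|
  have hmeas : ∀ n, AEMeasurable
      (fun ξ => ENNReal.ofReal (ψ ξ) * ‖A (F n) ξ - A c₁ ξ‖ₑ) μ := fun n =>
    (Lp.aestronglyMeasurable ψ).aemeasurable.ennreal_ofReal.mul
      ((Lp.aestronglyMeasurable _).sub (Lp.aestronglyMeasurable _)).enorm
  have hbound : ∀ n, N ≤ n → ∫⁻ ξ, ENNReal.ofReal (ψ ξ) * ‖A (F n) ξ - A c₁ ξ‖ₑ ∂μ ≤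
      ∫⁻ ξ, ENNReal.ofReal (A ψ ξ) * ‖f ξ - c‖ₑ ∂μ := by
    intro n hn
    have hcn : |c| ≤ n := hN.trans (by exact_mod_cast hn)
    have habs : (0 : Lp ℝ 2 μ) ≤ |F n - c₁| := abs_nonneg _
    -- Domination by `A |F n - c₁|`, then self-adjointness moves `A` to the weight, then the
    -- truncation is compared with `f`.
    calc ∫⁻ ξ, ENNReal.ofReal (ψ ξ) * ‖A (F n) ξ - A c₁ ξ‖ₑ ∂μ
        ≤ ∫⁻ ξ, ENNReal.ofReal (ψ ξ) * ENNReal.ofReal (A |F n - c₁| ξ) ∂μ := by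
          refine lintegral_mono_ae ?_
          filter_upwards [hA.abs_apply_le (F n - c₁), Lp.coeFn_sub (A (F n)) (A c₁)] with ξ h1 h2
          rw [map_sub, h2, Pi.sub_apply] at h1
          rw [← ofReal_norm, Real.norm_eq_abs]
          gcongr
      _ = ENNReal.ofReal (inner ℝ ψ (A |F n - c₁|)) :=
          lintegral_ofReal_mul_ofReal hψ (hA.positive _ habs)
      _ = ENNReal.ofReal (inner ℝ (A ψ) |F n - c₁|) := by rw [hA.selfAdjoint]
      _ = ∫⁻ ξ, ENNReal.ofReal (A ψ ξ) * ENNReal.ofReal (|F n - c₁| ξ) ∂μ :=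
          (lintegral_ofReal_mul_ofReal (hA.positive _ hψ) habs).symm
      _ ≤ _ := by
          refine lintegral_mono_ae ?_
          filter_upwards [Lp.coeFn_abs (F n - c₁), Lp.coeFn_sub (F n) c₁, (hm n).coeFn_toLp,
            (memLp_const (p := 2) (μ := μ) c).coeFn_toLp] with ξ h1 h2 h3 h4
          rw [h1, h2, Pi.sub_apply, h3, hc₁, h4, ← ofReal_norm, Real.norm_eq_abs]
          gcongr ENNReal.ofReal _ * ENNReal.ofReal ?_
          exact abs_truncate_sub_le hcn _
  calc ∫⁻ ξ, ENNReal.ofReal (ψ ξ) * ‖w ξ - A c₁ ξ‖ₑ ∂μ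
      ≤ ∫⁻ ξ, liminf (fun i => ENNReal.ofReal (ψ ξ) * ‖A (F (ns i)) ξ - A c₁ ξ‖ₑ) atTop ∂μ := by
        refine lintegral_mono_ae ?_
        filter_upwards [hlim] with ξ hξ
        have h1 : Tendsto (fun i => ENNReal.ofReal (ψ ξ) * ‖A (F (ns i)) ξ - A c₁ ξ‖ₑ) atTop
            (𝓝 (ENNReal.ofReal (ψ ξ) * ‖w ξ - A c₁ ξ‖ₑ)) :=
          ENNReal.Tendsto.const_mul ((hξ.sub_const _).enorm) (Or.inr ENNReal.ofReal_ne_top)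
        exact h1.liminf_eq.ge
    _ ≤ liminf (fun i => ∫⁻ ξ, ENNReal.ofReal (ψ ξ) * ‖A (F (ns i)) ξ - A c₁ ξ‖ₑ ∂μ) atTop :=
        lintegral_liminf_le' fun i => hmeas _
    _ ≤ _ := by
        refine liminf_le_of_frequently_le' (Eventually.frequently ?_)
        filter_upwards [eventually_ge_atTop N] with i hi
        exact hbound _ (hi.trans hns.le_apply)

end Graphop

/-! ### The interaction at a fixed time -/

section Slice

variable {X Y Ω : Type*} [MeasurableSpace X] [MeasurableSpace Y] [MeasurableSpace Ω]
  {T : Measure X} {ν : Measure Y} {μ : Measure Ω}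

theorem measurePreserving_prod_rearrange [SFinite T] [SFinite ν] [SFinite μ] :
    MeasurePreserving (fun z : (X × Y) × Ω => (z.1.1, (z.2, z.1.2)))
      ((T.prod ν).prod μ) (T.prod (μ.prod ν)) :=
  ((MeasurePreserving.id T).prod (Measure.measurePreserving_swap (μ := ν) (ν := μ))).comp
    (measurePreserving_prodAssoc T ν μ)

/-- The weight depends on `ξ` alone, so Tonelli reduces the claim to the fibrewise bound at almost
every `(x, ω)`. -/
theorem IsGraphop.lintegral_lintegral_image_le [SFinite T] [SFinite ν] [IsFiniteMeasure μ]
    {A : Lp ℝ 2 μ →L[ℝ] Lp ℝ 2 μ} (hA : IsGraphop A) {R W : X → Ω → Y → ℝ}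
    (hR : AEStronglyMeasurable (fun z : X × Ω × Y => R z.1 z.2.1 z.2.2) (T.prod (μ.prod ν)))
    (hW : AEStronglyMeasurable (fun z : X × Ω × Y => W z.1 z.2.1 z.2.2) (T.prod (μ.prod ν)))
    (hRW : ∀ᵐ q ∂(T.prod ν), IsImage A (fun ξ => R q.1 ξ q.2) (fun ξ => W q.1 ξ q.2))
    (c : ℝ) {ψ : Lp ℝ 2 μ} (hψ : 0 ≤ ψ) :
    ∫⁻ ξ, ENNReal.ofReal (ψ ξ) *
        ∫⁻ q, ‖W q.1 ξ q.2 - A ((memLp_const c).toLp _) ξ‖ₑ ∂(T.prod ν) ∂μ ≤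
      ∫⁻ ξ, ENNReal.ofReal (A ψ ξ) * ∫⁻ q, ‖R q.1 ξ q.2 - c‖ₑ ∂(T.prod ν) ∂μ := by
  have hW' : AEStronglyMeasurable (fun z : (X × Y) × Ω => W z.1.1 z.2 z.1.2)
      ((T.prod ν).prod μ) := hW.comp_measurePreserving measurePreserving_prod_rearrange
  have hR' : AEStronglyMeasurable (fun z : (X × Y) × Ω => R z.1.1 z.2 z.1.2)
      ((T.prod ν).prod μ) := hR.comp_measurePreserving measurePreserving_prod_rearrange
  have key : ∀ (φ : Lp ℝ 2 μ) (V : X → Ω → Y → ℝ≥0∞),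
      AEMeasurable (fun z : (X × Y) × Ω => V z.1.1 z.2 z.1.2) ((T.prod ν).prod μ) →
      ∫⁻ ξ, ENNReal.ofReal (φ ξ) * ∫⁻ q, V q.1 ξ q.2 ∂(T.prod ν) ∂μ
        = ∫⁻ q, ∫⁻ ξ, ENNReal.ofReal (φ ξ) * V q.1 ξ q.2 ∂μ ∂(T.prod ν) := by
    intro φ V hV
    have hφ : AEMeasurable (fun z : (X × Y) × Ω => ENNReal.ofReal (φ z.2)) ((T.prod ν).prod μ) :=
      (Lp.aestronglyMeasurable φ).aemeasurable.ennreal_ofReal.comp_snd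
    rw [lintegral_lintegral_swap (hφ.mul hV)]
    refine lintegral_congr fun ξ => ?_
    rw [lintegral_const_mul' _ _ ENNReal.ofReal_ne_top]
  rw [key ψ (fun x ξ y => ‖W x ξ y - A ((memLp_const c).toLp _) ξ‖ₑ)
    (hW'.sub (Lp.aestronglyMeasurable _).comp_snd).enorm,
    key (A ψ) (fun x ξ y => ‖R x ξ y - c‖ₑ) (hR'.sub aestronglyMeasurable_const).enorm]
  refine lintegral_mono_ae ?_
  filter_upwards [hRW] with q hq
  exact hA.lintegral_image_le hq c hψ

theorem lintegral_sq_le [IsProbabilityMeasure ν] {f : Y → ℝ≥0∞} (hf : AEMeasurable f ν) :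
    (∫⁻ y, f y ∂ν) ^ 2 ≤ ∫⁻ y, f y ^ 2 ∂ν := by
  have h := ENNReal.lintegral_mul_le_Lp_mul_Lq ν (p := 2) (q := 2)
    (by rw [Real.holderConjugate_iff]; norm_num) hf (aemeasurable_const (b := (1 : ℝ≥0∞)))
  simp only [Pi.mul_apply, mul_one, ENNReal.one_rpow, lintegral_one, measure_univ] at h
  calc (∫⁻ y, f y ∂ν) ^ 2 ≤ ((∫⁻ y, f y ^ (2 : ℝ) ∂ν) ^ (1 / 2 : ℝ)) ^ 2 := by gcongr
    _ = ∫⁻ y, f y ^ 2 ∂ν := by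
      rw [← ENNReal.rpow_natCast, ← ENNReal.rpow_mul]
      norm_num

/-- The interaction is controlled by the numerical radius. -/
theorem IsGraphop.lintegral_interaction_le [SFinite T] [IsProbabilityMeasure ν]
    [IsProbabilityMeasure μ] {A : Lp ℝ 2 μ →L[ℝ] Lp ℝ 2 μ} (hA : IsGraphop A) {R W : X → Ω → Y → ℝ}
    (hR : Measurable fun z : X × Ω × Y => R z.1 z.2.1 z.2.2)
    (hW : AEStronglyMeasurable (fun z : X × Ω × Y => W z.1 z.2.1 z.2.2) (T.prod (μ.prod ν)))
    (hRW : ∀ᵐ q ∂(T.prod ν), IsImage A (fun ξ => R q.1 ξ q.2) (fun ξ => W q.1 ξ q.2))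
    (c : ℝ) (hR2 : ∀ᵐ p ∂(μ.prod ν), ∫⁻ x, ‖R x p.1 p.2 - c‖ₑ ∂T ≤ 2) {e : ℝ} (he : 0 ≤ e) :
    ∫⁻ p, (∫⁻ x, ‖R x p.1 p.2 - c‖ₑ ∂T + ENNReal.ofReal e) *
        ∫⁻ q, ‖W q.1 p.1 q.2 - A ((memLp_const c).toLp _) p.1‖ₑ ∂(T.prod ν) ∂(μ.prod ν) ≤
      ENNReal.ofReal (numericalRadius A) * ∫⁻ p, (∫⁻ x, ‖R x p.1 p.2 - c‖ₑ ∂T) ^ 2 ∂(μ.prod ν)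
        + ENNReal.ofReal (2 * ‖A‖ * e) := by
  set Q : Ω × Y → ℝ≥0∞ := fun p => ∫⁻ x, ‖R x p.1 p.2 - c‖ₑ ∂T with hQ
  set s : Ω → ℝ≥0∞ := fun ξ =>
    ∫⁻ q, ‖W q.1 ξ q.2 - A ((memLp_const c).toLp _) ξ‖ₑ ∂(T.prod ν) with hs
  set r : Ω → ℝ≥0∞ := fun ξ => ∫⁻ y, Q (ξ, y) ∂ν with hr
  have hRc : Measurable (fun z : X × Ω × Y => ‖R z.1 z.2.1 z.2.2 - c‖ₑ) :=
    (hR.sub measurable_const).enorm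
  have hQm : Measurable Q := hRc.lintegral_prod_left'
  have hrm : Measurable r := hQm.lintegral_prod_right'
  have hsm : AEMeasurable s μ := by
    have hW' : AEStronglyMeasurable (fun z : (X × Y) × Ω => W z.1.1 z.2 z.1.2)
      ((T.prod ν).prod μ) := hW.comp_measurePreserving measurePreserving_prod_rearrange
    exact (hW'.sub (Lp.aestronglyMeasurable (A ((memLp_const c).toLp _))).comp_snd).enorm.lintegral_prod_left'
  have hrQ : ∀ ξ, r ξ = ∫⁻ q, ‖R q.1 ξ q.2 - c‖ₑ ∂(T.prod ν) := fun ξ =>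
    (lintegral_prod_symm' _ (hRc.comp (by fun_prop : Measurable fun q : X × Y =>
      (q.1, (ξ, q.2))))).symm
  have hr2 : ∀ᵐ ξ ∂μ, r ξ ≤ 2 := by
    filter_upwards [Measure.ae_ae_of_ae_prod hR2] with ξ hξ
    calc r ξ ≤ ∫⁻ _, 2 ∂ν := lintegral_mono_ae hξ
      _ = 2 := by simp
  have hrr : ∀ᵐ ξ ∂μ, ENNReal.ofReal (r ξ).toReal = r ξ := by
    filter_upwards [hr2] with ξ hξ
    exact ENNReal.ofReal_toReal (hξ.trans_lt (by norm_num)).ne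
  -- The average `r` is bounded by `2` even though the density itself may not be square-integrable,
  -- so it is a legitimate weight in `L²`.
  have hmem : MemLp (fun ξ => (r ξ).toReal) 2 μ := by
    refine MemLp.of_bound hrm.ennreal_toReal.aestronglyMeasurable 2 ?_
    filter_upwards [hr2] with ξ hξ
    rw [Real.norm_of_nonneg ENNReal.toReal_nonneg]
    exact ENNReal.toReal_le_of_le_ofReal (by norm_num) (by simpa using hξ)
  set g : Lp ℝ 2 μ := hmem.toLp _ with hg
  set k : Lp ℝ 2 μ := (memLp_const e).toLp _ with hk
  have hgae : ∀ᵐ ξ ∂μ, g ξ = (r ξ).toReal := hmem.coeFn_toLp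
  have hkae : ∀ᵐ ξ ∂μ, k ξ = e := (memLp_const (p := 2) (μ := μ) e).coeFn_toLp
  have hg0 : 0 ≤ g := by
    rw [← Lp.coeFn_nonneg]
    filter_upwards [hgae] with ξ hξ
    rw [hξ]; exact ENNReal.toReal_nonneg
  have hk0 : 0 ≤ k := by
    rw [← Lp.coeFn_nonneg]
    filter_upwards [hkae] with ξ hξ
    rw [hξ]; exact he
  have hgn : ENNReal.ofReal (‖g‖ ^ 2) = ∫⁻ ξ, r ξ ^ 2 ∂μ := by
    rw [← real_inner_self_eq_norm_sq, ← lintegral_ofReal_mul_ofReal hg0 hg0]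
    refine lintegral_congr_ae ?_
    filter_upwards [hgae, hrr] with ξ h1 h2
    rw [h1, h2, sq]
  have hg2 : ‖g‖ ≤ 2 := by
    have h1 : ∫⁻ ξ, r ξ ^ 2 ∂μ ≤ 4 := by
      calc ∫⁻ ξ, r ξ ^ 2 ∂μ ≤ ∫⁻ _, 4 ∂μ := by
            refine lintegral_mono_ae ?_
            filter_upwards [hr2] with ξ hξ
            calc r ξ ^ 2 ≤ 2 ^ 2 := by gcongr
              _ = 4 := by norm_num
        _ = 4 := by simp
    rw [← hgn] at h1
    have h2 : ‖g‖ ^ 2 ≤ 4 := by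
      have := (ENNReal.ofReal_le_ofReal_iff (q := 4) (by norm_num)).1 (h1.trans_eq (by simp))
      exact this
    nlinarith [norm_nonneg g]
  have hkn : ‖k‖ ≤ e := by
    have := Lp.norm_const (p := 2) (μ := μ) (c := e) (by simp)
    have h2 : k = Lp.const 2 μ e := rfl
    rw [h2, this]
    simp [abs_of_nonneg he]
  -- As `s` does not see the frequency, integrating it out replaces `Q` by `r`. Duality with weight
  -- `r + e` gives `(A (r + e), r)`: the numerical radius controls the main term, the operator norm
  -- the error, and Jensen returns from `r` to `Q`.
  calc ∫⁻ p, (Q p + ENNReal.ofReal e) * s p.1 ∂(μ.prod ν)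
      = ∫⁻ ξ, (r ξ + ENNReal.ofReal e) * s ξ ∂μ := by
        have hm : AEMeasurable (fun p : Ω × Y => (Q p + ENNReal.ofReal e) * s p.1) (μ.prod ν) :=
          (hQm.add measurable_const).aemeasurable.mul hsm.comp_fst
        rw [lintegral_prod _ hm]
        refine lintegral_congr fun ξ => ?_
        have hξ : Measurable fun y => Q (ξ, y) := hQm.comp measurable_prodMk_left
        have hξ' : Measurable fun y => Q (ξ, y) + ENNReal.ofReal e := hξ.add measurable_const
        change ∫⁻ y, (Q (ξ, y) + ENNReal.ofReal e) * s ξ ∂ν = _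
        rw [lintegral_mul_const _ hξ', lintegral_add_right _ measurable_const]
        simp [hr]
    _ = ∫⁻ ξ, ENNReal.ofReal ((g + k : Lp ℝ 2 μ) ξ) * s ξ ∂μ := by
        refine lintegral_congr_ae ?_
        filter_upwards [Lp.coeFn_add g k, hgae, hkae, hrr] with ξ h1 h2 h3 h4
        rw [h1, Pi.add_apply, h2, h3, ENNReal.ofReal_add ENNReal.toReal_nonneg he, h4]
    _ ≤ ∫⁻ ξ, ENNReal.ofReal (A (g + k) ξ) * ∫⁻ q, ‖R q.1 ξ q.2 - c‖ₑ ∂(T.prod ν) ∂μ :=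
        hA.lintegral_lintegral_image_le hR.aestronglyMeasurable hW hRW c (add_nonneg hg0 hk0)
    _ = ∫⁻ ξ, ENNReal.ofReal (A (g + k) ξ) * ENNReal.ofReal (g ξ) ∂μ := by
        refine lintegral_congr_ae ?_
        filter_upwards [hgae, hrr] with ξ h2 h3
        rw [← hrQ, h2, h3]
    _ = ENNReal.ofReal (inner ℝ (A (g + k)) g) :=
        lintegral_ofReal_mul_ofReal (hA.positive _ (add_nonneg hg0 hk0)) hg0
    _ ≤ ENNReal.ofReal (numericalRadius A * ‖g‖ ^ 2 + 2 * ‖A‖ * e) := by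
        refine ENNReal.ofReal_le_ofReal ?_
        rw [map_add, inner_add_left]
        refine add_le_add (inner_apply_le_numericalRadius A g) ?_
        calc (inner ℝ (A k) g : ℝ) ≤ ‖A k‖ * ‖g‖ := real_inner_le_norm _ _
          _ ≤ (‖A‖ * e) * 2 := by
              gcongr
              exact (A.le_opNorm k).trans (by gcongr)
          _ = _ := by ring
    _ = ENNReal.ofReal (numericalRadius A) * ∫⁻ ξ, r ξ ^ 2 ∂μ + ENNReal.ofReal (2 * ‖A‖ * e) := by
        have h0 := hA.numericalRadius_nonneg
        rw [ENNReal.ofReal_add (by positivity) (by positivity), ENNReal.ofReal_mul h0, hgn]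
    _ ≤ _ := by
        gcongr
        rw [lintegral_prod _ (hQm.pow_const 2).aemeasurable]
        exact lintegral_mono fun ξ =>
          lintegral_sq_le (hQm.comp measurable_prodMk_left).aemeasurable

end Slice

/-! ### The Vlasov term -/

/-- Both integrands are periodic, so the shift by `y` can be moved from the potential to the test
function. -/
theorem integral_convolution_deriv {L : ℝ} (hL : 0 < L) {d₁ d₂ : ℝ → ℝ}
    (p1 : Function.Periodic d₁ L) (p2 : Function.Periodic d₂ L)
    (hd : ∀ η η' : ℝ → ℝ, (∀ x, HasDerivAt η (η' x) x) → Continuous η' → Function.Periodic η L →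
        ∫ x, d₁ x * η' x ∂(torus L) = -∫ x, d₂ x * η x ∂(torus L))
    {η η' : ℝ → ℝ} (hη : ∀ x, HasDerivAt η (η' x) x) (hη' : Continuous η')
    (hηp : Function.Periodic η L) (y : ℝ) :
    ∫ x, d₁ (x - y) * η' x ∂(torus L) = -∫ x, d₂ (x - y) * η x ∂(torus L) := by
  have hη'p : Function.Periodic η' L := by
    intro x
    have h1 := (hη (x + L)).comp_add_const x L
    have h2 : (fun x => η (x + L)) = η := funext hηp
    rw [h2] at h1
    exact h1.unique (hη x)
  have h := hd (fun x => η (x + y)) (fun x => η' (x + y)) (fun x => (hη (x + y)).comp_add_const x y)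
    (hη'.comp (continuous_add_const y)) (fun x => by
      change η (x + L + y) = η (x + y)
      rw [show x + L + y = (x + y) + L by ring, hηp])
  have e : ∀ d k : ℝ → ℝ, Function.Periodic d L → Function.Periodic k L →
      ∫ x, d (x - y) * k x ∂(torus L) = ∫ x, d x * k (x + y) ∂(torus L) := by
    intro d k hd hk
    have := integral_torus_comp_sub hL (f := fun x => d (x - y) * k x) (fun x => by
      change d (x + L - y) * k (x + L) = d (x - y) * k x
      rw [show x + L - y = (x - y) + L by ring, hd, hk]) (-y)
    rw [← this]
    congr 1; funext x; simp
  rw [e _ _ p1 hη'p, e _ _ p2 hηp, h]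

/-- The Vlasov term is a bounded periodic function of the position, and its pairing with derivatives
is controlled by the distance of the network image from any constant. -/
theorem exists_vlasov_bound {L : ℝ} (hL : 0 < L) {D g : ℝ → ℝ} (hD : MemSobolev L 2 ⊤ D)
    [IsProbabilityMeasure (freqMeasure g)] {Ω : Type*} {W : ℝ → ℝ → Ω → ℝ → ℝ} {t : ℝ} {ξ : Ω}
    (hW : Integrable (fun q : ℝ × ℝ => W t q.1 ξ q.2) ((torus L).prod (freqMeasure g))) :
    Measurable (fun x => vlasov L D g W t x ξ) ∧ (∃ C, ∀ x, |vlasov L D g W t x ξ| ≤ C) ∧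
      Function.Periodic (fun x => vlasov L D g W t x ξ) L ∧
      ∀ (c : ℝ) (η η' : ℝ → ℝ), (∀ x, HasDerivAt η (η' x) x) → Continuous η' →
        Function.Periodic η L →
        |∫ x, η' x * vlasov L D g W t x ξ ∂(torus L)| ≤ supNorm L (weakDeriv L 2 D) *
          (∫ q, |W t q.1 ξ q.2 - c| ∂((torus L).prod (freqMeasure g))) *
            ∫ x, |η x| ∂(torus L) := by
  obtain ⟨d₁, d₂, m1, m2, p1, p2, b1, b2, e1, hibp⟩ := hD.exists_rep hL
  set C1 := supNorm L (weakDeriv L 1 D)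
  set C2 := supNorm L (weakDeriv L 2 D)
  have hC1 : 0 ≤ C1 := ENNReal.toReal_nonneg
  have hC2 : 0 ≤ C2 := ENNReal.toReal_nonneg
  set Q := (torus L).prod (freqMeasure g) with hQ
  set w : ℝ × ℝ → ℝ := fun q => W t q.1 ξ q.2 with hw
  obtain ⟨w', hw'm, hww'⟩ := hW.1
  -- Replacing the weak derivative by a representative changes nothing at any `x`: it is integrated
  -- against an absolutely continuous variable.
  have hV : ∀ x, vlasov L D g W t x ξ = ∫ q, d₁ (x - q.1) * w q ∂Q := by
    intro x
    have hi : Integrable (fun q : ℝ × ℝ => d₁ (x - q.1) * w q) Q :=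
      hW.bdd_mul (c := C1) (m1.comp (by fun_prop)).aestronglyMeasurable (ae_of_all _ fun q => b1 _)
    rw [integral_prod_symm _ hi, vlasov]
    refine integral_congr_ae (ae_of_all _ fun ω => integral_congr_ae ?_)
    have hx : ∀ᵐ y ∂volume, weakDeriv L 1 D (x - y) = d₁ (x - y) :=
      (quasiMeasurePreserving_sub_left volume x).ae e1
    filter_upwards [ae_restrict_of_ae hx] with y hy
    simp only [hy, hw]
  simp only [hV]
  refine ⟨?_, ⟨C1 * ∫ q, |w q| ∂Q, fun x => ?_⟩, fun x => ?_, ?_⟩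
  · have h1 : StronglyMeasurable fun x => ∫ q, d₁ (x - q.1) * w' q ∂Q := by
      refine StronglyMeasurable.integral_prod_right' (f := fun z : ℝ × ℝ × ℝ =>
        d₁ (z.1 - z.2.1) * w' z.2) ?_
      exact ((m1.comp (by fun_prop)).stronglyMeasurable).mul (hw'm.comp_measurable measurable_snd)
    convert h1.measurable using 2 with x
    refine integral_congr_ae ?_
    filter_upwards [hww'] with q hq
    rw [hq]
  · rw [← integral_const_mul]
    refine abs_integral_le_integral_abs.trans (integral_mono_of_nonneg
      (ae_of_all _ fun q => abs_nonneg _) (hW.abs.const_mul _) (ae_of_all _ fun q => ?_))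
    simp only [abs_mul]
    exact mul_le_mul_of_nonneg_right (b1 _) (abs_nonneg _)
  · refine integral_congr_ae (ae_of_all _ fun q => ?_)
    simp only
    rw [show x + L - q.1 = (x - q.1) + L by ring, p1]
  · intro c η η' hη hη' hηp
    have hηc : Continuous η := continuous_iff_continuousAt.2 fun x => (hη x).continuousAt
    set I := ∫ x, |η x| ∂(torus L) with hI
    have hI0 : 0 ≤ I := integral_nonneg fun x => abs_nonneg _
    set J : ℝ → ℝ := fun y => ∫ x, d₂ (x - y) * η x ∂(torus L) with hJ
    have hJb : ∀ y, |J y| ≤ C2 * I := by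
      intro y
      rw [hI, ← integral_const_mul]
      refine abs_integral_le_integral_abs.trans (integral_mono_of_nonneg
        (ae_of_all _ fun q => abs_nonneg _) ((hηc.integrable_torus L).abs.const_mul _)
        (ae_of_all _ fun q => ?_))
      simp only [abs_mul]
      exact mul_le_mul_of_nonneg_right (b2 _) (abs_nonneg _)
    have hJm : Measurable J := by
      refine (StronglyMeasurable.integral_prod_right' (f := fun z : ℝ × ℝ =>
        d₂ (z.2 - z.1) * η z.2) ?_).measurable
      exact ((m2.comp (by fun_prop)).mul (hηc.measurable.comp measurable_snd)).stronglyMeasurable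
    have hd2 : ∫ y, d₂ y ∂(torus L) = 0 := by
      have := hibp (fun _ => 1) (fun _ => 0) (fun x => hasDerivAt_const x 1) continuous_const
        (fun x => rfl)
      simpa using this.symm
    -- The second derivative of the potential has mean zero, hence so does `J`. This allows any
    -- constant to be subtracted from the network image.
    have hJ0 : ∫ y, J y ∂(torus L) = 0 := by
      have hi : Integrable (fun z : ℝ × ℝ => d₂ (z.2 - z.1) * η z.2)
          ((torus L).prod (torus L)) := by
        have h1 : Integrable (fun z : ℝ × ℝ => (1 : ℝ) * η z.2) ((torus L).prod (torus L)) :=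
          (integrable_const (1 : ℝ)).mul_prod (hηc.integrable_torus L)
        simp only [one_mul] at h1
        exact h1.bdd_mul (c := C2) (m2.comp (by fun_prop)).aestronglyMeasurable
          (ae_of_all _ fun q => b2 _)
      simp only [hJ]
      rw [integral_integral_swap hi]
      simp only [integral_mul_const]
      simp only [integral_torus_comp_sub_left hL p2, hd2, zero_mul, integral_zero]
    have hswap : ∫ x, η' x * ∫ q, d₁ (x - q.1) * w q ∂Q ∂(torus L) = -∫ q, w q * J q.1 ∂Q := by
      have hi : Integrable (fun z : ℝ × ℝ × ℝ => d₁ (z.1 - z.2.1) * (η' z.1 * w z.2))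
          ((torus L).prod Q) :=
        ((hη'.integrable_torus L).mul_prod hW).bdd_mul (c := C1)
          (m1.comp (by fun_prop)).aestronglyMeasurable (ae_of_all _ fun q => b1 _)
      have e2 : ∀ x, η' x * ∫ q, d₁ (x - q.1) * w q ∂Q
          = ∫ q, d₁ (x - q.1) * (η' x * w q) ∂Q := by
        intro x
        rw [← integral_const_mul]
        congr 1; funext q; ring
      simp only [e2]
      rw [integral_integral_swap hi, ← integral_neg]
      congr 1; funext q
      have e3 : ∀ x, d₁ (x - q.1) * (η' x * w q) = w q * (d₁ (x - q.1) * η' x) := fun x => by ring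
      simp only [e3, integral_const_mul]
      rw [integral_convolution_deriv hL p1 p2 hibp hη hη' hηp]
      simp only [hJ]; ring
    have hJi : Integrable (fun q : ℝ × ℝ => w q * J q.1) Q :=
      hW.mul_bdd (c := C2 * I) (hJm.comp measurable_fst).aestronglyMeasurable
        (ae_of_all _ fun q => hJb _)
    have hJc : Integrable (fun q : ℝ × ℝ => c * J q.1) Q :=
      (integrable_const c).mul_bdd (c := C2 * I) (hJm.comp measurable_fst).aestronglyMeasurable
        (ae_of_all _ fun q => hJb _)
    have hJc0 : ∫ q, c * J q.1 ∂Q = 0 := by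
      rw [integral_const_mul, integral_fun_fst, hJ0]; simp
    have hfin : ∫ q, w q * J q.1 ∂Q = ∫ q, (w q - c) * J q.1 ∂Q := by
      simp only [sub_mul]
      rw [integral_sub hJi hJc, hJc0, sub_zero]
    rw [hswap, abs_neg, hfin, mul_assoc, mul_comm (∫ q, |w q - c| ∂Q), ← mul_assoc,
      ← integral_const_mul]
    refine abs_integral_le_integral_abs.trans (integral_mono_of_nonneg
      (ae_of_all _ fun q => abs_nonneg _)
      (((hW.sub (integrable_const c)).abs).const_mul _) (ae_of_all _ fun q => ?_))
    simp only [abs_mul]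
    rw [mul_comm]
    exact mul_le_mul_of_nonneg_right (hJb _) (abs_nonneg _)

/-! ### Entropy inequality in integrated form -/

/-- A probability density evolving by an advection-diffusion equation whose drift is controlled by
`K` when paired with derivatives. -/
structure IsDensitySolution (L β : ℝ) (u : ℝ → ℝ → ℝ) (K : ℝ → ℝ) : Prop where
  exists_drift : ∃ B, IsAdvectionDiffusion L β u B ∧ ∀ t, 0 < t → ∀ η η' : ℝ → ℝ,
    (∀ x, HasDerivAt η (η' x) x) → Continuous η' → Function.Periodic η L →
      -∫ x, η' x * B t x ∂(torus L) ≤ K t * ∫ x, |η x| ∂(torus L)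
  nonneg : ∀ t, 0 ≤ t → ∀ x, 0 ≤ u t x
  integral_eq_one : ∀ t, 0 ≤ t → ∫ x, u t x ∂(torus L) = 1
  bound_nonneg : ∀ t, 0 < t → 0 ≤ K t

/-- The drift is `-ω + κ V`. The value `c` may depend on `ξ` because only constancy in `(x, ω)` is
used; it is later the image of the equilibrium under `A`. -/
theorem ae_isDensitySolution {Ω : Type*} [MeasurableSpace Ω] {μ : Measure Ω}
    [IsProbabilityMeasure μ] {L κ β : ℝ} (hL : 0 < L) (hκ : 0 < κ) (hβ : 0 < β)
    {D : ℝ → ℝ} (hD : MemSobolev L 2 ⊤ D) {g : ℝ → ℝ} [IsProbabilityMeasure (freqMeasure g)]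
    {A : Lp ℝ 2 μ →L[ℝ] Lp ℝ 2 μ} {ρ₀ : ℝ → Ω → ℝ → ℝ} (hρ₀ : IsAdmissible L μ g ρ₀)
    {ρ W : ℝ → ℝ → Ω → ℝ → ℝ} (hρ : IsClassicalSolution L κ β D g A ρ₀ ρ)
    (hW : IsNetworkImage L g A ρ W)
    (heq : ∀ᵐ p ∂(μ.prod (freqMeasure g)), ∀ t, 0 < t → ∀ x,
      HasDerivAt
        (fun y => -p.2 * ρ t y p.1 p.2 + κ * ρ t y p.1 p.2 * vlasov L D g W t y p.1)
        (deriv (fun s => ρ s x p.1 p.2) t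
          - β⁻¹ * iteratedDeriv 2 (fun y => ρ t y p.1 p.2) x) x) (c : Ω → ℝ) :
    ∀ᵐ p ∂(μ.prod (freqMeasure g)), IsDensitySolution L β (fun t x => ρ t x p.1 p.2)
      (fun t => κ * supNorm L (weakDeriv L 2 D) *
        ∫ q, |W t q.1 p.1 q.2 - c p.1| ∂((torus L).prod (freqMeasure g))) := by
  have hWi : ∀ᵐ p ∂(μ.prod (freqMeasure g)), ∀ t, 0 < t →
      Integrable (fun q : ℝ × ℝ => W t q.1 p.1 q.2) ((torus L).prod (freqMeasure g)) :=
    Measure.quasiMeasurePreserving_fst.ae hW.integrable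
  have hC2 : 0 ≤ supNorm L (weakDeriv L 2 D) := ENNReal.toReal_nonneg
  filter_upwards [hWi, heq, hρ.regular, hρ.initial, hρ₀.density] with p h1 h2 h3 h4 h5
  have hAD : IsAdvectionDiffusion L β (fun t x => ρ t x p.1 p.2)
      (fun t x => -p.2 + κ * vlasov L D g W t x p.1) := by
    refine ⟨h3, fun t ht => ?_, fun t ht => ?_, fun t ht => ?_, fun t ht x => ?_⟩
    · exact ((exists_vlasov_bound hL hD (h1 t ht)).1.const_mul κ).const_add _
    · obtain ⟨C, hC⟩ := (exists_vlasov_bound hL hD (h1 t ht)).2.1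
      refine ⟨|p.2| + κ * C, fun x => (abs_add_le _ _).trans ?_⟩
      rw [abs_neg, abs_mul, abs_of_pos hκ]
      have := hC x
      gcongr
    · intro x
      have := (exists_vlasov_bound hL hD (h1 t ht)).2.2.1 x
      simp only at this
      simp only [this]
    · convert h2 t ht x using 1
      funext y; ring
  have h0 : ∀ᵐ x ∂(torus L), 0 ≤ ρ 0 x p.1 p.2 := by
    filter_upwards [h4, h5.nonneg] with x hx1 hx2
    rwa [hx1]
  refine ⟨⟨_, hAD, fun t ht η η' hη hη' hηp => ?_⟩, fun t ht x => hAD.nonneg hL hβ h0 ht x,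
    fun t ht => ?_, fun t ht => ?_⟩
  · obtain ⟨hVm, ⟨C, hC⟩, -, hV⟩ := exists_vlasov_bound hL hD (h1 t ht)
    -- The derivative of a periodic function has mean zero, so the frequency drops out; this is why
    -- `g` may be arbitrary.
    have hη0 : ∫ x, η' x ∂(torus L) = 0 := by
      rw [integral_torus_eq hL, intervalIntegral.integral_eq_sub_of_hasDerivAt (fun x _ => hη x)
        (hη'.intervalIntegrable _ _)]
      have := hηp (-(L / 2))
      rw [show -(L / 2) + L = L / 2 by ring] at this
      rw [this, sub_self]
    have hi : Integrable (fun x => η' x * vlasov L D g W t x p.1) (torus L) :=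
      (hη'.integrable_torus L).mul_bdd (c := C) hVm.aestronglyMeasurable (ae_of_all _ hC)
    have e : ∫ x, η' x * (-p.2 + κ * vlasov L D g W t x p.1) ∂(torus L)
        = κ * ∫ x, η' x * vlasov L D g W t x p.1 ∂(torus L) := by
      have e1 : ∀ x, η' x * (-p.2 + κ * vlasov L D g W t x p.1)
          = -p.2 * η' x + κ * (η' x * vlasov L D g W t x p.1) := fun x => by ring
      simp only [e1]
      rw [integral_add ((hη'.integrable_torus L).const_mul _) (hi.const_mul _),
        integral_const_mul, integral_const_mul, hη0, mul_zero, zero_add]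
    rw [e]
    have h6 := hV (c p.1) η η' hη hη' hηp
    have h7 := mul_le_mul_of_nonneg_left ((neg_le_abs _).trans h6) hκ.le
    calc _ = κ * -∫ x, η' x * vlasov L D g W t x p.1 ∂(torus L) := by ring
      _ ≤ _ := h7
      _ = _ := by ring
  · rw [hAD.integral_eq hL ht]
    rw [← h5.integral_eq_one]
    exact integral_congr_ae h4
  · have : 0 ≤ ∫ q, |W t q.1 p.1 q.2 - c p.1| ∂((torus L).prod (freqMeasure g)) :=
      integral_nonneg fun q => abs_nonneg _
    positivity

/-- A form of the fundamental theorem of calculus in which the derivative need not be integrable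
from below. -/
theorem ofReal_le_add_lintegral {y y' : ℝ → ℝ} {Z : ℝ → ℝ≥0∞} {t : ℝ} (ht : 0 ≤ t)
    (hc : ContinuousOn y (Icc 0 t)) (hd : ∀ τ ∈ Ioo 0 t, HasDerivAt y (y' τ) τ)
    (hZ : Measurable Z) (hZy : ∀ τ ∈ Ioo 0 t, Z τ = ENNReal.ofReal (y' τ)) :
    ENNReal.ofReal (y t) ≤ ENNReal.ofReal (y 0) + ∫⁻ τ in Ioc 0 t, Z τ := by
  by_cases hfin : ∫⁻ τ in Ioc 0 t, Z τ = ⊤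
  · rw [hfin]; simp
  have hint : IntegrableOn (fun τ => (Z τ).toReal) (Icc 0 t) := by
    rw [integrableOn_Icc_iff_integrableOn_Ioc]
    exact integrable_toReal_of_lintegral_ne_top hZ.aemeasurable hfin
  -- The inequality version needs only an integrable majorant of the derivative, and its positive
  -- part is one.
  have h1 := intervalIntegral.sub_le_integral_of_hasDeriv_right_of_le ht hc
    (fun τ hτ => (hd τ hτ).hasDerivWithinAt) hint (fun τ hτ => by
      rw [hZy τ hτ]
      exact (le_max_left _ 0).trans_eq (ENNReal.toReal_ofReal' (r := y' τ)).symm)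
  have hlt : ∀ᵐ τ ∂(volume.restrict (Ioc 0 t)), Z τ < ⊤ := ae_lt_top hZ hfin
  rw [intervalIntegral.integral_of_le ht, integral_toReal hZ.aemeasurable hlt] at h1
  rw [← ENNReal.ofReal_toReal hfin]
  refine (ENNReal.ofReal_le_ofReal (by linarith : y t ≤ y 0 + _)).trans ENNReal.ofReal_add_le

/-- The relative entropy of the density at given network variable and frequency. -/
noncomputable def fiberEntropy {Ω : Type*} (L : ℝ) (R : ℝ → Ω → ℝ → ℝ) (p : Ω × ℝ) : ℝ :=
  ∫ x, R x p.1 p.2 * Real.log (R x p.1 p.2 * L) ∂(torus L)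

/-- The `L¹` distance to the uniform distribution at given network variable and frequency. -/
noncomputable def fiberDist {Ω : Type*} (L : ℝ) (R : ℝ → Ω → ℝ → ℝ) (p : Ω × ℝ) : ℝ≥0∞ :=
  ∫⁻ x, ‖R x p.1 p.2 - L⁻¹‖ₑ ∂(torus L)

namespace IsDensitySolution

variable {L β : ℝ} {u : ℝ → ℝ → ℝ} {K : ℝ → ℝ}

theorem continuous_space (h : IsDensitySolution L β u K) {t : ℝ} (ht : 0 ≤ t) :
    Continuous (u t) := by
  obtain ⟨B, hB, -⟩ := h.exists_drift
  exact hB.classical.continuous_space ht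

theorem sq_integral_abs_le (h : IsDensitySolution L β u K) (hL : 0 < L) {t : ℝ} (ht : 0 ≤ t) :
    (∫ x, |u t x - L⁻¹| ∂(torus L)) ^ 2 ≤ 2 * ∫ x, u t x * Real.log (u t x * L) ∂(torus L) := by
  have := sq_integral_abs_sub_le (a := -(L / 2)) (b := L / 2) (by linarith)
    (h.continuous_space ht) (h.nonneg t ht) (by rw [← integral_torus_eq hL, h.integral_eq_one t ht])
  rwa [show L / 2 - -(L / 2) = L by ring, ← integral_torus_eq hL, ← integral_torus_eq hL] at this

theorem integral_mul_log_nonneg (h : IsDensitySolution L β u K) (hL : 0 < L) {t : ℝ}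
    (ht : 0 ≤ t) : 0 ≤ ∫ x, u t x * Real.log (u t x * L) ∂(torus L) := by
  nlinarith [h.sq_integral_abs_le hL ht, sq_nonneg (∫ x, |u t x - L⁻¹| ∂(torus L))]

theorem lintegral_enorm_sub (h : IsDensitySolution L β u K) {t : ℝ} (ht : 0 ≤ t) :
    ∫⁻ x, ‖u t x - L⁻¹‖ₑ ∂(torus L) = ENNReal.ofReal (∫ x, |u t x - L⁻¹| ∂(torus L)) := by
  rw [← ofReal_integral_norm_eq_lintegral_enorm]
  · simp only [Real.norm_eq_abs]
  · exact ((h.continuous_space ht).sub continuous_const).integrable_torus L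

theorem integral_abs_sub_le_two (h : IsDensitySolution L β u K) (hL : 0 < L) {t : ℝ}
    (ht : 0 ≤ t) : ∫ x, |u t x - L⁻¹| ∂(torus L) ≤ 2 := by
  have hc := h.continuous_space ht
  calc ∫ x, |u t x - L⁻¹| ∂(torus L) ≤ ∫ x, (u t x + L⁻¹) ∂(torus L) := by
        refine integral_mono (Continuous.integrable_torus (by fun_prop) L)
          (Continuous.integrable_torus (by fun_prop) L) fun x => ?_
        refine (abs_sub _ _).trans ?_
        rw [abs_of_nonneg (h.nonneg t ht x), abs_of_pos (inv_pos.2 hL)]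
    _ = 2 := by
        rw [integral_add (hc.integrable_torus L) (integrable_const _), h.integral_eq_one t ht,
          integral_torus_const hL, mul_inv_cancel₀ hL.ne']
        norm_num

/-- The entropy dissipation inequality for the regularized entropy, integrated in time. -/
theorem ofReal_exp_mul_regEntropy_le (h : IsDensitySolution L β u K) (hL : 0 < L) (hβ : 0 < β)
    {ε t : ℝ} (hε : 0 < ε) (ht : 0 ≤ t) {Z : ℝ → ℝ≥0∞} (hZ : Measurable Z)
    (hZu : ∀ τ, 0 < τ → Z τ = liminf (fun n : ℕ => ENNReal.ofReal
      (Real.exp (4 * Real.pi ^ 2 / (L ^ 2 * β) * τ) *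
        (((n : ℝ) + 1) * (regEntropy L ε (u (τ + 1 / ((n : ℝ) + 1))) - regEntropy L ε (u τ))
          + 4 * Real.pi ^ 2 / (L ^ 2 * β) * regEntropy L ε (u τ)))) atTop) :
    ENNReal.ofReal (Real.exp (4 * Real.pi ^ 2 / (L ^ 2 * β) * t) * regEntropy L ε (u t)) ≤
        ENNReal.ofReal (regEntropy L ε (u 0)) + ∫⁻ τ in Ioc 0 t, Z τ ∧
      ∀ τ, 0 < τ → Z τ ≤ ENNReal.ofReal (Real.exp (4 * Real.pi ^ 2 / (L ^ 2 * β) * τ)) *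
        (ENNReal.ofReal (4 * Real.pi ^ 2 / (L ^ 2 * β) * ((1 + ε * L) * Real.log (1 + ε * L))) +
          ENNReal.ofReal (K τ) * (∫⁻ x, ‖u τ x - L⁻¹‖ₑ ∂(torus L)
            + ENNReal.ofReal (Real.sqrt ε * ((L + 1) / 2)))) := by
  obtain ⟨B, hB, hK⟩ := h.exists_drift
  set l := 4 * Real.pi ^ 2 / (L ^ 2 * β) with hl
  have hd : ∀ τ, ∃ d, 0 < τ → HasDerivAt (fun s => regEntropy L ε (u s)) d τ ∧
      d + l * (regEntropy L ε (u τ) - (1 + ε * L) * Real.log (1 + ε * L)) ≤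
      K τ * (∫ x, |u τ x - L⁻¹| ∂(torus L) + Real.sqrt ε * ((L + 1) / 2)) := by
    intro τ
    by_cases hτ : 0 < τ
    · obtain ⟨d, hd⟩ := hB.exists_hasDerivAt_regEntropy hL hβ h.nonneg h.integral_eq_one hε hτ
        (h.bound_nonneg τ hτ) (hK τ hτ)
      exact ⟨d, fun _ => hd⟩
    · exact ⟨0, fun h => absurd h hτ⟩
  choose d hd using hd
  -- The liminf of difference quotients is the positive part of the derivative of `exp (l τ)` times
  -- the regularized entropy, in a form that is visibly measurable in all variables.
  have hZd : ∀ τ, 0 < τ → Z τ = ENNReal.ofReal (Real.exp (l * τ) *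
      (d τ + l * regEntropy L ε (u τ))) := by
    intro τ hτ
    rw [hZu τ hτ]
    refine Tendsto.liminf_eq ?_
    refine ENNReal.tendsto_ofReal (Tendsto.const_mul _ (Tendsto.add_const _ ?_))
    have h1 := (hd τ hτ).1.tendsto_slope_zero_right
    have h2 : Tendsto (fun n : ℕ => 1 / ((n : ℝ) + 1)) atTop (𝓝[>] 0) :=
      tendsto_nhdsWithin_iff.2 ⟨tendsto_one_div_add_atTop_nhds_zero_nat,
        Eventually.of_forall fun n => mem_Ioi.2 Nat.one_div_pos_of_nat⟩
    refine (h1.comp h2).congr fun n => ?_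
    simp
  refine ⟨?_, fun τ hτ => ?_⟩
  · have hc : ContinuousOn (fun s => regEntropy L ε (u s)) (Ici 0) :=
      hB.classical.continuousOn_integral_comp (S := univ) (fun _ _ _ => mem_univ _)
        (j := fun v => (v + ε) * Real.log ((v + ε) * L))
        ((continuous_mul_log_mul L).comp (continuous_add_const ε)).continuousOn
    have h1 := ofReal_le_add_lintegral (y := fun s => Real.exp (l * s) * regEntropy L ε (u s))
      (y' := fun s => Real.exp (l * s) * (d s + l * regEntropy L ε (u s))) ht
      ((Continuous.continuousOn (by fun_prop)).mul (hc.mono Icc_subset_Ici_self))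
      (fun τ hτ => by
        have e1 : HasDerivAt (fun s => Real.exp (l * s)) (Real.exp (l * τ) * l) τ := by
          simpa using ((hasDerivAt_id τ).const_mul l).exp
        refine (e1.mul (hd τ hτ.1).1).congr_deriv ?_
        ring) hZ (fun τ hτ => hZd τ hτ.1)
    simpa using h1
  · rw [hZd τ hτ, ENNReal.ofReal_mul (Real.exp_pos _).le]
    gcongr
    have hq0 : 0 ≤ ∫ x, |u τ x - L⁻¹| ∂(torus L) := integral_nonneg fun x => abs_nonneg _
    have hK0 := h.bound_nonneg τ hτ
    have hm : 0 ≤ l * ((1 + ε * L) * Real.log (1 + ε * L)) := by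
      have : 0 ≤ Real.log (1 + ε * L) := Real.log_nonneg (by nlinarith)
      positivity
    rw [h.lintegral_enorm_sub hτ.le, ← ENNReal.ofReal_add hq0 (by positivity),
      ← ENNReal.ofReal_mul hK0, ← ENNReal.ofReal_add hm (by positivity)]
    refine ENNReal.ofReal_le_ofReal ?_
    have := (hd τ hτ).2
    linarith

end IsDensitySolution

/-- **Grönwall's inequality** in integral form, for bounded measurable functions. -/
theorem le_mul_exp_of_le_add_lintegral {y : ℝ → ℝ≥0∞} (hy : Measurable y) {a b M T : ℝ}
    (ha : 0 ≤ a) (hM : 0 ≤ M) (hT : 0 ≤ T) (hb : ∀ t ∈ Icc 0 T, y t ≤ ENNReal.ofReal b)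
    (h : ∀ t ∈ Icc 0 T, y t ≤ ENNReal.ofReal a + ENNReal.ofReal M * ∫⁻ τ in Ioc 0 t, y τ) :
    y T ≤ ENNReal.ofReal (a * Real.exp (M * T)) := by
  -- Cutting off outside `[0, T]` gives a bounded real function, integrable on every interval.
  set f : ℝ → ℝ := (Icc 0 T).indicator fun t => (y t).toReal with hf
  have hfm : Measurable f := hy.ennreal_toReal.indicator measurableSet_Icc
  have hfb : ∀ t, ‖f t‖ ≤ max b 0 := by
    intro t
    by_cases ht : t ∈ Icc 0 T
    · rw [hf, indicator_of_mem ht, Real.norm_of_nonneg ENNReal.toReal_nonneg]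
      refine (ENNReal.toReal_mono ENNReal.ofReal_ne_top (hb t ht)).trans ?_
      rw [ENNReal.toReal_ofReal']
    · rw [hf, indicator_of_notMem ht]; simp
  have hfi : ∀ s t, IntervalIntegrable f volume s t := fun s t => by
    rw [intervalIntegrable_iff]
    exact IntegrableOn.of_bound (by simp) hfm.aestronglyMeasurable _ (ae_of_all _ hfb)
  set Y : ℝ → ℝ := fun t => ∫ τ in (0 : ℝ)..t, f τ with hY
  have hYc : Continuous Y := intervalIntegral.continuous_primitive hfi 0
  have hlt : ∀ t ∈ Icc 0 T, y t < ⊤ := fun t ht => (hb t ht).trans_lt ENNReal.ofReal_lt_top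
  have hfY : ∀ t ∈ Icc 0 T, f t ≤ a + M * Y t := by
    intro t ht
    have hsub : ∀ τ ∈ Ioc 0 t, τ ∈ Icc 0 T := fun τ hτ => ⟨hτ.1.le, hτ.2.trans ht.2⟩
    have e : ∫⁻ τ in Ioc 0 t, y τ = ENNReal.ofReal (Y t) := by
      rw [hY]
      simp only
      rw [intervalIntegral.integral_of_le ht.1, ofReal_integral_eq_lintegral_ofReal
        ((intervalIntegrable_iff_integrableOn_Ioc_of_le ht.1).1 (hfi 0 t))
        (ae_of_all _ fun τ => indicator_nonneg (fun _ _ => ENNReal.toReal_nonneg) _)]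
      refine setLIntegral_congr_fun measurableSet_Ioc fun τ hτ => ?_
      simp only [hf]
      rw [indicator_of_mem (hsub τ hτ), ENNReal.ofReal_toReal (hlt τ (hsub τ hτ)).ne]
    have hY0 : 0 ≤ Y t := intervalIntegral.integral_nonneg ht.1 fun τ _ =>
      indicator_nonneg (fun _ _ => ENNReal.toReal_nonneg) _
    have h1 := h t ht
    rw [e, ← ENNReal.ofReal_mul hM, ← ENNReal.ofReal_add ha (by positivity)] at h1
    rw [hf, indicator_of_mem ht]
    exact ENNReal.toReal_le_of_le_ofReal (by positivity) h1
  -- The primitive `Y` is only continuous, so its differentiable majorant `Φ` is used: `Y ≤ Φ` makes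
  -- `(a + M Φ) exp (-M t)` nonincreasing.
  set Φ : ℝ → ℝ := fun t => ∫ τ in (0 : ℝ)..t, (a + M * Y τ) with hΦ
  have hcc : Continuous fun τ => a + M * Y τ := by fun_prop
  have hYΦ : ∀ t ∈ Icc 0 T, Y t ≤ Φ t := fun t ht =>
    intervalIntegral.integral_mono_on ht.1 (hfi 0 t) (hcc.intervalIntegrable _ _)
      fun τ hτ => hfY τ ⟨hτ.1, hτ.2.trans ht.2⟩
  have hΦd : ∀ t, HasDerivAt Φ (a + M * Y t) t := fun t =>
    intervalIntegral.integral_hasDerivAt_right (hcc.intervalIntegrable _ _)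
      hcc.stronglyMeasurable.stronglyMeasurableAtFilter hcc.continuousAt
  set Ψ : ℝ → ℝ := fun t => (a + M * Φ t) * Real.exp (-M * t) with hΨ
  have hΨd : ∀ t, HasDerivAt Ψ (M * (Y t - Φ t) * M * Real.exp (-M * t)) t := by
    intro t
    have e1 : HasDerivAt (fun s => Real.exp (-M * s)) (Real.exp (-M * t) * -M) t := by
      simpa using ((hasDerivAt_id t).const_mul (-M)).exp
    refine ((((hΦd t).const_mul M).const_add a).mul e1).congr_deriv ?_
    ring
  have hanti : AntitoneOn Ψ (Icc 0 T) := by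
    refine antitoneOn_of_deriv_nonpos (convex_Icc _ _)
      (fun t _ => (hΨd t).continuousAt.continuousWithinAt)
      (fun t _ => (hΨd t).differentiableAt.differentiableWithinAt) fun t ht => ?_
    rw [interior_Icc] at ht
    rw [(hΨd t).deriv]
    have h1 := hYΦ t (Ioo_subset_Icc_self ht)
    have h2 : 0 ≤ M * (Φ t - Y t) * M * Real.exp (-M * t) := by
      have := sub_nonneg.2 h1
      positivity
    linarith
  have h3 := hanti (left_mem_Icc.2 hT) (right_mem_Icc.2 hT) hT
  have h0 : Ψ 0 = a := by simp [hΨ, hΦ]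
  rw [h0] at h3
  have h4 : a + M * Φ T ≤ a * Real.exp (M * T) := by
    have h5 := mul_le_mul_of_nonneg_right h3 (Real.exp_pos (M * T)).le
    simp only [hΨ] at h5
    rw [mul_assoc, ← Real.exp_add] at h5
    simpa using h5
  have h6 := hfY T (right_mem_Icc.2 hT)
  have h7 := mul_le_mul_of_nonneg_left (hYΦ T (right_mem_Icc.2 hT)) hM
  rw [hf, indicator_of_mem (right_mem_Icc.2 hT)] at h6
  rw [← ENNReal.ofReal_toReal (hlt T (right_mem_Icc.2 hT)).ne]
  exact ENNReal.ofReal_le_ofReal (by linarith)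

/-! ### Averaging over the network variable and the frequency -/

section Model

variable {Ω : Type*} [MeasurableSpace Ω] {μ : Measure Ω}

theorem measurable_regEntropy {L ε : ℝ} {ρ : ℝ → ℝ → Ω → ℝ → ℝ}
    (hρ : Measurable fun z : ℝ × ℝ × Ω × ℝ => ρ z.1 z.2.1 z.2.2.1 z.2.2.2) :
    Measurable fun z : ℝ × Ω × ℝ => regEntropy L ε fun x => ρ z.1 x z.2.1 z.2.2 := by
  have h1 : Measurable fun w : (ℝ × Ω × ℝ) × ℝ => ρ w.1.1 w.2 w.1.2.1 w.1.2.2 :=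
    hρ.comp (by fun_prop : Measurable fun w : (ℝ × Ω × ℝ) × ℝ => (w.1.1, w.2, w.1.2.1, w.1.2.2))
  exact (StronglyMeasurable.integral_prod_right' (f := fun w : (ℝ × Ω × ℝ) × ℝ =>
    (ρ w.1.1 w.2 w.1.2.1 w.1.2.2 + ε) * Real.log ((ρ w.1.1 w.2 w.1.2.1 w.1.2.2 + ε) * L))
    (by fun_prop : Measurable _).stronglyMeasurable).measurable

theorem measurable_fiberEntropy {L : ℝ} {ρ : ℝ → ℝ → Ω → ℝ → ℝ}
    (hρ : Measurable fun z : ℝ × ℝ × Ω × ℝ => ρ z.1 z.2.1 z.2.2.1 z.2.2.2) :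
    Measurable fun z : ℝ × Ω × ℝ => fiberEntropy L (ρ z.1) z.2 := by
  simpa [regEntropy, fiberEntropy] using measurable_regEntropy (L := L) (ε := 0) hρ

theorem measurable_fiberDist {L : ℝ} {ρ : ℝ → ℝ → Ω → ℝ → ℝ}
    (hρ : Measurable fun z : ℝ × ℝ × Ω × ℝ => ρ z.1 z.2.1 z.2.2.1 z.2.2.2) :
    Measurable fun z : ℝ × Ω × ℝ => fiberDist L (ρ z.1) z.2 := by
  have h1 : Measurable fun w : (ℝ × Ω × ℝ) × ℝ => ρ w.1.1 w.2 w.1.2.1 w.1.2.2 :=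
    hρ.comp (by fun_prop : Measurable fun w : (ℝ × Ω × ℝ) × ℝ => (w.1.1, w.2, w.1.2.1, w.1.2.2))
  exact Measurable.lintegral_prod_right' (f := fun w : (ℝ × Ω × ℝ) × ℝ =>
    ‖ρ w.1.1 w.2 w.1.2.1 w.1.2.2 - L⁻¹‖ₑ) (h1.sub measurable_const).enorm

/-- No integrability is needed, since a divergent Bochner integral has value `0`. -/
theorem ofReal_integral_abs_le {α : Type*} [MeasurableSpace α] {ν : Measure α} (f : α → ℝ) :
    ENNReal.ofReal (∫ x, |f x| ∂ν) ≤ ∫⁻ x, ‖f x‖ₑ ∂ν := by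
  by_cases hf : Integrable (fun x => |f x|) ν
  · rw [ofReal_integral_eq_lintegral_ofReal hf (ae_of_all _ fun x => abs_nonneg _)]
    simp only [← ofReal_norm, Real.norm_eq_abs, le_refl]
  · rw [integral_undef hf]; simp

theorem lintegral_exp_lt_top (l t : ℝ) :
    ∫⁻ τ in Ioc 0 t, ENNReal.ofReal (Real.exp (l * τ)) < ⊤ := by
  have hc : Continuous fun τ : ℝ => Real.exp (l * τ) := by fun_prop
  have h1 : IntegrableOn (fun τ : ℝ => Real.exp (l * τ)) (Ioc 0 t) :=
    hc.integrableOn_Icc.mono_set Ioc_subset_Icc_self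
  rw [← ofReal_integral_eq_lintegral_ofReal h1 (ae_of_all _ fun x => (Real.exp_pos _).le)]
  exact ENNReal.ofReal_lt_top

/-- The entropy inequality, integrated in time, for almost all network variables and
frequencies. -/
theorem exp_mul_lintegral_fiberEntropy_le [IsProbabilityMeasure μ] {L κ β : ℝ} (hL : 0 < L)
    (hκ : 0 < κ) (hβ : 0 < β) {g : ℝ → ℝ} [IsProbabilityMeasure (freqMeasure g)]
    {A : Lp ℝ 2 μ →L[ℝ] Lp ℝ 2 μ} (hA : IsGraphop A) {C : ℝ} (hC : 0 ≤ C)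
    {ρ W : ℝ → ℝ → Ω → ℝ → ℝ}
    (hρ : Measurable fun z : ℝ × ℝ × Ω × ℝ => ρ z.1 z.2.1 z.2.2.1 z.2.2.2)
    (hW : IsNetworkImage L g A ρ W)
    (hsol : ∀ᵐ p ∂(μ.prod (freqMeasure g)), IsDensitySolution L β (fun t x => ρ t x p.1 p.2)
      (fun t => κ * C * ∫ q, |W t q.1 p.1 q.2 - A ((memLp_const L⁻¹).toLp _) p.1|
        ∂((torus L).prod (freqMeasure g)))) {t : ℝ} (ht : 0 ≤ t) :
    ENNReal.ofReal (Real.exp (4 * Real.pi ^ 2 / (L ^ 2 * β) * t)) *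
        ∫⁻ p, ENNReal.ofReal (fiberEntropy L (ρ t) p) ∂(μ.prod (freqMeasure g)) ≤
      ∫⁻ p, ENNReal.ofReal (fiberEntropy L (ρ 0) p) ∂(μ.prod (freqMeasure g)) +
        ENNReal.ofReal (κ * C * numericalRadius A) * ∫⁻ τ in Ioc 0 t,
          ENNReal.ofReal (Real.exp (4 * Real.pi ^ 2 / (L ^ 2 * β) * τ)) *
            ∫⁻ p, fiberDist L (ρ τ) p ^ 2 ∂(μ.prod (freqMeasure g)) := by
  set P := μ.prod (freqMeasure g) with hP
  set l := 4 * Real.pi ^ 2 / (L ^ 2 * β) with hl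
  set N : ℝ → ℝ≥0∞ := fun τ => ∫⁻ p, fiberDist L (ρ τ) p ^ 2 ∂P with hN
  set E := ∫⁻ τ in Ioc 0 t, ENNReal.ofReal (Real.exp (l * τ)) with hE
  set b : ℝ → ℝ≥0∞ := fun ε => ENNReal.ofReal (l * ((1 + ε * L) * Real.log (1 + ε * L))) +
    ENNReal.ofReal (κ * C) * ENNReal.ofReal (2 * ‖A‖ * (Real.sqrt ε * ((L + 1) / 2))) with hb
  have hNm : Measurable N :=
    ((measurable_fiberDist hρ).pow_const 2).lintegral_prod_right'
  -- The last bracket collects all the regularization errors; it tends to `0` with `ε`, while the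
  -- rest does not depend on `ε`.
  have key : ∀ ε : ℝ, 0 < ε → ENNReal.ofReal (Real.exp (l * t)) *
        ∫⁻ p, ENNReal.ofReal (fiberEntropy L (ρ t) p) ∂P ≤
      (∫⁻ p, ENNReal.ofReal (fiberEntropy L (ρ 0) p) ∂P +
        ENNReal.ofReal (κ * C * numericalRadius A) * ∫⁻ τ in Ioc 0 t,
          ENNReal.ofReal (Real.exp (l * τ)) * N τ) +
      (ENNReal.ofReal (regError L ε) + ENNReal.ofReal (Real.exp (l * t) * regError L ε)
        + b ε * E) := by
    intro ε hε
    set e := Real.sqrt ε * ((L + 1) / 2) with he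
    have he0 : 0 ≤ e := by positivity
    set G : ℝ × Ω × ℝ → ℝ := fun z => regEntropy L ε fun x => ρ z.1 x z.2.1 z.2.2 with hG
    have hGm : Measurable G := measurable_regEntropy hρ
    -- Joint measurability in `(τ, ξ, ω)` is what permits exchanging the time integral with the
    -- average.
    set Z : ℝ × Ω × ℝ → ℝ≥0∞ := fun z => liminf (fun n : ℕ => ENNReal.ofReal
      (Real.exp (l * z.1) * (((n : ℝ) + 1) * (G (z.1 + 1 / ((n : ℝ) + 1), z.2) - G z)
          + l * G z))) atTop with hZ
    have hZm : Measurable Z := by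
      refine Measurable.liminf fun n => ?_
      have h1 : Measurable fun z : ℝ × Ω × ℝ => G (z.1 + 1 / ((n : ℝ) + 1), z.2) :=
        hGm.comp (by fun_prop)
      fun_prop
    have hfib : ∀ᵐ p ∂P,
        ENNReal.ofReal (Real.exp (l * t)) * ENNReal.ofReal (fiberEntropy L (ρ t) p) ≤
          ENNReal.ofReal (fiberEntropy L (ρ 0) p) + (ENNReal.ofReal (regError L ε) +
            ENNReal.ofReal (Real.exp (l * t) * regError L ε)) + ∫⁻ τ in Ioc 0 t, Z (τ, p) := by
      filter_upwards [hsol] with p hp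
      have h1 := (hp.ofReal_exp_mul_regEntropy_le hL hβ hε ht (Z := fun τ => Z (τ, p))
        (hZm.comp (by fun_prop)) fun τ _ => rfl).1
      have h2 := (abs_le.1 (abs_regEntropy_sub_le hL (hp.continuous_space ht)
        (hp.nonneg t ht) (hp.integral_eq_one t ht) hε)).1
      have h3 := (abs_le.1 (abs_regEntropy_sub_le hL (hp.continuous_space le_rfl)
        (hp.nonneg 0 le_rfl) (hp.integral_eq_one 0 le_rfl) hε)).2
      change -regError L ε ≤ _ - fiberEntropy L (ρ t) p at h2
      change _ - fiberEntropy L (ρ 0) p ≤ regError L ε at h3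
      have h4 : ENNReal.ofReal (Real.exp (l * t)) * ENNReal.ofReal (fiberEntropy L (ρ t) p) ≤
          ENNReal.ofReal (Real.exp (l * t) * regEntropy L ε (fun x => ρ t x p.1 p.2)) +
            ENNReal.ofReal (Real.exp (l * t) * regError L ε) := by
        rw [← ENNReal.ofReal_mul (Real.exp_pos _).le]
        refine le_trans (ENNReal.ofReal_le_ofReal ?_) ENNReal.ofReal_add_le
        rw [← mul_add]
        exact mul_le_mul_of_nonneg_left (by linarith) (Real.exp_pos _).le
      have h5 : ENNReal.ofReal (regEntropy L ε (fun x => ρ 0 x p.1 p.2)) ≤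
          ENNReal.ofReal (fiberEntropy L (ρ 0) p) + ENNReal.ofReal (regError L ε) :=
        (ENNReal.ofReal_le_ofReal (by linarith)).trans ENNReal.ofReal_add_le
      calc _ ≤ _ := h4
        _ ≤ (ENNReal.ofReal (regEntropy L ε (fun x => ρ 0 x p.1 p.2))
              + ∫⁻ τ in Ioc 0 t, Z (τ, p)) + ENNReal.ofReal (Real.exp (l * t) * regError L ε) := by
            gcongr
        _ ≤ (ENNReal.ofReal (fiberEntropy L (ρ 0) p) + ENNReal.ofReal (regError L ε)
              + ∫⁻ τ in Ioc 0 t, Z (τ, p)) + ENNReal.ofReal (Real.exp (l * t) * regError L ε) := by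
            gcongr
        _ = _ := by ring
    -- At a fixed time the fibrewise dissipation bound is averaged, and the graphop estimate applies
    -- with `c = L⁻¹` and error `e`.
    have hslice : ∀ τ ∈ Ioc 0 t, ∫⁻ p, Z (τ, p) ∂P ≤
        ENNReal.ofReal (Real.exp (l * τ)) * (b ε + ENNReal.ofReal (κ * C * numericalRadius A)
          * N τ) := by
      intro τ hτ
      have hR : Measurable fun z : ℝ × Ω × ℝ => ρ τ z.1 z.2.1 z.2.2 :=
        hρ.comp (by fun_prop : Measurable fun z : ℝ × Ω × ℝ => (τ, z.1, z.2.1, z.2.2))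
      have hq2 : ∀ᵐ p ∂P, ∫⁻ x, ‖ρ τ x p.1 p.2 - L⁻¹‖ₑ ∂(torus L) ≤ 2 := by
        filter_upwards [hsol] with p hp
        rw [hp.lintegral_enorm_sub hτ.1.le]
        exact (ENNReal.ofReal_le_ofReal (hp.integral_abs_sub_le_two hL hτ.1.le)).trans_eq (by simp)
      have hint := hA.lintegral_interaction_le hR (hW.aestronglyMeasurable τ hτ.1)
        (hW.isImage τ hτ.1) L⁻¹ hq2 he0
      set s : Ω → ℝ≥0∞ := fun ξ => ∫⁻ q, ‖W τ q.1 ξ q.2 - A ((memLp_const L⁻¹).toLp _) ξ‖ₑ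
        ∂((torus L).prod (freqMeasure g)) with hs
      calc ∫⁻ p, Z (τ, p) ∂P
          ≤ ∫⁻ p, ENNReal.ofReal (Real.exp (l * τ)) *
              (ENNReal.ofReal (l * ((1 + ε * L) * Real.log (1 + ε * L))) +
                ENNReal.ofReal (κ * C) * ((∫⁻ x, ‖ρ τ x p.1 p.2 - L⁻¹‖ₑ ∂(torus L)
                  + ENNReal.ofReal e) * s p.1)) ∂P := by
            refine lintegral_mono_ae ?_
            filter_upwards [hsol] with p hp
            refine ((hp.ofReal_exp_mul_regEntropy_le hL hβ hε ht (Z := fun τ => Z (τ, p))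
              (hZm.comp (by fun_prop)) fun τ _ => rfl).2 τ hτ.1).trans ?_
            refine mul_le_mul' le_rfl (add_le_add le_rfl ?_)
            rw [ENNReal.ofReal_mul (by positivity), mul_assoc]
            refine mul_le_mul' le_rfl ?_
            rw [mul_comm]
            exact mul_le_mul' le_rfl (ofReal_integral_abs_le _)
        _ = ENNReal.ofReal (Real.exp (l * τ)) *
              (ENNReal.ofReal (l * ((1 + ε * L) * Real.log (1 + ε * L))) +
                ENNReal.ofReal (κ * C) * ∫⁻ p, (∫⁻ x, ‖ρ τ x p.1 p.2 - L⁻¹‖ₑ ∂(torus L)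
                  + ENNReal.ofReal e) * s p.1 ∂P) := by
            rw [lintegral_const_mul' _ _ ENNReal.ofReal_ne_top,
              lintegral_add_left measurable_const,
              lintegral_const_mul' _ _ ENNReal.ofReal_ne_top]
            simp [hP]
        _ ≤ ENNReal.ofReal (Real.exp (l * τ)) *
              (ENNReal.ofReal (l * ((1 + ε * L) * Real.log (1 + ε * L))) +
                ENNReal.ofReal (κ * C) * (ENNReal.ofReal (numericalRadius A) * N τ
                  + ENNReal.ofReal (2 * ‖A‖ * e))) := by
            gcongr
            exact hint
        _ = _ := by
            rw [hb, ENNReal.ofReal_mul (by positivity : 0 ≤ κ * C)]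
            simp only
            ring
    have hPm : Measurable fun p : Ω × ℝ => ∫⁻ τ in Ioc 0 t, Z (τ, p) :=
      hZm.lintegral_prod_left'
    calc ENNReal.ofReal (Real.exp (l * t)) * ∫⁻ p, ENNReal.ofReal (fiberEntropy L (ρ t) p) ∂P
        = ∫⁻ p, ENNReal.ofReal (Real.exp (l * t)) *
            ENNReal.ofReal (fiberEntropy L (ρ t) p) ∂P :=
          (lintegral_const_mul' _ _ ENNReal.ofReal_ne_top).symm
      _ ≤ ∫⁻ p, (ENNReal.ofReal (fiberEntropy L (ρ 0) p) + (ENNReal.ofReal (regError L ε) +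
            ENNReal.ofReal (Real.exp (l * t) * regError L ε)) + ∫⁻ τ in Ioc 0 t, Z (τ, p)) ∂P :=
          lintegral_mono_ae hfib
      _ = ∫⁻ p, ENNReal.ofReal (fiberEntropy L (ρ 0) p) ∂P + (ENNReal.ofReal (regError L ε) +
            ENNReal.ofReal (Real.exp (l * t) * regError L ε))
            + ∫⁻ τ in Ioc 0 t, ∫⁻ p, Z (τ, p) ∂P := by
          rw [lintegral_add_right _ hPm, lintegral_add_right _ measurable_const,
            lintegral_lintegral_swap (f := fun τ p => Z (τ, p)) hZm.aemeasurable]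
          simp [hP]
      _ ≤ ∫⁻ p, ENNReal.ofReal (fiberEntropy L (ρ 0) p) ∂P + (ENNReal.ofReal (regError L ε) +
            ENNReal.ofReal (Real.exp (l * t) * regError L ε))
            + ∫⁻ τ in Ioc 0 t, ENNReal.ofReal (Real.exp (l * τ)) *
              (b ε + ENNReal.ofReal (κ * C * numericalRadius A) * N τ) :=
          add_le_add le_rfl (setLIntegral_mono' measurableSet_Ioc hslice)
      _ = _ := by
          have e1 : ∀ τ, ENNReal.ofReal (Real.exp (l * τ)) *
              (b ε + ENNReal.ofReal (κ * C * numericalRadius A) * N τ)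
              = b ε * ENNReal.ofReal (Real.exp (l * τ)) +
                ENNReal.ofReal (κ * C * numericalRadius A) *
                  (ENNReal.ofReal (Real.exp (l * τ)) * N τ) := fun τ => by ring
          simp only [e1]
          have hm1 : Measurable fun τ : ℝ => ENNReal.ofReal (Real.exp (l * τ)) := by fun_prop
          have hm2 : Measurable fun τ => ENNReal.ofReal (Real.exp (l * τ)) * N τ := hm1.mul hNm
          rw [lintegral_add_left (hm1.const_mul _), lintegral_const_mul _ hm1,
            lintegral_const_mul _ hm2]
          ring
  have hEt : E ≠ ⊤ := (lintegral_exp_lt_top l t).ne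
  have hδ := tendsto_regError hL
  have hlim : Tendsto (fun ε => ENNReal.ofReal (regError L ε)
      + ENNReal.ofReal (Real.exp (l * t) * regError L ε) + b ε * E) (𝓝[>] 0) (𝓝 0) := by
    have t1 : Tendsto (fun ε => ENNReal.ofReal (regError L ε)) (𝓝[>] 0) (𝓝 0) := by
      simpa using ENNReal.tendsto_ofReal hδ
    have t2 : Tendsto (fun ε => ENNReal.ofReal (Real.exp (l * t) * regError L ε)) (𝓝[>] 0)
        (𝓝 0) := by
      simpa using ENNReal.tendsto_ofReal (hδ.const_mul (Real.exp (l * t)))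
    have c3 : ContinuousAt (fun ε : ℝ => l * ((1 + ε * L) * Real.log (1 + ε * L))) 0 := by
      refine ContinuousAt.mul continuousAt_const (ContinuousAt.mul (by fun_prop) ?_)
      exact ContinuousAt.log (by fun_prop) (by simp)
    have t3 : Tendsto (fun ε => ENNReal.ofReal (l * ((1 + ε * L) * Real.log (1 + ε * L))))
        (𝓝[>] 0) (𝓝 0) := by
      simpa using ENNReal.tendsto_ofReal (c3.tendsto.mono_left nhdsWithin_le_nhds)
    have c4 : Continuous fun ε : ℝ => 2 * ‖A‖ * (Real.sqrt ε * ((L + 1) / 2)) := by fun_prop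
    have t4 : Tendsto (fun ε => ENNReal.ofReal (2 * ‖A‖ * (Real.sqrt ε * ((L + 1) / 2))))
        (𝓝[>] 0) (𝓝 0) := by
      simpa using ENNReal.tendsto_ofReal ((c4.tendsto 0).mono_left nhdsWithin_le_nhds)
    have t5 : Tendsto b (𝓝[>] 0) (𝓝 0) := by
      have := t3.add (ENNReal.Tendsto.const_mul (a := ENNReal.ofReal (κ * C)) t4
        (Or.inr ENNReal.ofReal_ne_top))
      rwa [mul_zero, add_zero] at this
    simpa using (t1.add t2).add (ENNReal.Tendsto.mul_const t5 (Or.inr hEt))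
  have hlim2 := hlim.const_add (∫⁻ p, ENNReal.ofReal (fiberEntropy L (ρ 0) p) ∂P +
        ENNReal.ofReal (κ * C * numericalRadius A) * ∫⁻ τ in Ioc 0 t,
          ENNReal.ofReal (Real.exp (l * τ)) * N τ)
  rw [add_zero] at hlim2
  refine ge_of_tendsto hlim2 ?_
  filter_upwards [self_mem_nhdsWithin] with ε hε
  exact key ε hε

end Model

/-! ### Decay of the averaged entropy -/

theorem isProbabilityMeasure_freqMeasure {g : ℝ → ℝ} (hg : ∀ ω, 0 ≤ g ω) (hg_int : Integrable g)
    (hg_one : ∫ ω, g ω = 1) : IsProbabilityMeasure (freqMeasure g) := by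
  refine ⟨?_⟩
  rw [freqMeasure, withDensity_apply _ MeasurableSet.univ, Measure.restrict_univ,
    ← ofReal_integral_eq_lintegral_ofReal hg_int (ae_of_all _ hg), hg_one, ENNReal.ofReal_one]

/-- The function `v log (v L)` is at least `-L⁻¹`, from `log x ≥ 1 - 1 / x`, so its negative part is
harmless for integrability. -/
theorem abs_mul_log_mul_le {L v : ℝ} (hL : 0 < L) (hv : 0 ≤ v) :
    |v * Real.log (v * L)| ≤ v * Real.log (v * L) + 2 * L⁻¹ := by
  have h1 : -L⁻¹ ≤ v * Real.log (v * L) := by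
    rcases hv.eq_or_lt with rfl | hv
    · simpa using hL.le
    · have h2 := mul_le_mul_of_nonneg_left (Real.one_sub_inv_le_log_of_pos (mul_pos hv hL)) hv.le
      have h3 : v * (1 - (v * L)⁻¹) = v - L⁻¹ := by field_simp
      linarith
  have h4 : 0 < L⁻¹ := inv_pos.2 hL
  rcases abs_cases (v * Real.log (v * L)) with ⟨h, -⟩ | ⟨h, -⟩ <;> rw [h] <;> linarith

theorem entropyDensity_eq {Ω : Type*} {L : ℝ} (R : ℝ → Ω → ℝ → ℝ) (z : ℝ × Ω × ℝ) :
    entropyDensity L R z = R z.1 z.2.1 z.2.2 * Real.log (R z.1 z.2.1 z.2.2 * L) := by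
  rw [entropyDensity, div_div_eq_mul_div, div_one]

section Model

variable {Ω : Type*} [MeasurableSpace Ω] {μ : Measure Ω}

/-- Integrability over all variables reduces to the fibre entropies, because the integral of the
absolute value over a fibre exceeds its entropy by at most `2`. -/
theorem finiteEntropy_iff [IsProbabilityMeasure μ] {L : ℝ} (hL : 0 < L) {g : ℝ → ℝ}
    [IsProbabilityMeasure (freqMeasure g)] {R : ℝ → Ω → ℝ → ℝ}
    (hR : Measurable fun z : ℝ × Ω × ℝ => R z.1 z.2.1 z.2.2)
    (hc : ∀ᵐ p ∂(μ.prod (freqMeasure g)), Continuous fun x => R x p.1 p.2)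
    (h0 : ∀ᵐ p ∂(μ.prod (freqMeasure g)), ∀ x, 0 ≤ R x p.1 p.2)
    (hE : ∀ᵐ p ∂(μ.prod (freqMeasure g)), 0 ≤ fiberEntropy L R p) :
    FiniteEntropy L μ g R ↔
      ∫⁻ p, ENNReal.ofReal (fiberEntropy L R p) ∂(μ.prod (freqMeasure g)) < ⊤ := by
  have hm : Measurable fun p : Ω × ℝ => fiberEntropy L R p :=
    (measurable_fiberEntropy (ρ := fun _ => R)
      (hR.comp (by fun_prop : Measurable fun z : ℝ × ℝ × Ω × ℝ => z.2))).comp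
      (by fun_prop : Measurable fun p : Ω × ℝ => ((0 : ℝ), p))
  have hFm : Measurable (entropyDensity L R) := by
    have : entropyDensity L R = fun z : ℝ × Ω × ℝ =>
      R z.1 z.2.1 z.2.2 * Real.log (R z.1 z.2.1 z.2.2 * L) := funext fun z => entropyDensity_eq R z
    rw [this]
    fun_prop
  have hfib : ∀ᵐ p ∂(μ.prod (freqMeasure g)),
      Integrable (fun x => entropyDensity L R (x, p)) (torus L) := by
    filter_upwards [hc] with p hp
    simp only [entropyDensity_eq]
    exact ((continuous_mul_log_mul L).comp hp).integrable_torus L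
  have hiff : Integrable (fiberEntropy L R) (μ.prod (freqMeasure g)) ↔
      ∫⁻ p, ENNReal.ofReal (fiberEntropy L R p) ∂(μ.prod (freqMeasure g)) < ⊤ := by
    rw [← hasFiniteIntegral_iff_ofReal hE]
    exact ⟨fun h => h.2, fun h => ⟨hm.aestronglyMeasurable, h⟩⟩
  rw [← hiff]
  constructor
  · intro h
    refine h.integral_prod_right.congr (ae_of_all _ fun p => ?_)
    simp only [entropyDensity_eq]
    rfl
  · intro h
    refine (integrable_prod_iff' hFm.aestronglyMeasurable).2 ⟨hfib, ?_⟩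
    have hsf : SFinite (torus L) := by unfold torus; infer_instance
    have hFn : AEStronglyMeasurable (fun p : Ω × ℝ => ∫ x, ‖entropyDensity L R (x, p)‖ ∂(torus L))
        (μ.prod (freqMeasure g)) :=
      (StronglyMeasurable.integral_prod_left' (μ := torus L)
        hFm.norm.stronglyMeasurable).aestronglyMeasurable
    refine (h.add (integrable_const (2 : ℝ))).mono' hFn ?_
    filter_upwards [hc, h0, hfib] with p h1 h2 h3
    rw [Real.norm_of_nonneg (integral_nonneg fun x => norm_nonneg _)]
    have h4 : Integrable (fun x => R x p.1 p.2 * Real.log (R x p.1 p.2 * L)) (torus L) :=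
      ((continuous_mul_log_mul L).comp h1).integrable_torus L
    calc ∫ x, ‖entropyDensity L R (x, p)‖ ∂(torus L)
        ≤ ∫ x, (R x p.1 p.2 * Real.log (R x p.1 p.2 * L) + 2 * L⁻¹) ∂(torus L) := by
          refine integral_mono h3.norm (h4.add (continuous_const.integrable_torus L)) fun x => ?_
          simp only [entropyDensity_eq, Real.norm_eq_abs]
          exact abs_mul_log_mul_le hL (h2 x)
      _ = fiberEntropy L R p + 2 := by
          rw [integral_add h4 (continuous_const.integrable_torus L), integral_torus_const hL,
            fiberEntropy, mul_left_comm, mul_inv_cancel₀ hL.ne', mul_one]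

theorem FiniteEntropy.ofReal_entropy [IsProbabilityMeasure μ] {L : ℝ} {g : ℝ → ℝ}
    [IsProbabilityMeasure (freqMeasure g)] {R : ℝ → Ω → ℝ → ℝ} (h : FiniteEntropy L μ g R)
    (hE : ∀ᵐ p ∂(μ.prod (freqMeasure g)), 0 ≤ fiberEntropy L R p) :
    0 ≤ entropy L μ g R ∧ ENNReal.ofReal (entropy L μ g R) =
      ∫⁻ p, ENNReal.ofReal (fiberEntropy L R p) ∂(μ.prod (freqMeasure g)) := by
  have e : ∀ p : Ω × ℝ, ∫ x, entropyDensity L R (x, p) ∂(torus L) = fiberEntropy L R p := fun p => by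
    simp only [entropyDensity_eq]
    rfl
  have h1 : Integrable (fiberEntropy L R) (μ.prod (freqMeasure g)) :=
    h.integral_prod_right.congr (ae_of_all _ e)
  have h2 : entropy L μ g R = ∫ p, fiberEntropy L R p ∂(μ.prod (freqMeasure g)) := by
    rw [entropy, integral_prod_symm _ h]
    simp only [e]
  rw [h2]
  exact ⟨integral_nonneg_of_ae hE, ofReal_integral_eq_lintegral_ofReal h1 hE⟩

/-- The classical solution attains its initial datum almost everywhere in all variables. -/
theorem IsClassicalSolution.ae_initial [IsProbabilityMeasure μ] {L κ β : ℝ} {D g : ℝ → ℝ}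
    [IsProbabilityMeasure (freqMeasure g)] {A : Lp ℝ 2 μ →L[ℝ] Lp ℝ 2 μ} {ρ₀ : ℝ → Ω → ℝ → ℝ}
    (hρ₀ : IsAdmissible L μ g ρ₀) {ρ : ℝ → ℝ → Ω → ℝ → ℝ}
    (hρ : IsClassicalSolution L κ β D g A ρ₀ ρ) :
    ∀ᵐ z ∂((torus L).prod (μ.prod (freqMeasure g))),
      ρ 0 z.1 z.2.1 z.2.2 = ρ₀ z.1 z.2.1 z.2.2 := by
  have hsf : SFinite (torus L) := by unfold torus; infer_instance
  -- Passing from fibrewise to joint almost everywhere equality needs a measurable set, hence a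
  -- measurable version of the initial datum.
  obtain ⟨r, hrm, hr⟩ := hρ₀.aestronglyMeasurable
  have h1 : ∀ᵐ w ∂((μ.prod (freqMeasure g)).prod (torus L)),
      ρ₀ w.2 w.1.1 w.1.2 = r (w.2, w.1) :=
    (Measure.measurePreserving_swap (μ := μ.prod (freqMeasure g))
      (ν := torus L)).quasiMeasurePreserving.ae hr
  have h2 : ∀ᵐ p ∂(μ.prod (freqMeasure g)), ∀ᵐ x ∂(torus L), ρ 0 x p.1 p.2 = r (x, p) := by
    filter_upwards [hρ.initial, Measure.ae_ae_of_ae_prod h1] with p hp1 hp2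
    filter_upwards [hp1, hp2] with x hx1 hx2
    exact hx1.trans hx2
  have hm : MeasurableSet {w : (Ω × ℝ) × ℝ | ρ 0 w.2 w.1.1 w.1.2 = r (w.2, w.1)} := by
    refine measurableSet_eq_fun (hρ.measurable.comp (by fun_prop :
      Measurable fun w : (Ω × ℝ) × ℝ => ((0 : ℝ), w.2, w.1.1, w.1.2))) ?_
    exact hrm.measurable.comp measurable_swap
  have h3 := (Measure.ae_prod_mem_iff_ae_ae_mem hm).2 h2
  have h4 : ∀ᵐ z ∂((torus L).prod (μ.prod (freqMeasure g))), ρ 0 z.1 z.2.1 z.2.2 = r z :=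
    (Measure.measurePreserving_swap (μ := torus L)
      (ν := μ.prod (freqMeasure g))).quasiMeasurePreserving.ae h3
  filter_upwards [h4, hr] with z hz1 hz2
  exact hz1.trans hz2.symm

/-- Exponential decay of the averaged entropy, allowing infinite values. -/
theorem lintegral_fiberEntropy_le [IsProbabilityMeasure μ] {L κ β : ℝ} (hL : 0 < L)
    (hκ : 0 < κ) (hβ : 0 < β) {g : ℝ → ℝ} [IsProbabilityMeasure (freqMeasure g)]
    {A : Lp ℝ 2 μ →L[ℝ] Lp ℝ 2 μ} (hA : IsGraphop A) {C : ℝ} (hC : 0 ≤ C)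
    {ρ W : ℝ → ℝ → Ω → ℝ → ℝ}
    (hρ : Measurable fun z : ℝ × ℝ × Ω × ℝ => ρ z.1 z.2.1 z.2.2.1 z.2.2.2)
    (hW : IsNetworkImage L g A ρ W)
    (hsol : ∀ᵐ p ∂(μ.prod (freqMeasure g)), IsDensitySolution L β (fun t x => ρ t x p.1 p.2)
      (fun t => κ * C * ∫ q, |W t q.1 p.1 q.2 - A ((memLp_const L⁻¹).toLp _) p.1|
        ∂((torus L).prod (freqMeasure g)))) {E₀ : ℝ} (hE₀ : 0 ≤ E₀)
    (h0 : ∫⁻ p, ENNReal.ofReal (fiberEntropy L (ρ 0) p) ∂(μ.prod (freqMeasure g))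
      = ENNReal.ofReal E₀) {t : ℝ} (ht : 0 ≤ t) :
    ∫⁻ p, ENNReal.ofReal (fiberEntropy L (ρ t) p) ∂(μ.prod (freqMeasure g)) ≤
      ENNReal.ofReal (Real.exp (-(4 * Real.pi ^ 2 / (L ^ 2 * β)
        - 2 * κ * C * numericalRadius A) * t) * E₀) := by
  set P := μ.prod (freqMeasure g) with hP
  set l := 4 * Real.pi ^ 2 / (L ^ 2 * β) with hl
  have hl0 : 0 ≤ l := by positivity
  have hn := hA.numericalRadius_nonneg
  set H : ℝ → ℝ≥0∞ := fun τ => ∫⁻ p, ENNReal.ofReal (fiberEntropy L (ρ τ) p) ∂P with hH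
  set y : ℝ → ℝ≥0∞ := fun τ => ENNReal.ofReal (Real.exp (l * τ)) * H τ with hy
  have hym : Measurable y := by
    have h1 : Measurable H := (measurable_fiberEntropy hρ).ennreal_ofReal.lintegral_prod_right'
    have h2 : Measurable fun τ : ℝ => ENNReal.ofReal (Real.exp (l * τ)) := by fun_prop
    exact h2.mul h1
  have hint : ∀ τ, 0 ≤ τ → y τ ≤ ENNReal.ofReal E₀ +
      ENNReal.ofReal (κ * C * numericalRadius A) * ∫⁻ σ in Ioc 0 τ,
        ENNReal.ofReal (Real.exp (l * σ)) * ∫⁻ p, fiberDist L (ρ σ) p ^ 2 ∂P := by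
    intro τ hτ
    rw [← h0]
    exact exp_mul_lintegral_fiberEntropy_le hL hκ hβ hA hC hρ hW hsol hτ
  -- Pinsker on each fibre closes the inequality in terms of the entropy.
  have hN2 : ∀ σ, 0 ≤ σ → ∫⁻ p, fiberDist L (ρ σ) p ^ 2 ∂P ≤ 2 * H σ := by
    intro σ hσ
    rw [hH, ← lintegral_const_mul' _ _ (by simp)]
    refine lintegral_mono_ae ?_
    filter_upwards [hsol] with p hp
    have h1 : fiberDist L (ρ σ) p = _ := hp.lintegral_enorm_sub hσ
    rw [h1, ← ENNReal.ofReal_pow (integral_nonneg fun x => abs_nonneg _),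
      ← ENNReal.ofReal_ofNat 2, ← ENNReal.ofReal_mul (by norm_num)]
    exact ENNReal.ofReal_le_ofReal (hp.sq_integral_abs_le hL hσ)
  -- The distance of two probability densities is at most `2`. This bound involves no entropy and
  -- yields finiteness on `[0, t]`, before Grönwall is applied.
  have hN4 : ∀ σ, 0 ≤ σ → ∫⁻ p, fiberDist L (ρ σ) p ^ 2 ∂P ≤ 4 := by
    intro σ hσ
    calc ∫⁻ p, fiberDist L (ρ σ) p ^ 2 ∂P ≤ ∫⁻ _, 4 ∂P := by
          refine lintegral_mono_ae ?_
          filter_upwards [hsol] with p hp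
          have h1 : fiberDist L (ρ σ) p = _ := hp.lintegral_enorm_sub hσ
          rw [h1]
          refine (pow_le_pow_left' (ENNReal.ofReal_le_ofReal
            (hp.integral_abs_sub_le_two hL hσ)) 2).trans_eq ?_
          rw [← ENNReal.ofReal_pow (by norm_num)]
          norm_num
      _ = 4 := by simp [hP]
  set B := ENNReal.ofReal E₀ + ENNReal.ofReal (κ * C * numericalRadius A) *
    ∫⁻ σ in Ioc 0 t, ENNReal.ofReal (Real.exp (l * σ)) * 4 with hB
  have hBt : B ≠ ⊤ := by
    rw [hB, lintegral_mul_const' _ _ (by simp)]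
    exact ENNReal.add_ne_top.2 ⟨ENNReal.ofReal_ne_top, ENNReal.mul_ne_top ENNReal.ofReal_ne_top
      (ENNReal.mul_ne_top (lintegral_exp_lt_top l t).ne (by simp))⟩
  have hG := le_mul_exp_of_le_add_lintegral (y := y) (a := E₀) (b := B.toReal)
    (M := 2 * κ * C * numericalRadius A) (T := t) hym hE₀ (by positivity) ht ?_ ?_
  · have h1 : H t = ENNReal.ofReal (Real.exp (-(l * t))) * y t := by
      rw [hy]
      simp only
      rw [← mul_assoc, ← ENNReal.ofReal_mul (Real.exp_pos _).le, ← Real.exp_add]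
      simp
    change H t ≤ _
    rw [h1]
    refine (mul_le_mul' le_rfl hG).trans_eq ?_
    rw [← ENNReal.ofReal_mul (Real.exp_pos _).le]
    congr 1
    rw [mul_left_comm, ← Real.exp_add, mul_comm]
    congr 2
    ring
  · intro τ hτ
    rw [ENNReal.ofReal_toReal hBt]
    refine (hint τ hτ.1).trans (add_le_add le_rfl (mul_le_mul' le_rfl ?_))
    refine (setLIntegral_mono' measurableSet_Ioc fun σ hσ => ?_).trans
      (lintegral_mono_set (Ioc_subset_Ioc_right hτ.2))
    exact mul_le_mul' le_rfl (hN4 σ hσ.1.le)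
  · intro τ hτ
    refine (hint τ hτ.1).trans (add_le_add le_rfl ?_)
    have h1 : ∫⁻ σ in Ioc 0 τ, ENNReal.ofReal (Real.exp (l * σ)) *
        ∫⁻ p, fiberDist L (ρ σ) p ^ 2 ∂P ≤ 2 * ∫⁻ σ in Ioc 0 τ, y σ := by
      rw [← lintegral_const_mul' _ _ (by simp)]
      refine setLIntegral_mono' measurableSet_Ioc fun σ hσ => ?_
      refine (mul_le_mul' le_rfl (hN2 σ hσ.1.le)).trans_eq ?_
      rw [hy]
      ring
    refine (mul_le_mul' le_rfl h1).trans_eq ?_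
    rw [← mul_assoc, ← ENNReal.ofReal_ofNat 2, ← ENNReal.ofReal_mul (by positivity)]
    congr 2
    ring

end Model

end SakaguchiKuramoto

/-! ### Exponential stability of the uniform state -/

theorem mainTheorem5
    {Ω : Type*} [MeasurableSpace Ω] (μ : MeasureTheory.Measure Ω)
    [MeasureTheory.IsProbabilityMeasure μ]
    (L κ β : ℝ) (hL : 0 < L) (hκ : 0 < κ) (hβ : 0 < β)
    (D : ℝ → ℝ) (hD : SakaguchiKuramoto.MemSobolev L 2 ⊤ D)
    (g : ℝ → ℝ) (hg : ∀ ω, 0 ≤ g ω) (hg_int : MeasureTheory.Integrable g)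
    (hg_one : ∫ ω, g ω = 1)
    (A : MeasureTheory.Lp ℝ 2 μ →L[ℝ] MeasureTheory.Lp ℝ 2 μ)
    (hA : SakaguchiKuramoto.IsGraphop A)
    (ρ₀ : ℝ → Ω → ℝ → ℝ) (hρ₀ : SakaguchiKuramoto.IsAdmissible L μ g ρ₀)
    (hH₀ : SakaguchiKuramoto.FiniteEntropy L μ g ρ₀)
    -- `κ < 2π² / (L² β ‖∂ₓₓ D‖_∞ n(A))`, read as no condition if the denominator vanishes
    (hκ_lt : κ * (L ^ 2 * β * SakaguchiKuramoto.supNorm L (SakaguchiKuramoto.weakDeriv L 2 D)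
      * SakaguchiKuramoto.numericalRadius A) < 2 * Real.pi ^ 2)
    (ρ : ℝ → ℝ → Ω → ℝ → ℝ)
    (hρ : SakaguchiKuramoto.IsClassicalSolution L κ β D g A ρ₀ ρ) :
    0 < 4 * Real.pi ^ 2 / (L ^ 2 * β)
        - 2 * κ * SakaguchiKuramoto.supNorm L (SakaguchiKuramoto.weakDeriv L 2 D)
          * SakaguchiKuramoto.numericalRadius A ∧
    ∀ t, 0 ≤ t →
      SakaguchiKuramoto.FiniteEntropy L μ g (ρ t) ∧
      SakaguchiKuramoto.entropy L μ g (ρ t) ≤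
        Real.exp (-(4 * Real.pi ^ 2 / (L ^ 2 * β)
          - 2 * κ * SakaguchiKuramoto.supNorm L (SakaguchiKuramoto.weakDeriv L 2 D)
            * SakaguchiKuramoto.numericalRadius A) * t)
          * SakaguchiKuramoto.entropy L μ g ρ₀ := by
  have hprob := SakaguchiKuramoto.isProbabilityMeasure_freqMeasure hg hg_int hg_one
  have hC : 0 ≤ SakaguchiKuramoto.supNorm L (SakaguchiKuramoto.weakDeriv L 2 D) :=
    ENNReal.toReal_nonneg
  refine ⟨?_, fun t ht => ?_⟩
  · rw [sub_pos, lt_div_iff₀ (by positivity)]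
    linarith
  obtain ⟨W, hW, heq⟩ := hρ.equation
  -- The subtracted constant is the image under `A` of the uniform density; it depends on `ξ` alone.
  have hsol := SakaguchiKuramoto.ae_isDensitySolution hL hκ hβ hD hρ₀ hρ hW heq
    (c := fun ξ => A ((memLp_const L⁻¹).toLp _) ξ)
  have hm : ∀ s, Measurable fun z : ℝ × Ω × ℝ => ρ s z.1 z.2.1 z.2.2 := fun s =>
    hρ.measurable.comp (by fun_prop : Measurable fun z : ℝ × Ω × ℝ => (s, z.1, z.2.1, z.2.2))
  have hpos : ∀ s, 0 ≤ s → ∀ᵐ p ∂(μ.prod (SakaguchiKuramoto.freqMeasure g)),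
      0 ≤ SakaguchiKuramoto.fiberEntropy L (ρ s) p := fun s hs => by
    filter_upwards [hsol] with p hp
    exact hp.integral_mul_log_nonneg hL hs
  have hae : SakaguchiKuramoto.entropyDensity L (ρ 0) =ᵐ[(SakaguchiKuramoto.torus L).prod
      (μ.prod (SakaguchiKuramoto.freqMeasure g))] SakaguchiKuramoto.entropyDensity L ρ₀ := by
    filter_upwards [hρ.ae_initial hρ₀] with z hz
    rw [SakaguchiKuramoto.entropyDensity, SakaguchiKuramoto.entropyDensity, hz]
  have hfin : SakaguchiKuramoto.FiniteEntropy L μ g (ρ 0) := (integrable_congr hae).2 hH₀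
  have hent : SakaguchiKuramoto.entropy L μ g (ρ 0) = SakaguchiKuramoto.entropy L μ g ρ₀ :=
    integral_congr_ae hae
  obtain ⟨h1, h2⟩ := hfin.ofReal_entropy (hpos 0 le_rfl)
  have h3 := SakaguchiKuramoto.lintegral_fiberEntropy_le hL hκ hβ hA hC hρ.measurable hW hsol h1
    h2.symm ht
  -- Finiteness is a consequence of the decay estimate in `[0, ∞]`, and only afterwards can the
  -- estimate be read in `ℝ`.
  have h4 : SakaguchiKuramoto.FiniteEntropy L μ g (ρ t) := by
    refine (SakaguchiKuramoto.finiteEntropy_iff hL (hm t) ?_ ?_ (hpos t ht)).2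
      (h3.trans_lt ENNReal.ofReal_lt_top)
    · filter_upwards [hsol] with p hp
      exact hp.continuous_space ht
    · filter_upwards [hsol] with p hp
      exact hp.nonneg t ht
  refine ⟨h4, ?_⟩
  rw [← (h4.ofReal_entropy (hpos t ht)).2, hent] at h3
  exact (ENNReal.ofReal_le_ofReal_iff (mul_nonneg (Real.exp_pos _).le (hent ▸ h1))).1 h3
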